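/- \textbf{Theorem.} First-Last-CCAV! logspace many-one reduces to Exact Perfect Bipartite $b$-Matching for Multigraphs; that is, there is a function $f$ on strings that is computable by a deterministic Turing machine in logarithmic space (read-only input tape, write-only output tape, $O(\log n)$ work tape cells on inputs of length $n$) such that a string $w$ encodes a yes-instance of the first problem if and only if $f(w)$ encodes a yes-instance of the second. The two problems are as follows. \emph{First-Last-CCAV!} (exact constructive control by adding voters). An instance consists of a finite set $C$ of candidates, a preferred candidate $p \in C$, a finite collection $V$ of registered voters and a finite collection $W$ of unregistered voters, each voter having a total-order vote over $C$, and an integer $k \ge 0$. The question is whether there is $W' \subseteq W$ with exactly $k$ voters such that $p$ is a First-Last winner of the election $(C, V \cup W')$. Under First-Last every voter gives $1$ point to the candidate ranked first, $-1$ point to the candidate ranked last and $0$ points to every other candidate (scoring vector $\langle 1, 0, \dots, 0, -1\rangle$), and the winners are the candidates of maximum total score. \emph{Exact Perfect Bipartite $b$-Matching for Multigraphs.} An instance consists of a bipartite multigraph $G = (V, E)$, a capacity function $b : V \to \mathbb{N}$, a set $R \subseteq E$ of red edges and an integer $k \ge 0$. The question is whether there is a set of edges $E' \subseteq E$, exactly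 $k$ of which are red, such that each $v \in V$ is incident with exactly $b(v)$ edges in $E'$. In the encodings, candidates and vertices are listed (their number enters the length of the string in unary), every voter and every edge is listed individually, and $k$ and the values of $b$ are written in binary. -/

import Mathlib

/-! ## Logspace transducers and logspace many-one reductions -/

/-- What the head of the input tape sees: the left end marker, an input symbol, or the right
end marker. -/
inductive InputCell (α : Type) : Type
  | leftEnd : InputCell α
  | sym (a : α) : InputCell α
  | rightEnd : InputCell α

/-- Head movements. -/
inductive HeadMove : Type
  | left : HeadMove
  | stay : HeadMove
  | right : HeadMove

/-- A deterministic multi-tape Turing machine that computes a function from strings over `α` to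
strings over `β`. It has a two-way read-only input tape with end markers, `tapes` many read-write
work tapes, and a write-only output tape. The value `none` of `trans` means that the machine
halts; otherwise `trans` gives the new state, the movement of the input head, for every work tape
the symbol written and the movement of the head, and the symbol (if any) that is appended to the
output. -/
structure Transducer (α β : Type) [Finite α] [Finite β] where
  State : Type
  [finState : Finite State]
  WorkSym : Type
  [finWorkSym : Finite WorkSym]
  tapes : ℕ
  start : State
  blank : WorkSym
  trans : State → InputCell α → (Fin tapes → WorkSym) →
    Option (State × HeadMove × (Fin tapes → WorkSym × HeadMove) × Option β)

namespace Transducer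

variable {α β : Type} [Finite α] [Finite β]

/-- A configuration: the work tapes are infinite to the right, with cells `0, 1, 2, …`. -/
structure Config (M : Transducer α β) where
  state : M.State
  inputHead : ℕ
  tape : Fin M.tapes → ℕ → M.WorkSym
  head : Fin M.tapes → ℕ
  output : List β

/-- Cell `0` of the input tape holds the left end marker, cells `1, …, x.length` hold the input
`x`, and cell `x.length + 1` holds the right end marker. -/
def inputCell (x : List α) : ℕ → InputCell α
  | 0 => InputCell.leftEnd
  | i + 1 =>
    match x[i]? with
    | some a => InputCell.sym a
    | none => InputCell.rightEnd

/-- Moving a head on a tape that is infinite to the right; a head on cell `0` cannot go left. -/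
def moveHead (i : ℕ) : HeadMove → ℕ
  | HeadMove.left => i - 1
  | HeadMove.stay => i
  | HeadMove.right => i + 1

/-- All tapes blank, all heads on cell `0`, nothing written on the output tape. -/
def init (M : Transducer α β) : M.Config where
  state := M.start
  inputHead := 0
  tape := fun _ _ => M.blank
  head := fun _ => 0
  output := []

/-- One step on input `x`. The input head cannot go beyond the end markers. -/
def step (M : Transducer α β) (x : List α) (c : M.Config) : Option M.Config :=
  match M.trans c.state (inputCell x c.inputHead) (fun i => c.tape i (c.head i)) with
  | none => none
  | some (q, d, w, o) =>
    some
      { state := q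
        inputHead := min (moveHead c.inputHead d) (x.length + 1)
        tape := fun i => Function.update (c.tape i) (c.head i) (w i).1
        head := fun i => moveHead (c.head i) (w i).2
        output := c.output ++ o.toList }

/-- The configuration `c` occurs in the run on input `x`. -/
def Visits (M : Transducer α β) (x : List α) (c : M.Config) : Prop :=
  StateTransition.Reaches (M.step x) M.init c

/-- On input `x` the machine halts with output `y`. -/
def Outputs (M : Transducer α β) (x : List α) (y : List β) : Prop :=
  ∃ c : M.Config, M.Visits x c ∧ M.step x c = none ∧ c.output = y

/-- On input `x`, only the first `s` cells of each work tape are ever visited. -/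
def UsesSpaceAtMost (M : Transducer α β) (x : List α) (s : ℕ) : Prop :=
  ∀ c : M.Config, M.Visits x c → ∀ i, c.head i < s

end Transducer

/-- `f` is computable in logarithmic space: some transducer halts on every input `x` with output
`f x`, and visits `O(log |x|)` work tape cells. -/
def LogspaceComputable {α β : Type} [Finite α] [Finite β] (f : List α → List β) : Prop :=
  ∃ M : Transducer α β,
    (∀ x, M.Outputs x (f x)) ∧
    ∃ c : ℕ, ∀ x, M.UsesSpaceAtMost x (c * (Nat.log 2 x.length + 1))

/-- Logspace many-one reducibility of languages. -/
def LogspaceManyOneReduces {α β : Type} [Finite α] [Finite β]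
    (A : Language α) (B : Language β) : Prop :=
  ∃ f : List α → List β, LogspaceComputable f ∧ ∀ x, x ∈ A ↔ f x ∈ B

/-! ## Strings that encode instances -/

/-- The alphabet of the encodings: `some false` and `some true` are the bits `0` and `1`, and
`none` is a delimiter. -/
abbrev CodeSym : Type := Option Bool

/-- Binary notation, least significant bit first and without superfluous zeros, followed by a
delimiter. -/
def encodeBinary (n : ℕ) : List CodeSym := n.bits.map some ++ [none]

/-- Unary notation, followed by a delimiter. -/
def encodeUnary (n : ℕ) : List CodeSym := List.replicate n (some true) ++ [none]

/-! ## Elections and control by adding voters -/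

/-- A total-order vote over the candidates `0, …, m - 1`: `v i` is the candidate in position `i`,
and position `0` is the most preferred one. -/
abbrev Vote (m : ℕ) : Type := Equiv.Perm (Fin m)

/-- A voting rule maps an election, with candidates `0, …, m - 1` and a list of voters, each given
by a vote, to the set of winners. -/
abbrev VotingRule : Type := (m : ℕ) → List (Vote m) → Set (Fin m)

/-- The score of candidate `c` under the scoring vector `α`, where `α i` is what a voter gives to
the candidate in position `i`. -/
def score {m : ℕ} (α : Fin m → ℤ) (voters : List (Vote m)) (c : Fin m) : ℤ :=
  (voters.map fun v => α (v.symm c)).sum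

/-- The voting rule of a family of scoring vectors: the candidates of maximum score win. -/
def scoringRule (α : (m : ℕ) → Fin m → ℤ) : VotingRule :=
  fun m voters => {c | ∀ d, score (α m) voters d ≤ score (α m) voters c}

/-- The scoring vector `⟨1, 0, …, 0, -1⟩` (for a single candidate, where any vector gives the same
winner, it is `⟨0⟩`). -/
def firstLastVector (m : ℕ) (i : Fin m) : ℤ :=
  (if i.val = 0 then 1 else 0) - (if i.val + 1 = m then 1 else 0)

/-- The voting rule First-Last. -/
def firstLast : VotingRule := scoringRule firstLastVector

/-- An instance of (exact) constructive control by adding voters. Different voters may cast the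
same vote, so collections of voters are lists of votes. -/
structure CCAVInstance where
  /-- the number of candidates -/
  m : ℕ
  /-- the preferred candidate -/
  p : Fin m
  registered : List (Vote m)
  unregistered : List (Vote m)
  k : ℕ

namespace CCAVInstance

/-- The question of exact control by adding voters: can one choose exactly `k` of the unregistered
voters (a sublist, that is, a choice of positions in the list) such that adding them makes `p` a
winner? -/
def ExactControl (rule : VotingRule) (I : CCAVInstance) : Prop :=
  ∃ added : List (Vote I.m), added.Sublist I.unregistered ∧ added.length = I.k ∧
    I.p ∈ rule I.m (I.registered ++ added)

/-- A vote is encoded by its candidates in order of preference. -/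
def encodeVote {m : ℕ} (v : Vote m) : List CodeSym :=
  (List.ofFn v).flatMap fun c => encodeBinary c.val

/-- The numbers of candidates, registered voters and unregistered voters in unary, then `p` and
`k` in binary, then all the votes. -/
def encode (I : CCAVInstance) : List CodeSym :=
  encodeUnary I.m ++ encodeUnary I.registered.length ++ encodeUnary I.unregistered.length ++
    encodeBinary I.p.val ++ encodeBinary I.k ++
    I.registered.flatMap encodeVote ++ I.unregistered.flatMap encodeVote

end CCAVInstance

/-- CCAV! for a voting rule, as a language. -/
def ccavExact (rule : VotingRule) : Language CodeSym :=
  {w | ∃ I : CCAVInstance, I.encode = w ∧ I.ExactControl rule}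

/-! ## Exact perfect bipartite b-matching for multigraphs -/

/-- An edge between the vertices `fst` and `snd` (in no particular direction), red or not. -/
structure ColoredEdge (n : ℕ) where
  fst : Fin n
  snd : Fin n
  red : Bool

/-- The edge `e` is incident with the vertex `v`. -/
def ColoredEdge.Incident {n : ℕ} (v : Fin n) (e : ColoredEdge n) : Prop :=
  e.fst = v ∨ e.snd = v

instance {n : ℕ} (v : Fin n) : DecidablePred (ColoredEdge.Incident v) :=
  fun _ => inferInstanceAs (Decidable (_ ∨ _))

/-- An instance of the matching problem: a bipartite multigraph on the vertices `0, …, n - 1`, with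
a list of edges in which parallel edges may occur, capacities `b`, red edges, and a number `k`. -/
structure BMatchingInstance where
  /-- the number of vertices -/
  n : ℕ
  edges : List (ColoredEdge n)
  bipartite : ∃ side : Fin n → Bool, ∀ e ∈ edges, side e.fst ≠ side e.snd
  b : Fin n → ℕ
  k : ℕ

namespace BMatchingInstance

/-- Is there a set of edges (a sublist, that is, a choice of positions in the list of edges),
exactly `k` of which are red, such that each vertex `v` is incident with exactly `b v` of them? -/
def HasExactPerfectBMatching (G : BMatchingInstance) : Prop :=
  ∃ E' : List (ColoredEdge G.n), E'.Sublist G.edges ∧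
    E'.countP (fun e => e.red) = G.k ∧
    ∀ v, E'.countP (fun e => decide (ColoredEdge.Incident v e)) = G.b v

/-- An edge is encoded by its endpoints and its color (`1` for red, `0` for not red). -/
def encodeEdge {n : ℕ} (e : ColoredEdge n) : List CodeSym :=
  encodeBinary e.fst.val ++ encodeBinary e.snd.val ++ encodeBinary e.red.toNat

/-- The number of vertices in unary, then `k` and the capacities in binary, then the edges. -/
def encode (G : BMatchingInstance) : List CodeSym :=
  encodeUnary G.n ++ encodeBinary G.k ++
    (List.ofFn G.b).flatMap encodeBinary ++ G.edges.flatMap encodeEdge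

end BMatchingInstance

/-- Exact Perfect Bipartite b-Matching for Multigraphs, as a language. -/
def exactPerfectBipartiteBMatching : Language CodeSym :=
  {w | ∃ G : BMatchingInstance, G.encode = w ∧ G.HasExactPerfectBMatching}

/-! Under First-Last a score is the number of first places minus the number of last places. An
unregistered voter therefore matters only through its pair (first, last) and becomes a red edge from
a "plus" vertex of the one candidate to a "minus" vertex of the other; choosing `k` voters is
choosing `k` red edges.

The final score of `p` need not be guessed. Exchanging an added voter that does not rank `p` first
for one that does raises the score of `p` and raises no other score by more; the same holds for
exchanging a voter that ranks `p` last for one that does not. So if `p` can win, it can win with the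
most first places and the fewest last places at once (`exists_optimal_choice`), and its score `S` is
then read off from counts (`bestScore`). All scores sum to zero, so a winner has `S ≥ 0`.

Let `N` be the number of all voters. For every candidate `c`, `N` parallel non-red edges join its
plus and minus vertices, and further non-red edges lead from plus to a sink, except for `c = p`. The
capacities are `N + S` minus the registered first places at plus, and `N` minus the registered last
places at minus. Subtracting the two degree equations of `c` cancels the parallel edges and leaves:
score of `c` equals `S` minus the number of chosen sink edges at `c`. So perfect matchings are the
choices where `p` scores exactly `S` and nobody more; the sink has degree `m * S` because scores sum
to zero. This is `exactControl_iff`.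

For space, programs are built from single actions by sequence, branching and loops, with one counter
per work tape. `LogNat` collects the functions with polynomially bounded values that such programs
compute. It is closed under substitution and polynomially bounded primitive recursion, and the
running time is irrelevant, so arithmetic may be done by counting. The input is read as a sequence
of delimited tokens; the reduction prints the multigraph if the string is a valid encoding with
enough voters and `S ≥ 0`, and otherwise the empty string, which encodes nothing. Numbers read from
the input are clipped at its length, since `k` may be exponentially large; a `k` that is really
clipped exceeds the number of unregistered voters and is rejected. -/

/-! ## Program fragments -/

/-- The symbols of the work tapes: a digit or a blank, and a mark. -/
abbrev WorkCell : Type := Option Bool × Bool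

/-- What one step does: the movement of the input head, the symbol written on the current work
tape, the movement of its head, and the output. -/
structure StepAction (β : Type) where
  move : HeadMove
  write : WorkCell
  workMove : HeadMove
  out : Option β

/-- A piece of a transducer whose work tapes are indexed by `ℕ`. Every state reads and writes one
work tape, and the next state `none` leaves the fragment. -/
structure Frag (α β : Type) where
  Q : Type
  [fin : Finite Q]
  start : Q
  tape : Q → ℕ
  trans : Q → InputCell α → WorkCell → Option Q × StepAction β

/-- The contents of all tapes and the positions of the heads. -/
structure Memory (β : Type) where
  inputHead : ℕ
  tape : ℕ → ℕ → WorkCell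
  head : ℕ → ℕ
  output : List β

namespace Frag

open Transducer

variable {α β : Type}

/-- The effect of an action on the work tape `r`. -/
def act (x : List α) (r : ℕ) (a : StepAction β) (c : Memory β) : Memory β where
  inputHead := min (moveHead c.inputHead a.move) (x.length + 1)
  tape := Function.update c.tape r (Function.update (c.tape r) (c.head r) a.write)
  head := Function.update c.head r (moveHead (c.head r) a.workMove)
  output := c.output ++ a.out.toList

/-- The transition in state `q` and memory `c`. -/
def next (F : Frag α β) (x : List α) (q : F.Q) (c : Memory β) : Option F.Q × StepAction β :=
  F.trans q (inputCell x c.inputHead) (c.tape (F.tape q) (c.head (F.tape q)))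

/-- The fragment runs from state `q` and memory `c` until it is left with memory `c'`, and all work
heads stay on the first `L` cells. -/
inductive Run (F : Frag α β) (x : List α) (L : ℕ) : Option F.Q → Memory β → Memory β → Prop
  | done (c : Memory β) (h : ∀ r, c.head r < L) : Run F x L none c c
  | step (q : F.Q) (c c' : Memory β) (h : ∀ r, c.head r < L)
      (hr : Run F x L (F.next x q c).1 (act x (F.tape q) (F.next x q c).2 c) c') :
      Run F x L (some q) c c'

theorem Run.of_step {F : Frag α β} {x : List α} {L : ℕ} {q : F.Q} {c c' : Memory β}
    (h : ∀ r, c.head r < L) {q' : Option F.Q} {a : StepAction β} (hn : F.next x q c = (q', a))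
    {c₁ : Memory β} (hc : act x (F.tape q) a c = c₁) (hr : Run F x L q' c₁ c') :
    Run F x L (some q) c c' := by
  refine Run.step q c c' h ?_
  rw [hn, hc]
  exact hr

theorem Run.head_lt {F : Frag α β} {x : List α} {L : ℕ} {q : Option F.Q} {c c' : Memory β}
    (h : Run F x L q c c') : ∀ r, c.head r < L := by
  cases h <;> assumption

/-- The action that changes nothing when the symbol `w` is read. -/
def idle (w : WorkCell) : StepAction β := ⟨HeadMove.stay, w, HeadMove.stay, none⟩

/-- Tests are steps of the machine that write back what they read. The hypothesis makes the clamping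
of the input head at the right end marker harmless. -/
theorem act_idle (x : List α) (r : ℕ) (c : Memory β) (h : c.inputHead ≤ x.length + 1) :
    act x r (idle (c.tape r (c.head r))) c = c := by
  cases c
  simp only [act, idle, moveHead, Function.update_eq_self, Option.toList_none, List.append_nil]
  simpa using h

/-- A single action that may depend on the symbol read from tape `r`. -/
def atom (r : ℕ) (f : WorkCell → StepAction β) : Frag α β where
  Q := Unit
  start := ()
  tape := fun _ => r
  trans := fun _ _ w => (none, f w)

/-- One fragment after the other. -/
def seq (F G : Frag α β) : Frag α β where
  Q := F.Q ⊕ G.Q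
  fin := by have := F.fin; have := G.fin; infer_instance
  start := Sum.inl F.start
  tape := Sum.elim F.tape G.tape
  trans := fun q i w =>
    match q with
    | Sum.inl q => (some (((F.trans q i w).1).elim (Sum.inr G.start) Sum.inl), (F.trans q i w).2)
    | Sum.inr q => ((G.trans q i w).1.map Sum.inr, (G.trans q i w).2)

/-- A test on the input symbol and the symbol on tape `r`. -/
abbrev Test (α : Type) : Type := InputCell α → WorkCell → Bool

/-- `F` if the test on tape `r` succeeds, otherwise `G`. -/
def ite (r : ℕ) (t : Test α) (F G : Frag α β) : Frag α β where
  Q := Option (F.Q ⊕ G.Q)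
  fin := by have := F.fin; have := G.fin; infer_instance
  start := none
  tape := fun q => q.elim r (Sum.elim F.tape G.tape)
  trans := fun q i w =>
    match q with
    | none => (some (some (if t i w then Sum.inl F.start else Sum.inr G.start)), idle w)
    | some (Sum.inl q) => ((F.trans q i w).1.map fun q => some (Sum.inl q), (F.trans q i w).2)
    | some (Sum.inr q) => ((G.trans q i w).1.map fun q => some (Sum.inr q), (G.trans q i w).2)

/-- Repeat `F` as long as the test on tape `r` succeeds. -/
def loop (r : ℕ) (t : Test α) (F : Frag α β) : Frag α β where
  Q := Option F.Q
  fin := by have := F.fin; infer_instance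
  start := none
  tape := fun q => q.elim r F.tape
  trans := fun q i w =>
    match q with
    | none => (if t i w then some (some F.start) else none, idle w)
    | some q => (some (F.trans q i w).1, (F.trans q i w).2)

/-- The outcome of a test in memory `c`. -/
def testVal (x : List α) (r : ℕ) (t : Test α) (c : Memory β) : Bool :=
  t (inputCell x c.inputHead) (c.tape r (c.head r))

/-! ### Runs of compound fragments -/

section

variable {F G : Frag α β} {x : List α} {L : ℕ} {c c₁ c' : Memory β}

theorem run_atom {r : ℕ} {f : WorkCell → StepAction β} (h : ∀ r, c.head r < L)
    (hc : act x r (f (c.tape r (c.head r))) c = c') (h' : ∀ r, c'.head r < L) :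
    Run (atom r f : Frag α β) x L (some (atom r f : Frag α β).start) c c' :=
  Run.of_step (F := atom r f) h rfl hc (Run.done _ h')

theorem run_seq_right {q : Option G.Q} (h : Run G x L q c c') :
    Run (seq F G) x L (q.map Sum.inr) c c' := by
  induction h with
  | done c h => exact Run.done c h
  | step q c c' h _ ih => exact Run.step (F := seq F G) (Sum.inr q) c c' h ih

/-- The exit of `F` is redirected to the start of `G`, so induction along the run of `F` ends where
the run of `G` is spliced in. -/
theorem run_seq_left {q : Option F.Q} (h : Run F x L q c c₁)
    (h' : Run G x L (some G.start) c₁ c') :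
    Run (seq F G) x L (some (q.elim (Sum.inr G.start) Sum.inl)) c c' := by
  induction h with
  | done c h => exact run_seq_right h'
  | step q c c' h _ ih => exact Run.step (F := seq F G) (Sum.inl q) c _ h (ih h')

theorem run_seq (h : Run F x L (some F.start) c c₁) (h' : Run G x L (some G.start) c₁ c') :
    Run (seq F G) x L (some (seq F G).start) c c' :=
  run_seq_left h h'

theorem run_ite_left {r : ℕ} {t : Test α} {q : Option F.Q} (h : Run F x L q c c') :
    Run (ite r t F G) x L (q.map fun q => some (Sum.inl q)) c c' := by
  induction h with
  | done c h => exact Run.done c h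
  | step q c c' h _ ih => exact Run.step (F := ite r t F G) (some (Sum.inl q)) c c' h ih

theorem run_ite_right {r : ℕ} {t : Test α} {q : Option G.Q} (h : Run G x L q c c') :
    Run (ite r t F G) x L (q.map fun q => some (Sum.inr q)) c c' := by
  induction h with
  | done c h => exact Run.done c h
  | step q c c' h _ ih => exact Run.step (F := ite r t F G) (some (Sum.inr q)) c c' h ih

theorem run_ite_true {r : ℕ} {t : Test α} (hi : c.inputHead ≤ x.length + 1)
    (ht : testVal x r t c = true) (h : Run F x L (some F.start) c c') :
    Run (ite r t F G) x L (some (ite r t F G).start) c c' := by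
  refine Run.of_step (F := ite r t F G) (q := none) h.head_lt (q' := some (some (Sum.inl F.start)))
    (a := idle (c.tape r (c.head r))) ?_ (act_idle x r c hi) (run_ite_left h)
  simp only [testVal] at ht
  simp [next, ite, ht]

theorem run_ite_false {r : ℕ} {t : Test α} (hi : c.inputHead ≤ x.length + 1)
    (ht : testVal x r t c = false) (h : Run G x L (some G.start) c c') :
    Run (ite r t F G) x L (some (ite r t F G).start) c c' := by
  refine Run.of_step (F := ite r t F G) (q := none) h.head_lt (q' := some (some (Sum.inr G.start)))
    (a := idle (c.tape r (c.head r))) ?_ (act_idle x r c hi) (run_ite_right h)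
  simp only [testVal] at ht
  simp [next, ite, ht]

theorem run_loop_body {r : ℕ} {t : Test α} {q : Option F.Q} (h : Run F x L q c c₁)
    (h' : Run (loop r t F) x L (some none) c₁ c') :
    Run (loop r t F) x L (some q) c c' := by
  induction h with
  | done c h => exact h'
  | step q c c' h _ ih => exact Run.step (F := loop r t F) (some q) c _ h (ih h')

theorem run_loop_true {r : ℕ} {t : Test α} (hi : c.inputHead ≤ x.length + 1)
    (ht : testVal x r t c = true) (h : Run F x L (some F.start) c c₁)
    (h' : Run (loop r t F) x L (some (loop r t F).start) c₁ c') :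
    Run (loop r t F) x L (some (loop r t F).start) c c' := by
  refine Run.of_step (F := loop r t F) (q := none) h.head_lt (q' := some (some F.start))
    (a := idle (c.tape r (c.head r))) ?_ (act_idle x r c hi) (run_loop_body h h')
  simp only [testVal] at ht
  simp [next, loop, ht]

theorem run_loop_false {r : ℕ} {t : Test α} (hi : c.inputHead ≤ x.length + 1)
    (ht : testVal x r t c = false) (h : ∀ r, c.head r < L) :
    Run (loop r t F) x L (some (loop r t F).start) c c := by
  refine Run.of_step (F := loop r t F) (q := none) h (q' := none)
    (a := idle (c.tape r (c.head r))) ?_ (act_idle x r c hi) (Run.done c h)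
  simp only [testVal] at ht
  simp [next, loop, ht]

end

/-! ### The transducer of a fragment -/

/-- Each of the finitely many states names one tape, so indexing tapes by `ℕ` in fragments costs
nothing: a machine with a fixed number of tapes suffices. -/
theorem exists_tape_lt (F : Frag α β) : ∃ t, ∀ q, F.tape q < t := by
  have := F.fin
  obtain ⟨t, ht⟩ := (Set.finite_range F.tape).bddAbove
  exact ⟨t + 1, fun q => Nat.lt_succ_of_le (ht ⟨q, rfl⟩)⟩

variable [Finite α] [Finite β]

/-- The transducer with `t` work tapes that runs the fragment and then halts. -/
def toTransducer (F : Frag α β) (t : ℕ) (ht : ∀ q, F.tape q < t) : Transducer α β where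
  State := Option F.Q
  finState := by have := F.fin; infer_instance
  WorkSym := WorkCell
  tapes := t
  start := some F.start
  blank := (none, false)
  trans := fun q i w =>
    match q with
    | none => none
    | some q =>
      let o := F.trans q i (w ⟨F.tape q, ht q⟩)
      some (o.1, o.2.move,
        fun j => if j.val = F.tape q then (o.2.write, o.2.workMove) else (w j, HeadMove.stay),
        o.2.out)

/-- The configuration with state `q` and memory `c`. -/
def toConfig (F : Frag α β) (t : ℕ) (ht : ∀ q, F.tape q < t) (q : Option F.Q) (c : Memory β) :
    (F.toTransducer t ht).Config where
  state := q
  inputHead := c.inputHead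
  tape := fun (j : Fin t) => c.tape j.val
  head := fun (j : Fin t) => c.head j.val
  output := c.output

theorem step_toConfig_none (F : Frag α β) (t : ℕ) (ht : ∀ q, F.tape q < t) (x : List α)
    (c : Memory β) : (F.toTransducer t ht).step x (F.toConfig t ht none c) = none := rfl

theorem step_toConfig_some (F : Frag α β) (t : ℕ) (ht : ∀ q, F.tape q < t) (x : List α)
    (q : F.Q) (c : Memory β) :
    (F.toTransducer t ht).step x (F.toConfig t ht (some q) c) =
      some (F.toConfig t ht (F.next x q c).1 (act x (F.tape q) (F.next x q c).2 c)) := by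
  simp only [step, toConfig, toTransducer, next, act, Option.some.injEq, Config.mk.injEq,
    true_and, and_true]
  constructor
  · funext j
    by_cases h : j.val = F.tape q
    · simp [h]
    · simp [h]
  · funext j
    by_cases h : j.val = F.tape q
    · simp [h]
    · simp [h, moveHead]

theorem Run.reaches {F : Frag α β} {t : ℕ} (ht : ∀ q, F.tape q < t) {x : List α} {L : ℕ}
    {q : Option F.Q} {c c' : Memory β} (h : Run F x L q c c') :
    StateTransition.Reaches ((F.toTransducer t ht).step x) (F.toConfig t ht q c)
      (F.toConfig t ht none c') := by
  induction h with
  | done c h => exact Relation.ReflTransGen.refl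
  | step q c c' h _ ih =>
    exact Relation.ReflTransGen.head (by rw [step_toConfig_some]; rfl) ih

/-- The machine is deterministic, so every reachable configuration lies on the one halting run, and
the space bound recorded along `Run` applies to it. -/
theorem Run.head_lt_of_reaches {F : Frag α β} {t : ℕ} (ht : ∀ q, F.tape q < t) {x : List α}
    {L : ℕ} {q : Option F.Q} {c c' : Memory β} (h : Run F x L q c c')
    (d : (F.toTransducer t ht).Config)
    (hd : StateTransition.Reaches ((F.toTransducer t ht).step x) (F.toConfig t ht q c) d) :
    ∀ i, d.head i < L := by
  induction h with
  | done c h =>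
    rcases Relation.ReflTransGen.cases_head hd with rfl | ⟨e, he, _⟩
    · exact fun i => h _
    · rw [step_toConfig_none] at he
      simp at he
  | step q c c' h _ ih =>
    rcases Relation.ReflTransGen.cases_head hd with rfl | ⟨e, he, hed⟩
    · exact fun i => h _
    · rw [step_toConfig_some, Option.mem_some_iff] at he
      subst he
      exact ih hed

/-- The memory at the start of a computation. -/
def blankMemory : Memory β := ⟨0, fun _ _ => (none, false), fun _ => 0, []⟩

theorem logspaceComputable_of_run (F : Frag α β) (f : List α → List β) (a : ℕ)
    (h : ∀ x : List α, ∃ L ≤ a * (Nat.log 2 x.length + 1), ∃ c : Memory β,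
      Run F x L (some F.start) blankMemory c ∧ c.output = f x) :
    LogspaceComputable f := by
  obtain ⟨t, ht⟩ := F.exists_tape_lt
  refine ⟨F.toTransducer t ht, fun x => ?_, a, fun x d hd i => ?_⟩
  · obtain ⟨L, -, c, hr, ho⟩ := h x
    exact ⟨_, hr.reaches ht, step_toConfig_none F t ht x c, ho⟩
  · obtain ⟨L, hL, c, hr, -⟩ := h x
    exact (hr.head_lt_of_reaches ht d hd i).trans_le hL

end Frag

/-! ## Numbers on work tapes -/

/-- Addition of one in bijective binary notation, least significant digit first; `false` is the
digit `1` and `true` is the digit `2`. -/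
def incDigits : List Bool → List Bool
  | [] => [false]
  | false :: l => true :: l
  | true :: l => false :: incDigits l

/-- Subtraction of one in bijective binary notation. -/
def decDigits : List Bool → List Bool
  | [] => []
  | true :: l => false :: l
  | [false] => []
  | false :: b :: l => true :: decDigits (b :: l)

theorem incDigits_ne_nil (l : List Bool) : incDigits l ≠ [] := by
  rcases l with _ | ⟨_ | _, l⟩ <;> simp [incDigits]

/-- A carry leaves a digit `1` in front of a nonempty word, which is exactly where `decDigits`
borrows; on the one-digit word `[false]` it erases instead. -/
theorem decDigits_incDigits (l : List Bool) : decDigits (incDigits l) = l := by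
  induction l with
  | nil => rfl
  | cons b l ih =>
    cases b
    · rfl
    · rcases h : incDigits l with _ | ⟨b, l'⟩
      · exact absurd h (incDigits_ne_nil l)
      · rw [incDigits, h, decDigits, ← h, ih]

/-- Bijective binary notation. -/
def digits (n : ℕ) : List Bool := incDigits^[n] []

theorem digits_zero : digits 0 = [] := rfl

theorem digits_succ (n : ℕ) : digits (n + 1) = incDigits (digits n) :=
  Function.iterate_succ_apply' _ _ _

theorem digits_eq_nil_iff {n : ℕ} : digits n = [] ↔ n = 0 := by
  cases n with
  | zero => simp [digits_zero]
  | succ n => simp [digits_succ, incDigits_ne_nil]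

theorem decDigits_digits (n : ℕ) : decDigits (digits n) = digits (n - 1) := by
  cases n with
  | zero => rfl
  | succ n => rw [digits_succ, decDigits_incDigits, Nat.add_sub_cancel]

/-- The number with given digits. -/
def digitsVal (l : List Bool) : ℕ := l.foldr (fun b n => 2 * n + 1 + b.toNat) 0

theorem digitsVal_incDigits (l : List Bool) : digitsVal (incDigits l) = digitsVal l + 1 := by
  induction l with
  | nil => rfl
  | cons b l ih =>
    cases b
    · simp [digitsVal, incDigits]
    · simp only [digitsVal, incDigits, List.foldr_cons, Bool.toNat_false, Bool.toNat_true] at ih ⊢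
      omega

theorem digitsVal_digits (n : ℕ) : digitsVal (digits n) = n := by
  induction n with
  | zero => rfl
  | succ n ih => rw [digits_succ, digitsVal_incDigits, ih]

/-- Every bijective digit is at least `1`, so a word of length `n` has value at least `1 + 2 + ⋯ + 2
^ (n - 1)`. -/
theorem two_pow_length_le (l : List Bool) : 2 ^ l.length ≤ digitsVal l + 1 := by
  induction l with
  | nil => simp [digitsVal]
  | cons b l ih =>
    simp only [digitsVal, List.length_cons, List.foldr_cons, pow_succ] at ih ⊢
    omega

theorem length_digits_lt {n L : ℕ} (h : n + 1 < 2 ^ L) : (digits n).length < L := by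
  have := two_pow_length_le (digits n)
  rw [digitsVal_digits] at this
  exact (Nat.pow_lt_pow_iff_right (by norm_num)).1 (this.trans_lt h)

/-- The tape with content `l`. -/
def digitTape (l : List Bool) (j : ℕ) : WorkCell := (l[j]?, false)

/-- The memory where register `r` holds `s r`, all heads of work tapes are on cell `0`, the input
head is on cell `i`, and the output is `o`. -/
def regMemory {β : Type} (s : ℕ → ℕ) (i : ℕ) (o : List β) : Memory β :=
  ⟨i, fun r => digitTape (digits (s r)), fun _ => 0, o⟩

/-- The state in which tape `r` has content `T` and its head is on cell `h`, and everything else is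
as in `c`. -/
def Memory.setTape {β : Type} (c : Memory β) (r : ℕ) (T : ℕ → WorkCell) (h : ℕ) : Memory β :=
  ⟨c.inputHead, Function.update c.tape r T, Function.update c.head r h, c.output⟩

/-! ### Counting up and down on a work tape -/

namespace Frag

open Transducer

variable {α β : Type}

/-- The fragment transforms the registers `s`, the position `i` of the input head and the output `o`
to `s'`, `i'`, `o'`. -/
def Exec (F : Frag α β) (x : List α) (L : ℕ) (s : ℕ → ℕ) (i : ℕ) (o : List β)
    (s' : ℕ → ℕ) (i' : ℕ) (o' : List β) : Prop :=
  i ≤ x.length + 1 → 0 < L → Run F x L (some F.start) (regMemory s i o) (regMemory s' i' o') ∧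
    i' ≤ x.length + 1

theorem act_setTape (x : List α) (r : ℕ) (c : Memory β) (T : ℕ → WorkCell) (h : ℕ) (w : WorkCell)
    (m : HeadMove) (hi : c.inputHead ≤ x.length + 1) :
    act x r ⟨HeadMove.stay, w, m, none⟩ (c.setTape r T h) =
      c.setTape r (Function.update T h w) (moveHead h m) := by
  simp [act, Memory.setTape, moveHead, hi]

theorem setTape_regMemory (s : ℕ → ℕ) (i : ℕ) (o : List β) (r n : ℕ) :
    (regMemory s i o).setTape r (digitTape (digits n)) 0 =
      regMemory (Function.update s r n) i o := by
  simp only [Memory.setTape, regMemory, Memory.mk.injEq, true_and, and_true]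
  constructor
  · funext j
    by_cases h : j = r
    · subst h; simp
    · simp [h]
  · simp

theorem setTape_regMemory_self (s : ℕ → ℕ) (i : ℕ) (o : List β) (r : ℕ) :
    (regMemory s i o).setTape r (digitTape (digits (s r))) 0 = regMemory s i o := by
  rw [setTape_regMemory, Function.update_eq_self]

/-- The states of the fragments that count up or down. -/
inductive CountState : Type
  | first
  | carry
  | erase
  | back

instance : Finite CountState :=
  Finite.of_surjective
    (fun i : Fin 4 => match i with
      | 0 => CountState.first | 1 => CountState.carry | 2 => CountState.erase
      | 3 => CountState.back)
    (by rintro (_ | _ | _ | _); exacts [⟨0, rfl⟩, ⟨1, rfl⟩, ⟨2, rfl⟩, ⟨3, rfl⟩])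

/-- Write a symbol on the work tape and move its head. -/
def put (d : Option Bool) (mark : Bool) (m : HeadMove) : StepAction β :=
  ⟨HeadMove.stay, (d, mark), m, none⟩

/-- Add one to register `r`. -/
def inc (r : ℕ) : Frag α β where
  Q := CountState
  start := CountState.first
  tape := fun _ => r
  trans := fun q _ w =>
    match q, w with
    | CountState.first, (none, _) => (none, put (some false) false HeadMove.stay)
    | CountState.first, (some false, _) => (none, put (some true) false HeadMove.stay)
    | CountState.first, (some true, _) =>
      (some CountState.carry, put (some false) true HeadMove.right)
    | CountState.carry, (none, _) => (some CountState.back, put (some false) false HeadMove.left)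
    | CountState.carry, (some false, _) =>
      (some CountState.back, put (some true) false HeadMove.left)
    | CountState.carry, (some true, _) =>
      (some CountState.carry, put (some false) false HeadMove.right)
    | CountState.erase, (d, m) => (none, put d m HeadMove.stay)
    | CountState.back, (d, true) => (none, put d false HeadMove.stay)
    | CountState.back, (d, false) => (some CountState.back, put d false HeadMove.left)

/-- Subtract one from register `r`. -/
def dec (r : ℕ) : Frag α β where
  Q := CountState
  start := CountState.first
  tape := fun _ => r
  trans := fun q _ w =>
    match q, w with
    | CountState.first, (none, m) => (none, put none m HeadMove.stay)
    | CountState.first, (some true, _) => (none, put (some false) false HeadMove.stay)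
    | CountState.first, (some false, _) =>
      (some CountState.carry, put (some true) true HeadMove.right)
    | CountState.carry, (none, _) => (some CountState.erase, put none false HeadMove.left)
    | CountState.carry, (some true, _) =>
      (some CountState.back, put (some false) false HeadMove.left)
    | CountState.carry, (some false, _) =>
      (some CountState.carry, put (some true) false HeadMove.right)
    | CountState.erase, (_, true) => (none, put none false HeadMove.stay)
    | CountState.erase, (_, false) => (some CountState.back, put none false HeadMove.left)
    | CountState.back, (d, true) => (none, put d false HeadMove.stay)
    | CountState.back, (d, false) => (some CountState.back, put d false HeadMove.left)

section

variable {x : List α} {L r : ℕ} {c c' : Memory β}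

theorem setTape_head_lt (hc : ∀ r, c.head r < L) {T : ℕ → WorkCell} {h : ℕ} (hh : h < L) :
    ∀ j, (c.setTape r T h).head j < L := by
  intro j
  by_cases hj : j = r
  · subst hj; simpa [Memory.setTape] using hh
  · simpa [Memory.setTape, hj] using hc j

/-- One step of a fragment on tape `r`. -/
theorem Run.put_step {F : Frag α β} {q : F.Q} {T : ℕ → WorkCell} {h : ℕ}
    (hi : c.inputHead ≤ x.length + 1) (hc : ∀ r, c.head r < L) (hr : F.tape q = r) (hh : h < L)
    (w : WorkCell) (hw : T h = w) {q' : Option F.Q} {d : Option Bool} {mk : Bool} {m : HeadMove}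
    (hF : ∀ i, F.trans q i w = (q', put d mk m))
    (h' : Run F x L q' (c.setTape r (Function.update T h (d, mk)) (moveHead h m)) c') :
    Run F x L (some q) (c.setTape r T h) c' := by
  refine Run.of_step (setTape_head_lt hc hh) (a := put d mk m) ?_ ?_ h'
  · rw [← hF (inputCell x (c.setTape r T h).inputHead), next]
    subst hr
    simp [Memory.setTape, hw]
  · subst hr
    exact act_setTape x _ c T h _ m hi

/-- A fragment that, in its state `q`, walks back to the marked cell and unmarks it. -/
def WalksBack (F : Frag α β) (r : ℕ) (q : F.Q) : Prop :=
  F.tape q = r ∧ (∀ i d, F.trans q i (d, true) = (none, put d false HeadMove.stay)) ∧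
    ∀ i d, F.trans q i (d, false) = (some q, put d false HeadMove.left)

/-- A head cannot sense that it is on cell `0`, so that cell carries a mark while the head is away,
and the mark stops the way back. -/
theorem WalksBack.run {F : Frag α β} {q : F.Q} (hF : WalksBack F r q)
    (hi : c.inputHead ≤ x.length + 1) (hc : ∀ r, c.head r < L) (l : ℕ → Option Bool) (h : ℕ)
    (hh : h < L) :
    Run F x L (some q) (c.setTape r (fun j => (l j, decide (j = 0))) h)
      (c.setTape r (fun j => (l j, false)) 0) := by
  induction h with
  | zero =>
    refine Run.put_step hi hc hF.1 hh (l 0, true) (by simp) (fun i => hF.2.1 i _) ?_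
    have : Function.update (fun j => (l j, decide (j = 0))) 0 (l 0, false) =
        fun j => (l j, false) := by
      funext j
      by_cases hj : j = 0
      · subst hj; simp
      · simp [hj]
    rw [this]
    exact Run.done _ (setTape_head_lt hc hh)
  | succ h ih =>
    refine Run.put_step hi hc hF.1 hh (l (h + 1), false) (by simp) (fun i => hF.2.2 i _) ?_
    rw [Function.update_eq_self_iff.2 (by simp)]
    exact ih (by omega)

/-- The tape whose first cells hold `p`, followed by `l`, with a mark on cell `0`. -/
def markedTape (p l : List Bool) (j : ℕ) : WorkCell := ((p ++ l)[j]?, decide (j = 0))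

theorem update_markedTape {p l : List Bool} (hp : p ≠ []) (b b' : Bool) :
    Function.update (markedTape p (b :: l)) p.length (some b', false) =
      markedTape p (b' :: l) := by
  funext j
  have hp' : p.length ≠ 0 := by simpa using hp
  by_cases hj : j = p.length
  · subst hj
    simp [markedTape, hp]
  · rw [Function.update_of_ne hj]
    simp only [markedTape, Prod.mk.injEq, and_true]
    rcases Nat.lt_or_gt_of_ne hj with h | h
    · rw [List.getElem?_append_left h, List.getElem?_append_left h]
    · rw [List.getElem?_append_right h.le, List.getElem?_append_right h.le]
      obtain ⟨k, hk⟩ : ∃ k, j - p.length = k + 1 := ⟨j - p.length - 1, by omega⟩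
      rw [hk, List.getElem?_cons_succ, List.getElem?_cons_succ]

theorem update_markedTape_nil {p : List Bool} (hp : p ≠ []) (b : Bool) :
    Function.update (markedTape p []) p.length (some b, false) = markedTape p [b] := by
  funext j
  have hp' : p.length ≠ 0 := by simpa using hp
  by_cases hj : j = p.length
  · subst hj
    simp [markedTape, hp]
  · rw [Function.update_of_ne hj]
    simp only [markedTape, Prod.mk.injEq, and_true, List.append_nil]
    rcases Nat.lt_or_gt_of_ne hj with h | h
    · rw [List.getElem?_append_left h]
    · rw [List.getElem?_eq_none h.le, List.getElem?_eq_none (by simp; omega)]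

theorem update_markedTape_concat {p : List Bool} (hp : p ≠ []) (b : Bool) :
    Function.update (markedTape (p ++ [b]) []) p.length (none, false) = markedTape p [] := by
  funext j
  have hp' : p.length ≠ 0 := by simpa using hp
  by_cases hj : j = p.length
  · subst hj
    simp [markedTape, hp]
  · rw [Function.update_of_ne hj]
    simp only [markedTape, Prod.mk.injEq, and_true, List.append_nil]
    rcases Nat.lt_or_gt_of_ne hj with h | h
    · rw [List.getElem?_append_left h]
    · rw [List.getElem?_eq_none h.le, List.getElem?_eq_none (by simp; omega)]

theorem markedTape_append (p q l : List Bool) :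
    markedTape (p ++ q) l = markedTape p (q ++ l) := by
  funext j
  simp [markedTape]

theorem markedTape_length (p l : List Bool) (hp : p ≠ []) :
    markedTape p l p.length = (l.head?, false) := by
  have hp' : p.length ≠ 0 := by simpa using hp
  cases l <;> simp [markedTape, hp]

theorem WalksBack.run_markedTape {F : Frag α β} {q : F.Q} (hF : WalksBack F r q)
    (hi : c.inputHead ≤ x.length + 1) (hc : ∀ r, c.head r < L) (p l : List Bool) (h : ℕ)
    (hh : h < L) :
    Run F x L (some q) (c.setTape r (markedTape p l) h) (c.setTape r (digitTape (p ++ l)) 0) :=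
  hF.run hi hc (fun j => (p ++ l)[j]?) h hh

theorem walksBack_inc (r : ℕ) : WalksBack (inc r : Frag α β) r CountState.back :=
  ⟨rfl, fun _ _ => rfl, fun _ _ => rfl⟩

theorem walksBack_dec (r : ℕ) : WalksBack (dec r : Frag α β) r CountState.back :=
  ⟨rfl, fun _ _ => rfl, fun _ _ => rfl⟩

/-- Loop invariant: `p` is the part already rewritten, with the mark on cell `0`, and a carry is
pending into `l`. -/
theorem run_inc_carry (hi : c.inputHead ≤ x.length + 1) (hc : ∀ r, c.head r < L)
    (l p : List Bool) (hp : p ≠ []) (hL : p.length + l.length < L) :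
    Run (inc r : Frag α β) x L (some CountState.carry) (c.setTape r (markedTape p l) p.length)
      (c.setTape r (digitTape (p ++ incDigits l)) 0) := by
  induction l generalizing p with
  | nil =>
    refine Run.put_step (F := inc r) hi hc rfl (by simpa using hL) (none, false)
      (by rw [markedTape_length _ _ hp]; rfl) (fun _ => rfl) ?_
    rw [update_markedTape_nil hp]
    exact (walksBack_inc r).run_markedTape hi hc _ _ _ (by simp [moveHead] at hL ⊢; omega)
  | cons b l ih =>
    simp only [List.length_cons] at hL
    cases b
    · refine Run.put_step (F := inc r) hi hc rfl (by omega) (some false, false)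
        (by rw [markedTape_length _ _ hp]; rfl) (fun _ => rfl) ?_
      rw [update_markedTape hp]
      exact (walksBack_inc r).run_markedTape hi hc _ _ _ (by simp [moveHead]; omega)
    · refine Run.put_step (F := inc r) hi hc rfl (by omega) (some true, false)
        (by rw [markedTape_length _ _ hp]; rfl) (fun _ => rfl) ?_
      rw [update_markedTape hp]
      have := ih (p ++ [false]) (by simp) (by simp; omega)
      rw [markedTape_append] at this
      simp only [incDigits, List.append_assoc, List.singleton_append, List.length_append,
        List.length_singleton] at this ⊢
      exact this

/-- Each digit `1` is rewritten as `2` before it is known whether anything can be borrowed from the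
right. The last such digit is the `true` after `p`; if the word ends there, it was the leading digit
and has to be erased. -/
theorem run_dec_carry (hi : c.inputHead ≤ x.length + 1) (hc : ∀ r, c.head r < L)
    (l p : List Bool) (hL : p.length + 1 + l.length < L) :
    Run (dec r : Frag α β) x L (some CountState.carry)
      (c.setTape r (markedTape (p ++ [true]) l) (p.length + 1))
      (c.setTape r (digitTape (p ++ decDigits (false :: l))) 0) := by
  induction l generalizing p with
  | nil =>
    simp only [List.length_nil] at hL
    have hm := markedTape_length (p ++ [true]) [] (by simp)
    rw [List.length_append, List.length_singleton] at hm
    refine Run.put_step (F := dec r) hi hc rfl hL (none, false) hm (fun _ => rfl) ?_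
    rw [Function.update_eq_self_iff.2 hm.symm]
    have hd : p ++ decDigits [false] = p ++ [] := rfl
    rw [hd]
    by_cases hp : p = []
    -- The digit to erase is the marked cell `0` itself, so erasing and unmarking happen in one step
    -- and there is no way back to walk.
    · subst hp
      refine Run.put_step (F := dec r) hi hc rfl (by simp [moveHead]; omega) (some true, true)
        (by simp [markedTape, moveHead]) (fun _ => rfl) ?_
      have : Function.update (markedTape ([] ++ [true]) []) 0 (none, false) = digitTape [] := by
        funext j
        cases j <;> simp [markedTape, digitTape]
      simp only [moveHead, List.length_nil, zero_add, Nat.sub_self, this, List.append_nil]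
      exact Run.done _ (setTape_head_lt hc (by omega))
    · have hp' : p.length ≠ 0 := by simpa using hp
      refine Run.put_step (F := dec r) hi hc rfl (by simp [moveHead]; omega) (some true, false)
        (by simp [markedTape, moveHead, hp]) (fun _ => rfl) ?_
      simp only [moveHead, Nat.add_sub_cancel]
      rw [update_markedTape_concat hp]
      exact (walksBack_dec r).run_markedTape hi hc _ _ _ (by omega)
  | cons b l ih =>
    simp only [List.length_cons] at hL
    have hp : p ++ [true] ≠ [] := by simp
    have hl : (p ++ [true]).length = p.length + 1 := by simp
    rw [← hl]
    cases b
    · refine Run.put_step (F := dec r) hi hc rfl (by omega) (some false, false)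
        (by rw [markedTape_length _ _ hp]; rfl) (fun _ => rfl) ?_
      rw [update_markedTape hp]
      have := ih (p ++ [true]) (by simp; omega)
      rw [markedTape_append] at this
      simp only [decDigits, List.append_assoc, List.cons_append,
        List.nil_append, List.length_append, List.length_singleton] at this ⊢
      exact this
    · refine Run.put_step (F := dec r) hi hc rfl (by omega) (some true, false)
        (by rw [markedTape_length _ _ hp]; rfl) (fun _ => rfl) ?_
      rw [update_markedTape hp]
      have := (walksBack_dec r).run_markedTape hi hc (p ++ [true]) (false :: l) p.length (by omega)
      simp only [decDigits, List.append_assoc, List.cons_append,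
        List.nil_append, List.length_append, List.length_singleton] at this ⊢
      exact this

theorem update_digitTape_first (b b' : Bool) (l : List Bool) (m : Bool) :
    Function.update (digitTape (b :: l)) 0 (some b', m) =
      fun j => ((b' :: l)[j]?, m && decide (j = 0)) := by
  funext j
  cases j <;> simp [digitTape]

theorem run_inc (hi : c.inputHead ≤ x.length + 1) (hc : ∀ r, c.head r < L) (l : List Bool)
    (hL : l.length < L) :
    Run (inc r : Frag α β) x L (some CountState.first) (c.setTape r (digitTape l) 0)
      (c.setTape r (digitTape (incDigits l)) 0) := by
  rcases l with _ | ⟨_ | _, l⟩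
  · refine Run.put_step (F := inc r) hi hc rfl hL (none, false) rfl (fun _ => rfl) ?_
    have : Function.update (digitTape []) 0 (some false, false) = digitTape [false] := by
      funext j
      cases j <;> simp [digitTape]
    rw [this]
    exact Run.done _ (setTape_head_lt hc hL)
  · refine Run.put_step (F := inc r) hi hc rfl (by omega) (some false, false) rfl (fun _ => rfl) ?_
    rw [update_digitTape_first]
    simp only [Bool.false_and]
    exact Run.done _ (setTape_head_lt hc (by simp [moveHead]; omega))
  · refine Run.put_step (F := inc r) hi hc rfl (by omega) (some true, false) rfl (fun _ => rfl) ?_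
    rw [update_digitTape_first]
    simp only [Bool.true_and]
    exact run_inc_carry hi hc l [false] (by simp) (by simpa [add_comm] using hL)

theorem run_dec (hi : c.inputHead ≤ x.length + 1) (hc : ∀ r, c.head r < L) (l : List Bool)
    (hL : l.length < L) :
    Run (dec r : Frag α β) x L (some CountState.first) (c.setTape r (digitTape l) 0)
      (c.setTape r (digitTape (decDigits l)) 0) := by
  rcases l with _ | ⟨_ | _, l⟩
  · refine Run.put_step (F := dec r) hi hc rfl hL (none, false) rfl (fun _ => rfl) ?_
    have : Function.update (digitTape []) 0 (none, false) = digitTape [] :=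
      Function.update_eq_self 0 (digitTape [])
    rw [this]
    exact Run.done _ (setTape_head_lt hc hL)
  · refine Run.put_step (F := dec r) hi hc rfl (by omega) (some false, false) rfl (fun _ => rfl) ?_
    rw [update_digitTape_first]
    simp only [Bool.true_and]
    exact run_dec_carry hi hc l [] (by simpa [add_comm] using hL)
  · refine Run.put_step (F := dec r) hi hc rfl (by omega) (some true, false) rfl (fun _ => rfl) ?_
    rw [update_digitTape_first]
    simp only [Bool.false_and]
    exact Run.done _ (setTape_head_lt hc (by simp [moveHead]; omega))

end

end Frag

/-! ### The effect of fragments on registers -/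

namespace Frag

open Transducer

variable {α β : Type}

section

variable {F G : Frag α β} {x : List α} {L : ℕ} {s s' s'' : ℕ → ℕ} {i i' i'' : ℕ} {o o' o'' : List β}

theorem Exec.congr (h : Exec F x L s i o s' i' o') (hs : s' = s'') : Exec F x L s i o s'' i' o' :=
  hs ▸ h

theorem exec_seq (h : Exec F x L s i o s' i' o') (h' : Exec G x L s' i' o' s'' i'' o'') :
    Exec (seq F G) x L s i o s'' i'' o'' := fun hi hL =>
  have h₁ := h hi hL
  have h₂ := h' h₁.2 hL
  ⟨run_seq h₁.1 h₂.1, h₂.2⟩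

theorem exec_inc {r : ℕ} (h : s r + 1 < 2 ^ L) :
    Exec (inc r) x L s i o (Function.update s r (s r + 1)) i o := by
  intro hi hL
  have := run_inc (r := r) (c := regMemory s i o) hi (fun _ => hL) _ (length_digits_lt h)
  rw [setTape_regMemory_self, ← digits_succ, setTape_regMemory] at this
  exact ⟨this, hi⟩

theorem exec_dec {r : ℕ} (h : s r + 1 < 2 ^ L) :
    Exec (dec r) x L s i o (Function.update s r (s r - 1)) i o := by
  intro hi hL
  have := run_dec (r := r) (c := regMemory s i o) hi (fun _ => hL) _ (length_digits_lt h)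
  rw [setTape_regMemory_self, decDigits_digits, setTape_regMemory] at this
  exact ⟨this, hi⟩

/-- The test whether a register is not zero. -/
def nonzero : Test α := fun _ w => w.1.isSome

/-- Zero is the only number with no digits in bijective notation, so looking at cell `0` decides the
question. -/
theorem testVal_nonzero (r : ℕ) :
    testVal x r nonzero (regMemory s i o) = decide (s r ≠ 0) := by
  rw [Bool.eq_iff_iff, decide_eq_true_iff, ← not_iff_not, not_not, ← digits_eq_nil_iff]
  cases h : digits (s r) <;> simp [testVal, nonzero, regMemory, digitTape, h]

theorem exec_ite_nonzero {r : ℕ} (h : s r ≠ 0 → Exec F x L s i o s' i' o')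
    (h' : s r = 0 → Exec G x L s i o s' i' o') :
    Exec (ite r nonzero F G) x L s i o s' i' o' := by
  intro hi hL
  by_cases hr : s r = 0
  · exact ⟨run_ite_false hi (by simp [testVal_nonzero, hr]) (h' hr hi hL).1, (h' hr hi hL).2⟩
  · exact ⟨run_ite_true hi (by simp [testVal_nonzero, hr]) (h hr hi hL).1, (h hr hi hL).2⟩

theorem exec_ite_input {p : InputCell α → Bool} {r : ℕ}
    (h : p (inputCell x i) = true → Exec F x L s i o s' i' o')
    (h' : p (inputCell x i) = false → Exec G x L s i o s' i' o') :
    Exec (ite r (fun c _ => p c) F G) x L s i o s' i' o' := by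
  intro hi hL
  cases hr : p (inputCell x i)
  · exact ⟨run_ite_false hi hr (h' hr hi hL).1, (h' hr hi hL).2⟩
  · exact ⟨run_ite_true hi hr (h hr hi hL).1, (h hr hi hL).2⟩

/-- A loop that is executed `n` times. -/
theorem exec_loop {r : ℕ} {t : Test α} (n : ℕ) (S : ℕ → ℕ → ℕ) (I : ℕ → ℕ) (O : ℕ → List β)
    (ht : ∀ j ≤ n, testVal x r t (regMemory (S j) (I j) (O j)) = decide (j < n))
    (h : ∀ j < n, Exec F x L (S j) (I j) (O j) (S (j + 1)) (I (j + 1)) (O (j + 1))) :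
    Exec (loop r t F) x L (S 0) (I 0) (O 0) (S n) (I n) (O n) := by
  -- Induction on the number `k` of iterations that remain, since a run of the loop is assembled
  -- from its end.
  suffices H : ∀ k j, j + k = n →
      Exec (loop r t F) x L (S j) (I j) (O j) (S n) (I n) (O n) from H n 0 (zero_add n)
  intro k
  induction k with
  | zero =>
    rintro j rfl hi hL
    have := ht j le_rfl
    simp only [add_zero, lt_irrefl, decide_false] at this
    exact ⟨run_loop_false hi this fun _ => hL, hi⟩
  | succ k ih =>
    intro j hj hi hL
    have h₁ := h j (by omega) hi hL
    have h₂ := ih (j + 1) (by omega) h₁.2 hL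
    have := ht j (by omega)
    rw [decide_eq_true (by omega)] at this
    exact ⟨run_loop_true hi this h₁.1 h₂.1, h₂.2⟩

/-- A loop that counts register `r` down to zero. -/
theorem exec_loop_nonzero {r : ℕ} (n : ℕ) (S : ℕ → ℕ → ℕ) (I : ℕ → ℕ) (O : ℕ → List β)
    (ht : ∀ j ≤ n, S j r = n - j)
    (h : ∀ j < n, Exec F x L (S j) (I j) (O j) (S (j + 1)) (I (j + 1)) (O (j + 1))) :
    Exec (loop r nonzero F) x L (S 0) (I 0) (O 0) (S n) (I n) (O n) := by
  refine exec_loop n S I O (fun j hj => ?_) h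
  rw [testVal_nonzero, ht j hj, decide_eq_decide]
  omega

/-- Do nothing. -/
def skip : Frag α β := atom 0 idle

theorem exec_skip : Exec skip x L s i o s i o := fun hi hL =>
  ⟨run_atom (fun _ => hL) (act_idle x 0 _ hi) (fun _ => hL), hi⟩

/-- Move the input head. -/
def moveInput (m : HeadMove) : Frag α β := atom 0 fun w => ⟨m, w, HeadMove.stay, none⟩

theorem exec_moveInput (m : HeadMove) :
    Exec (moveInput m) x L s i o s (min (moveHead i m) (x.length + 1)) o := fun _ hL =>
  ⟨run_atom (fun _ => hL) (by
      simp [act, regMemory, moveHead]) (fun _ => hL), min_le_right _ _⟩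

/-- Append a symbol to the output. -/
def emit (b : β) : Frag α β := atom 0 fun w => ⟨HeadMove.stay, w, HeadMove.stay, some b⟩

theorem exec_emit (b : β) : Exec (emit b) x L s i o s i (o ++ [b]) := fun hi hL =>
  ⟨run_atom (fun _ => hL) (by
      simp [act, regMemory, moveHead, hi]) (fun _ => hL), hi⟩

/-- Set register `r` to zero. -/
def clear (r : ℕ) : Frag α β := loop r nonzero (dec r)

theorem exec_clear {r : ℕ} (h : s r + 1 < 2 ^ L) :
    Exec (clear r) x L s i o (Function.update s r 0) i o := by
  have := exec_loop_nonzero (F := dec r) (r := r) (x := x) (L := L) (s r)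
    (fun j => Function.update s r (s r - j)) (fun _ => i) (fun _ => o) (by simp)
    (fun j hj => by
      refine (exec_dec (by simp; omega)).congr ?_
      simp [Nat.sub_sub])
  simpa [clear] using this

/-- Add register `r` to register `t` and set `r` to zero. -/
def addTo (r t : ℕ) : Frag α β := loop r nonzero (seq (dec r) (inc t))

theorem exec_addTo {r t : ℕ} (hrt : r ≠ t) (h : s r + s t + 1 < 2 ^ L) :
    Exec (addTo r t) x L s i o (Function.update (Function.update s r 0) t (s t + s r)) i o := by
  have := exec_loop_nonzero (F := seq (dec r) (inc t)) (r := r) (x := x) (L := L) (s r)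
    (fun j => Function.update (Function.update s r (s r - j)) t (s t + j))
    (fun _ => i) (fun _ => o) (by simp [hrt])
    (fun j hj => by
      refine exec_seq (exec_dec (by simp [hrt]; omega)) ((exec_inc ?_).congr ?_)
      · simp [hrt.symm]; omega
      · funext k
        simp only [Function.update_apply]
        split_ifs <;> simp_all <;> omega)
  simpa [addTo] using this

/-- Copy register `r` to register `t` using register `u`. -/
def copyTo (r t u : ℕ) : Frag α β :=
  seq (loop r nonzero (seq (dec r) (seq (inc t) (inc u)))) (addTo u r)

theorem exec_copyTo {r t u : ℕ} (hrt : r ≠ t) (hru : r ≠ u) (htu : t ≠ u) (ht : s t = 0)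
    (hu : s u = 0) (h : s r + 1 < 2 ^ L) :
    Exec (copyTo r t u) x L s i o (Function.update s t (s r)) i o := by
  have := exec_loop_nonzero (F := seq (dec r) (seq (inc t) (inc u))) (r := r) (x := x) (L := L)
    (s r)
    (fun j => Function.update (Function.update (Function.update s r (s r - j)) t j) u j)
    (fun _ => i) (fun _ => o) (by simp [hrt, hru])
    (fun j hj => by
      refine exec_seq (exec_dec (by simp [hrt, hru]; omega))
        (exec_seq (exec_inc ?_) ((exec_inc ?_).congr ?_))
      · simp [hrt.symm, htu]; omega
      · simp [hru.symm, htu.symm]; omega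
      · funext k
        simp only [Function.update_apply]
        split_ifs <;> simp_all <;> omega)
  -- The invariant holds initially because `t` and `u` start at zero; `u` only keeps a second copy
  -- from which `r` is restored.
  have h0 : (fun j => Function.update (Function.update (Function.update s r (s r - j)) t j) u j) 0
      = s := by
    funext k
    simp only [Function.update_apply]
    split_ifs <;> simp_all
  simp only [h0] at this
  refine exec_seq this ((exec_addTo hru.symm ?_).congr ?_)
  · simp [hrt, hru]; omega
  · funext k
    simp only [Function.update_apply]
    split_ifs <;> simp_all

/-- Move the input head to cell `0`. -/
def rewind : Frag α β :=
  loop 0 (fun c _ => match c with | InputCell.leftEnd => false | _ => true)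
    (moveInput HeadMove.left)

theorem exec_rewind (hi : i ≤ x.length + 1) : Exec rewind x L s i o s 0 o := by
  have := exec_loop (F := moveInput HeadMove.left) (r := 0) (x := x) (L := L)
    (t := fun c _ => match c with | InputCell.leftEnd => false | _ => true) i
    (fun _ => s) (fun j => i - j) (fun _ => o)
    (fun j hj => by
      rcases h : i - j with _ | k
      · simp [testVal, regMemory, inputCell]
        omega
      · rw [decide_eq_true (by omega)]
        simp only [testVal, regMemory, inputCell]
        cases x[k]? <;> rfl)
    (fun j hj => by
      have := exec_moveInput (x := x) (L := L) (s := s) (i := i - j) (o := o) HeadMove.left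
      simp only [moveHead] at this
      rwa [min_eq_left (by omega), Nat.sub_sub] at this)
  simpa [rewind] using this

end

end Frag

/-! ## Functions with small values that are computable in logarithmic space -/

/-- The types of contexts of numbers: `Unit`, and `Γ × ℕ` where `Γ` is a context. -/
class NumContext (Γ : Type) where
  vars : Γ → List ℕ

open NumContext

instance : NumContext Unit := ⟨fun _ => []⟩

instance {Γ : Type} [NumContext Γ] : NumContext (Γ × ℕ) := ⟨fun q => q.2 :: vars q.1⟩

section LogNat

open Frag Transducer

variable {α Γ : Type} [NumContext Γ]

/-- `z` bounds the length of the input and all numbers in the context. -/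
structure SizeBound (x : List α) (γ : Γ) (z : ℕ) : Prop where
  length_le : x.length + 2 ≤ z
  vars_le : ∀ a ∈ vars γ, a ≤ z

theorem SizeBound.mono {x : List α} {γ : Γ} {z z' : ℕ} (h : SizeBound x γ z) (hz : z ≤ z') :
    SizeBound x γ z' :=
  ⟨h.1.trans hz, fun a ha => (h.2 a ha).trans hz⟩

theorem SizeBound.cons {x : List α} {γ : Γ} {z a : ℕ} (h : SizeBound x γ z) (ha : a ≤ z) :
    SizeBound x (γ, a) z :=
  ⟨h.1, by
    intro b hb
    rcases List.mem_cons.1 hb with rfl | hb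
    · exact ha
    · exact h.2 b hb⟩

theorem SizeBound.of_cons {x : List α} {γ : Γ} {z a : ℕ} (h : SizeBound x (γ, a) z) :
    SizeBound x γ z :=
  ⟨h.1, fun b hb => h.2 b (List.mem_cons_of_mem _ hb)⟩

theorem SizeBound.two_le {x : List α} {γ : Γ} {z : ℕ} (h : SizeBound x γ z) : 2 ≤ z :=
  (Nat.le_add_left 2 _).trans h.1

theorem SizeBound.pow_le {x : List α} {γ : Γ} {z d e : ℕ} (h : SizeBound x γ z) (hd : d ≤ e) :
    z ^ d ≤ z ^ e :=
  Nat.pow_le_pow_right (by have := h.two_le; omega) hd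

theorem SizeBound.pow {x : List α} {γ : Γ} {z : ℕ} (h : SizeBound x γ z) (d : ℕ) :
    SizeBound x γ (z ^ (d + 1)) :=
  h.mono (by simpa using h.pow_le (show 1 ≤ d + 1 by omega))

/-- Since `z ≥ 2` even for the empty input, constant factors are absorbed by one more power of `z`;
polynomial bounds therefore need no coefficients. -/
theorem SizeBound.two_mul_pow_le {x : List α} {γ : Γ} {z : ℕ} (h : SizeBound x γ z) (d : ℕ) :
    2 * z ^ d ≤ z ^ (d + 1) := by
  rw [pow_succ, mul_comm]
  exact Nat.mul_le_mul_left _ h.two_le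

theorem SizeBound.pos_pow {x : List α} {γ : Γ} {z : ℕ} (h : SizeBound x γ z) (d : ℕ) :
    1 ≤ z ^ d :=
  Nat.one_le_pow _ _ (by have := h.two_le; omega)

/-- The fragment `F` computes `g`: if the variables are in the registers `ρ` and the registers from
`b` on are zero, then it stores the value in register `b`. -/
def Computes (F : Frag α α) (d : ℕ) (ρ : List ℕ) (b : ℕ) (g : List α → Γ → ℕ) : Prop :=
  ∀ x γ s z L o, ρ.map s = vars γ → (∀ r, b ≤ r → s r = 0) → SizeBound x γ z → z ^ d < 2 ^ L →
    Exec F x L s 0 o (Function.update s b (g x γ)) 0 o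

/-- The fragment `F` writes the value of `g` on the output tape. -/
def Prints (F : Frag α α) (d : ℕ) (ρ : List ℕ) (b : ℕ) (g : List α → Γ → List α) : Prop :=
  ∀ x γ s z L o, ρ.map s = vars γ → (∀ r, b ≤ r → s r = 0) → SizeBound x γ z → z ^ d < 2 ^ L →
    Exec F x L s 0 o s 0 (o ++ g x γ)

/-- The values of `g` are bounded by a polynomial. -/
def PolyBounded (g : List α → Γ → ℕ) : Prop :=
  ∃ d, ∀ x γ z, SizeBound x γ z → g x γ < z ^ d

/-- A function with polynomially bounded values that is computable in logarithmic space. -/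
structure LogNat (g : List α → Γ → ℕ) : Prop where
  bound : PolyBounded g
  computes : ∀ ρ b, (∀ r ∈ ρ, r < b) → ∃ F d, Computes F d ρ b g

/-- A function with values on the output tape that is computable in logarithmic space. -/
def Printable (g : List α → Γ → List α) : Prop :=
  ∀ ρ b, (∀ r ∈ ρ, r < b) → ∃ F d, Prints F d ρ b g

theorem map_update_of_lt {ρ : List ℕ} {b r : ℕ} (h : ∀ r ∈ ρ, r < b) (hr : b ≤ r) (s : ℕ → ℕ)
    (v : ℕ) : ρ.map (Function.update s r v) = ρ.map s :=
  List.map_congr_left fun j hj => Function.update_of_ne (by have := h j hj; omega) _ _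

theorem LogNat.congr {g g' : List α → Γ → ℕ} (h : LogNat g) (hg : ∀ x γ, g x γ = g' x γ) :
    LogNat g' := by
  have : g = g' := funext fun x => funext fun γ => hg x γ
  exact this ▸ h

theorem Printable.congr {g g' : List α → Γ → List α} (h : Printable g)
    (hg : ∀ x γ, g x γ = g' x γ) : Printable g' := by
  have : g = g' := funext fun x => funext fun γ => hg x γ
  exact this ▸ h

/-! ### Closure properties: variables, branching, substitution, recursion, access to the input -/

theorem LogNat.zero : LogNat (fun (_ : List α) (_ : Γ) => 0) where
  bound := ⟨0, fun x γ z h => by simp⟩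
  computes ρ b hρ := ⟨skip, 0, fun x γ s z L o hs hb hz hL => exec_skip.congr (by
    rw [Function.update_eq_self_iff.2 (hb b le_rfl).symm])⟩

theorem LogNat.weaken {g : List α → Γ → ℕ} (h : LogNat g) :
    LogNat (fun x (q : Γ × ℕ) => g x q.1) where
  bound := by
    obtain ⟨d, hd⟩ := h.bound
    exact ⟨d, fun x γ z hz => hd x γ.1 z hz.of_cons⟩
  computes ρ b hρ := by
    rcases ρ with _ | ⟨r, ρ⟩
    -- With no registers the nonempty context cannot be represented, so the claim is vacuous and any
    -- fragment serves.
    · exact ⟨skip, 0, fun x γ s z L o hs => by simp [vars] at hs⟩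
    · obtain ⟨F, d, hF⟩ := h.computes ρ b fun r hr => hρ r (List.mem_cons_of_mem _ hr)
      refine ⟨F, d, fun x γ s z L o hs hb hz hL => hF x γ.1 s z L o ?_ hb hz.of_cons hL⟩
      exact (List.cons_eq_cons.1 hs).2

theorem LogNat.snd : LogNat (fun (_ : List α) (q : Γ × ℕ) => q.2) where
  bound := ⟨2, fun x γ z hz => by
    have := hz.2 γ.2 (List.mem_cons_self ..)
    have := hz.two_le
    nlinarith⟩
  computes ρ b hρ := by
    rcases ρ with _ | ⟨r, ρ⟩
    · exact ⟨skip, 0, fun x γ s z L o hs => by simp [vars] at hs⟩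
    · refine ⟨copyTo r b (b + 1), 2, fun x γ s z L o hs hb hz hL => ?_⟩
      have hr := hρ r (List.mem_cons_self ..)
      have hv : s r = γ.2 := (List.cons_eq_cons.1 hs).1
      have h₁ := hz.2 γ.2 (List.mem_cons_self ..)
      have h₂ := hz.two_le
      exact (exec_copyTo (by omega) (by omega) (by omega) (hb _ le_rfl) (hb _ (by omega))
        (by nlinarith)).congr (by rw [hv])

theorem LogNat.succ {g : List α → Γ → ℕ} (h : LogNat g) : LogNat (fun x γ => g x γ + 1) := by
  obtain ⟨d, hd⟩ := h.bound
  refine ⟨⟨d + 1, fun x γ z hz => ?_⟩, fun ρ b hρ => ?_⟩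
  · have := hd x γ z hz
    have := hz.two_mul_pow_le d
    have := hz.pos_pow d
    dsimp only
    omega
  · obtain ⟨F, e, hF⟩ := h.computes ρ b hρ
    refine ⟨seq F (inc b), e + d, fun x γ s z L o hs hb hz hL => ?_⟩
    have h₁ := hd x γ z hz
    have h₂ := hz.pow_le (show d ≤ e + d by omega)
    have h₃ := hz.pow_le (show e ≤ e + d by omega)
    refine exec_seq (hF x γ s z L o hs hb hz (by omega)) ((exec_inc ?_).congr ?_)
    · simp; omega
    · simp

theorem LogNat.pred {g : List α → Γ → ℕ} (h : LogNat g) : LogNat (fun x γ => g x γ - 1) := by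
  obtain ⟨d, hd⟩ := h.bound
  refine ⟨⟨d, fun x γ z hz => ?_⟩, fun ρ b hρ => ?_⟩
  · have := hd x γ z hz
    dsimp only
    omega
  · obtain ⟨F, e, hF⟩ := h.computes ρ b hρ
    refine ⟨seq F (dec b), e + d, fun x γ s z L o hs hb hz hL => ?_⟩
    have h₁ := hd x γ z hz
    have h₂ := hz.pow_le (show d ≤ e + d by omega)
    have h₃ := hz.pow_le (show e ≤ e + d by omega)
    refine exec_seq (hF x γ s z L o hs hb hz (by omega)) ((exec_dec ?_).congr ?_)
    · simp; omega
    · simp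

/-- Case distinction on whether a number is zero. -/
theorem LogNat.ite {c g h : List α → Γ → ℕ} (hc : LogNat c) (hg : LogNat g) (hh : LogNat h) :
    LogNat (fun x γ => if c x γ ≠ 0 then g x γ else h x γ) := by
  obtain ⟨dc, hdc⟩ := hc.bound
  obtain ⟨dg, hdg⟩ := hg.bound
  obtain ⟨dh, hdh⟩ := hh.bound
  refine ⟨⟨dg + dh, fun x γ z hz => ?_⟩, fun ρ b hρ => ?_⟩
  · have h₁ := hz.pow_le (show dg ≤ dg + dh by omega)
    have h₂ := hz.pow_le (show dh ≤ dg + dh by omega)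
    have := hdg x γ z hz
    have := hdh x γ z hz
    dsimp only
    split_ifs <;> omega
  · obtain ⟨Fc, ec, hFc⟩ := hc.computes ρ b hρ
    obtain ⟨Fg, eg, hFg⟩ := hg.computes ρ b hρ
    obtain ⟨Fh, eh, hFh⟩ := hh.computes ρ b hρ
    refine ⟨seq Fc (Frag.ite b nonzero (seq (clear b) Fg) Fh), ec + eg + eh + dc,
      fun x γ s z L o hs hb hz hL => ?_⟩
    have h₁ := hz.pow_le (show dc ≤ ec + eg + eh + dc by omega)
    have h₂ := hz.pow_le (show ec ≤ ec + eg + eh + dc by omega)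
    have h₃ := hz.pow_le (show eg ≤ ec + eg + eh + dc by omega)
    have h₄ := hz.pow_le (show eh ≤ ec + eg + eh + dc by omega)
    have h₅ := hdc x γ z hz
    refine exec_seq (hFc x γ s z L o hs hb hz (by omega)) (exec_ite_nonzero (fun h => ?_)
      (fun h => ?_))
    · simp only [Function.update_self] at h
      -- The branch expects all registers from `b` on to be zero, so the value of the condition is
      -- removed first.
      refine exec_seq (exec_clear (by simp; omega)) ?_
      dsimp only
      rw [Function.update_idem, Function.update_eq_self_iff.2 (hb b le_rfl).symm, if_pos h]
      exact hFg x γ s z L o hs hb hz (by omega)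
    · simp only [Function.update_self] at h
      dsimp only
      rw [h, Function.update_eq_self_iff.2 (hb b le_rfl).symm, if_neg (by simp)]
      exact hFh x γ s z L o hs hb hz (by omega)

/-- Substitution of a value for a variable. -/
theorem LogNat.subst {h : List α → Γ → ℕ} {g : List α → Γ × ℕ → ℕ} (hg : LogNat g) (hh : LogNat h) :
    LogNat (fun x γ => g x (γ, h x γ)) := by
  obtain ⟨dg, hdg⟩ := hg.bound
  obtain ⟨dh, hdh⟩ := hh.bound
  -- The substituted value may exceed `z`, so `g` is used with a power of `z` as size bound; this
  -- multiplies the exponents.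
  have hz' : ∀ x γ z, SizeBound x γ z → SizeBound x (γ, h x γ) (z ^ (dh + 1)) := fun x γ z hz =>
    (hz.pow dh).cons ((hdh x γ z hz).le.trans (hz.pow_le (by omega)))
  refine ⟨⟨(dh + 1) * dg, fun x γ z hz => ?_⟩, fun ρ b hρ => ?_⟩
  · rw [pow_mul]
    exact hdg _ _ _ (hz' x γ z hz)
  · obtain ⟨Fh, eh, hFh⟩ := hh.computes ρ b hρ
    obtain ⟨Fg, eg, hFg⟩ := hg.computes (b :: ρ) (b + 1) (by
      intro r hr
      rcases List.mem_cons.1 hr with rfl | hr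
      · omega
      · have := hρ r hr
        omega)
    refine ⟨seq Fh (seq Fg (seq (clear b) (addTo (b + 1) b))), eh + (dh + 1) * eg + (dh + 1) * dg +
      dh, fun x γ s z L o hs hb hz hL => ?_⟩
    have h₁ := hz.pow_le (show eh ≤ eh + (dh + 1) * eg + (dh + 1) * dg + dh by omega)
    have h₂ := hz.pow_le (show (dh + 1) * eg ≤ eh + (dh + 1) * eg + (dh + 1) * dg + dh by omega)
    have h₃ := hz.pow_le (show (dh + 1) * dg ≤ eh + (dh + 1) * eg + (dh + 1) * dg + dh by omega)
    have h₄ := hz.pow_le (show dh ≤ eh + (dh + 1) * eg + (dh + 1) * dg + dh by omega)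
    have h₅ := hdh x γ z hz
    have h₆ := hdg _ _ _ (hz' x γ z hz)
    rw [← pow_mul] at h₆
    refine exec_seq (hFh x γ s z L o hs hb hz (by omega)) (exec_seq
      (hFg x (γ, h x γ) _ (z ^ (dh + 1)) L o ?_ ?_ (hz' x γ z hz) ?_)
      (exec_seq (exec_clear ?_) ((exec_addTo ?_ ?_).congr ?_)))
    · simp [map_update_of_lt hρ le_rfl, hs, vars]
    · intro r hr
      rw [Function.update_of_ne (by omega), hb r (by omega)]
    · rw [← pow_mul]; omega
    · simp; omega
    · omega
    · simp; omega
    · have h₇ := hb b le_rfl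
      have h₈ := hb (b + 1) (by omega)
      funext k
      simp only [Function.update_apply]
      split_ifs <;> simp_all

/-- Primitive recursion with polynomially bounded values. -/
theorem LogNat.natRec {n z₀ : List α → Γ → ℕ} {f : List α → Γ → ℕ → ℕ → ℕ} (hn : LogNat n)
    (hz₀ : LogNat z₀) (hf : LogNat (fun x (q : (Γ × ℕ) × ℕ) => f x q.1.1 q.1.2 q.2))
    (hb : ∃ d, ∀ x γ z, SizeBound x γ z → ∀ i ≤ n x γ,
      Nat.rec (motive := fun _ => ℕ) (z₀ x γ) (f x γ) i < z ^ d) :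
    LogNat (fun x γ => Nat.rec (motive := fun _ => ℕ) (z₀ x γ) (f x γ) (n x γ)) := by
  obtain ⟨dn, hdn⟩ := hn.bound
  obtain ⟨d, hd⟩ := hb
  refine ⟨⟨d, fun x γ z hz => hd x γ z hz _ le_rfl⟩, fun ρ b hρ => ?_⟩
  obtain ⟨Fn, en, hFn⟩ := hn.computes ρ b hρ
  obtain ⟨Fz, ez, hFz⟩ := hz₀.computes ρ (b + 2) (fun r hr => by have := hρ r hr; omega)
  obtain ⟨Ff, ef, hFf⟩ := hf.computes ((b + 2) :: (b + 1) :: ρ) (b + 3) (by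
    intro r hr
    simp only [List.mem_cons] at hr
    rcases hr with rfl | rfl | hr
    · omega
    · omega
    · have := hρ r hr
      omega)
  refine ⟨seq Fn (seq Fz (seq
    (loop b nonzero (seq (dec b) (seq Ff (seq (clear (b + 2)) (seq (addTo (b + 3) (b + 2))
      (inc (b + 1)))))))
    (seq (clear (b + 1)) (addTo (b + 2) b)))), en + ez + (d + dn + 1) * ef + d + dn,
    fun x γ s z L o hs hb hz hL => ?_⟩
  have h₁ := hz.pow_le (show en ≤ en + ez + (d + dn + 1) * ef + d + dn by omega)
  have h₂ := hz.pow_le (show ez ≤ en + ez + (d + dn + 1) * ef + d + dn by omega)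
  have h₃ := hz.pow_le (show (d + dn + 1) * ef ≤ en + ez + (d + dn + 1) * ef + d + dn by omega)
  have h₄ := hz.pow_le (show d ≤ en + ez + (d + dn + 1) * ef + d + dn by omega)
  have h₅ := hz.pow_le (show dn ≤ en + ez + (d + dn + 1) * ef + d + dn by omega)
  have h₆ := hdn x γ z hz
  have h₇ := hd x γ z hz
  have h₈ := hz.pow_le (show dn ≤ d + dn + 1 by omega)
  have h₉ := hz.pow_le (show d ≤ d + dn + 1 by omega)
  have hz' := hz.pow (d + dn)
  set R : ℕ → ℕ := Nat.rec (motive := fun _ => ℕ) (z₀ x γ) (f x γ) with hR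
  -- Invariant after `j` rounds: `b` holds the rounds left, `b + 1` the index, `b + 2` the value of
  -- the recursion. The next value is formed in `b + 3` and then moved, because the step function
  -- still needs the old one.
  let S : ℕ → ℕ → ℕ := fun j => Function.update (Function.update (Function.update s b (n x γ - j))
    (b + 1) j) (b + 2) (R j)
  have hSρ : ∀ j, ρ.map (S j) = ρ.map s := fun j => by
    simp only [S]
    rw [map_update_of_lt hρ (by omega), map_update_of_lt hρ (by omega),
      map_update_of_lt hρ le_rfl]
  have hS0 : ∀ j r, b + 3 ≤ r → S j r = 0 := fun j r hr => by
    simp only [S]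
    rw [Function.update_of_ne (by omega), Function.update_of_ne (by omega),
      Function.update_of_ne (by omega), hb r (by omega)]
  have hSb : ∀ j, S j b = n x γ - j := fun j => by simp [S]
  have hSb1 : ∀ j, S j (b + 1) = j := fun j => by simp [S]
  have hSb2 : ∀ j, S j (b + 2) = R j := fun j => by simp [S]
  have hloop := exec_loop_nonzero (x := x) (L := L) (r := b) (n x γ) S (fun _ => 0)
    (fun _ => o) (F := seq (dec b) (seq Ff (seq (clear (b + 2)) (seq (addTo (b + 3) (b + 2))
      (inc (b + 1)))))) (fun j _ => hSb j) (fun j hj => by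
      have hRj := h₇ j hj.le
      have hRj' := h₇ (j + 1) hj
      have hRs : R (j + 1) = f x γ j (R j) := rfl
      refine exec_seq (exec_dec (by rw [hSb]; omega)) (exec_seq
        (hFf x ((γ, j), R j) _ (z ^ (d + dn + 1)) L o ?_ ?_
          ((hz'.cons (by omega)).cons (by omega)) ?_)
        (exec_seq (exec_clear ?_) (exec_seq (exec_addTo ?_ ?_) ((exec_inc ?_).congr ?_))))
      · simp [map_update_of_lt hρ le_rfl, hSρ, hs, vars, hSb1, hSb2]
      · intro r hr
        rw [Function.update_of_ne (by omega), hS0 j r hr]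
      · rw [← pow_mul]; omega
      · simp [hSb2]; omega
      · omega
      · simp [← hRs]; omega
      · simp [hSb1]; omega
      · have h₇ := hb (b + 3) (by omega)
        funext k
        simp only [S, Function.update_apply]
        rcases eq_or_ne k (b + 3) with rfl | h3
        · simp [h₇]
        rcases eq_or_ne k (b + 2) with rfl | h2
        · simp [← hRs]
        rcases eq_or_ne k (b + 1) with rfl | h1
        · simp
        rcases eq_or_ne k b with rfl | h0
        · simp; omega
        simp [h0, h1, h2, h3])
  refine exec_seq (hFn x γ s z L o hs hb hz (by omega)) (exec_seq
    (hFz x γ _ z L o ?_ ?_ hz (by omega)) (exec_seq (s' := S (n x γ)) (i' := 0) (o' := o) ?_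
    (exec_seq (exec_clear ?_) ((exec_addTo ?_ ?_).congr ?_))))
  · rw [map_update_of_lt hρ le_rfl, hs]
  · intro r hr
    rw [Function.update_of_ne (by omega), hb r (by omega)]
  · have hS : Function.update (Function.update s b (n x γ)) (b + 2) (z₀ x γ) = S 0 := by
      have h₇ := hb (b + 1) (by omega)
      funext k
      simp only [S, Function.update_apply, hR]
      split_ifs <;> simp_all
    rw [hS]
    exact hloop
  · rw [hSb1]; omega
  · omega
  · have := h₇ _ le_rfl
    simp [hSb, hSb2]; omega
  · have h₇ := hb (b + 1) (by omega)
    have h₈ := hb (b + 2) (by omega)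
    funext k
    simp only [S, Function.update_apply]
    rcases eq_or_ne k (b + 2) with rfl | h2
    · simp [h₈]
    rcases eq_or_ne k (b + 1) with rfl | h1
    · simp [h₇]
    rcases eq_or_ne k b with rfl | h0
    · simp [hR]
    simp [h0, h1, h2]

/-- The length of the input. -/
theorem LogNat.length : LogNat (fun (x : List α) (_ : Γ) => x.length) := by
  refine ⟨⟨1, fun x γ z hz => by have := hz.1; simp; omega⟩, fun ρ b hρ => ?_⟩
  refine ⟨seq (moveInput HeadMove.right) (seq
    (loop b (fun c _ => match c with | InputCell.rightEnd => false | _ => true)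
      (seq (inc b) (moveInput HeadMove.right))) rewind), 1,
    fun x γ s z L o hs hb hz hL => ?_⟩
  have hz := hz.1
  rw [pow_one] at hL
  have hloop := exec_loop (x := x) (L := L) (r := b)
    (t := fun c _ => match c with | InputCell.rightEnd => false | _ => true)
    (F := seq (inc b) (moveInput HeadMove.right)) x.length (fun j => Function.update s b j)
    (fun j => j + 1) (fun _ => o)
    (fun j hj => by
      simp only [testVal, regMemory, inputCell]
      by_cases hj' : j < x.length
      · simp [hj']
      · simp [hj'])
    (fun j hj => by
      refine exec_seq ((exec_inc (by simp; omega)).congr (s'' := Function.update s b (j + 1)) ?_) ?_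
      · simp
      · have := exec_moveInput (x := x) (L := L) (s := Function.update s b (j + 1)) (i := j + 1)
          (o := o) HeadMove.right
        simp only [moveHead] at this
        rwa [min_eq_left (by omega)] at this)
  have hm := exec_moveInput (x := x) (L := L) (s := s) (i := 0) (o := o) HeadMove.right
  simp only [moveHead] at hm
  rw [min_eq_left (by omega)] at hm
  refine exec_seq hm (exec_seq (s' := Function.update s b x.length) (i' := x.length + 1) (o' := o)
    ?_ (exec_rewind le_rfl))
  have h0 : Function.update s b 0 = s := Function.update_eq_self_iff.2 (hb b le_rfl).symm
  simp only [h0] at hloop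
  exact hloop

/-- A test of the input symbol at a given position. -/
theorem LogNat.getElem {h : List α → Γ → ℕ} (hh : LogNat h) (p : Option α → Bool) :
    LogNat (fun x γ => (p x[h x γ]?).toNat) := by
  obtain ⟨d, hd⟩ := hh.bound
  refine ⟨⟨1, fun x γ z hz => ?_⟩, fun ρ b hρ => ?_⟩
  · have := hz.two_le
    have := Bool.toNat_le (p x[h x γ]?)
    simp; omega
  obtain ⟨F, e, hF⟩ := hh.computes ρ b hρ
  refine ⟨seq F (seq (moveInput HeadMove.right) (seq
    (loop b nonzero (seq (dec b) (moveInput HeadMove.right)))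
    (seq (Frag.ite 0 (fun c _ => p (match c with | InputCell.sym a => some a | _ => none))
      (inc b) skip) rewind))), e + d + 1,
    fun x γ s z L o hs hb hz hL => ?_⟩
  have h₁ := hz.pow_le (show e ≤ e + d + 1 by omega)
  have h₂ := hz.pow_le (show d ≤ e + d + 1 by omega)
  have h₃ := hz.pow_le (show 1 ≤ e + d + 1 by omega)
  have h₄ := hd x γ z hz
  have h₅ := hz.two_le
  rw [pow_one] at h₃
  have hloop := exec_loop_nonzero (x := x) (L := L) (r := b)
    (F := seq (dec b) (moveInput HeadMove.right)) (h x γ)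
    (fun j => Function.update s b (h x γ - j))
    -- For a position beyond the input the head stops at the right end marker, which is read as
    -- `none` just like `x[h x γ]?`.
    (fun j => min (j + 1) (x.length + 1)) (fun _ => o) (fun j _ => by simp)
    (fun j hj => by
      refine exec_seq ((exec_dec (by simp; omega)).congr
        (s'' := Function.update s b (h x γ - (j + 1))) ?_) ?_
      · simp [Nat.sub_sub]
      · have := exec_moveInput (x := x) (L := L) (s := Function.update s b (h x γ - (j + 1)))
          (i := min (j + 1) (x.length + 1)) (o := o) HeadMove.right
        simp only [moveHead] at this
        rwa [show min (min (j + 1) (x.length + 1) + 1) (x.length + 1) =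
          min (j + 1 + 1) (x.length + 1) by omega] at this)
  have hm := exec_moveInput (x := x) (L := L) (s := Function.update s b (h x γ)) (i := 0) (o := o)
    HeadMove.right
  simp only [moveHead] at hm
  have hcell : (match inputCell x (min (h x γ + 1) (x.length + 1)) with
      | InputCell.sym a => some a | _ => none) = x[h x γ]? := by
    by_cases hj : h x γ < x.length
    · rw [min_eq_left (by omega)]
      simp [inputCell, hj]
    · rw [min_eq_right (by omega)]
      simp [inputCell, hj]
  refine exec_seq (hF x γ s z L o hs hb hz (by omega)) (exec_seq hm
    (exec_seq (s' := Function.update s b 0) (i' := min (h x γ + 1) (x.length + 1)) (o' := o)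
      ?_ (exec_seq (i' := min (h x γ + 1) (x.length + 1))
      (exec_ite_input (fun hp => ?_) (fun hp => ?_))
      (exec_rewind (min_le_right _ _)))))
  · simpa using hloop
  · rw [hcell] at hp
    refine (exec_inc ?_).congr ?_
    · have : 1 < 2 ^ L := by omega
      simpa using this
    · simp [hp]
  · rw [hcell] at hp
    simp only [hp, Bool.toNat_false]
    exact exec_skip

/-! ### Output -/

theorem Printable.nil : Printable (fun (_ : List α) (_ : Γ) => []) := fun _ _ _ =>
  ⟨skip, 0, fun x γ s z L o _ _ _ _ => by rw [List.append_nil]; exact exec_skip⟩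

theorem Printable.singleton (a : α) : Printable (fun (_ : List α) (_ : Γ) => [a]) := fun _ _ _ =>
  ⟨emit a, 0, fun _ _ _ _ _ _ _ _ _ _ => exec_emit a⟩

theorem Printable.append {g h : List α → Γ → List α} (hg : Printable g) (hh : Printable h) :
    Printable (fun x γ => g x γ ++ h x γ) := fun ρ b hρ => by
  obtain ⟨F, d, hF⟩ := hg ρ b hρ
  obtain ⟨G, e, hG⟩ := hh ρ b hρ
  refine ⟨seq F G, d + e, fun x γ s z L o hs hb hz hL => ?_⟩
  have h₁ := hz.pow_le (show d ≤ d + e by omega)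
  have h₂ := hz.pow_le (show e ≤ d + e by omega)
  have := exec_seq (hF x γ s z L o hs hb hz (by omega)) (hG x γ s z L _ hs hb hz (by omega))
  rwa [List.append_assoc] at this

theorem Printable.ite {c : List α → Γ → ℕ} {g h : List α → Γ → List α} (hc : LogNat c)
    (hg : Printable g) (hh : Printable h) :
    Printable (fun x γ => if c x γ ≠ 0 then g x γ else h x γ) := fun ρ b hρ => by
  obtain ⟨dc, hdc⟩ := hc.bound
  obtain ⟨Fc, ec, hFc⟩ := hc.computes ρ b hρ
  obtain ⟨Fg, eg, hFg⟩ := hg ρ b hρ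
  obtain ⟨Fh, eh, hFh⟩ := hh ρ b hρ
  refine ⟨seq Fc (Frag.ite b nonzero (seq (clear b) Fg) Fh), ec + eg + eh + dc,
    fun x γ s z L o hs hb hz hL => ?_⟩
  have h₁ := hz.pow_le (show dc ≤ ec + eg + eh + dc by omega)
  have h₂ := hz.pow_le (show ec ≤ ec + eg + eh + dc by omega)
  have h₃ := hz.pow_le (show eg ≤ ec + eg + eh + dc by omega)
  have h₄ := hz.pow_le (show eh ≤ ec + eg + eh + dc by omega)
  have h₅ := hdc x γ z hz
  refine exec_seq (hFc x γ s z L o hs hb hz (by omega)) (exec_ite_nonzero (fun h => ?_)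
    (fun h => ?_))
  · simp only [Function.update_self] at h
    refine exec_seq (exec_clear (by simp; omega)) ?_
    dsimp only
    rw [Function.update_idem, Function.update_eq_self_iff.2 (hb b le_rfl).symm, if_pos h]
    exact hFg x γ s z L o hs hb hz (by omega)
  · simp only [Function.update_self] at h
    dsimp only
    rw [h, Function.update_eq_self_iff.2 (hb b le_rfl).symm, if_neg (by simp)]
    exact hFh x γ s z L o hs hb hz (by omega)

theorem Printable.flatMap_range {n : List α → Γ → ℕ} {g : List α → Γ → ℕ → List α} (hn : LogNat n)
    (hg : Printable (fun x (q : Γ × ℕ) => g x q.1 q.2)) :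
    Printable (fun x γ => (List.range (n x γ)).flatMap (g x γ)) := fun ρ b hρ => by
  obtain ⟨dn, hdn⟩ := hn.bound
  obtain ⟨Fn, en, hFn⟩ := hn.computes ρ b hρ
  obtain ⟨Fg, eg, hFg⟩ := hg ((b + 1) :: ρ) (b + 2) (by
    intro r hr
    rcases List.mem_cons.1 hr with rfl | hr
    · omega
    · have := hρ r hr
      omega)
  refine ⟨seq Fn (seq (loop b nonzero (seq (dec b) (seq Fg (inc (b + 1))))) (clear (b + 1))),
    en + (dn + 1) * eg + dn, fun x γ s z L o hs hb hz hL => ?_⟩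
  have h₁ := hz.pow_le (show en ≤ en + (dn + 1) * eg + dn by omega)
  have h₂ := hz.pow_le (show (dn + 1) * eg ≤ en + (dn + 1) * eg + dn by omega)
  have h₃ := hz.pow_le (show dn ≤ en + (dn + 1) * eg + dn by omega)
  have h₄ := hdn x γ z hz
  have h₅ := hz.pow_le (show dn ≤ dn + 1 by omega)
  have hb1 := hb (b + 1) (by omega)
  have hloop := exec_loop_nonzero (x := x) (L := L) (r := b)
    (F := seq (dec b) (seq Fg (inc (b + 1)))) (n x γ)
    -- Register `b` counts the rounds left and `b + 1` is the loop variable seen by `g`.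
    (fun j => Function.update (Function.update s b (n x γ - j)) (b + 1) j) (fun _ => 0)
    (fun j => o ++ (List.range j).flatMap (g x γ)) (fun j _ => by simp)
    (fun j hj => by
      rw [List.range_succ, List.flatMap_append, List.flatMap_singleton, ← List.append_assoc]
      refine exec_seq (exec_dec (by simp; omega)) (exec_seq
        (hFg x (γ, j) _ (z ^ (dn + 1)) L _ ?_ ?_ ((hz.pow dn).cons (by omega)) ?_)
        ((exec_inc ?_).congr ?_))
      · simp [map_update_of_lt hρ le_rfl, map_update_of_lt hρ (Nat.le_succ b), hs, vars]
      · intro r hr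
        rw [Function.update_of_ne (by omega), Function.update_of_ne (by omega),
          Function.update_of_ne (by omega), hb r (by omega)]
      · rw [← pow_mul]; omega
      · simp; omega
      · funext k
        simp only [Function.update_apply]
        rcases eq_or_ne k (b + 1) with rfl | h1
        · simp
        rcases eq_or_ne k b with rfl | h0
        · simp; omega
        simp [h0, h1])
  refine exec_seq (s' := Function.update s b (n x γ)) (hFn x γ s z L o hs hb hz (by omega))
    (exec_seq (s' := Function.update (Function.update s b 0) (b + 1) (n x γ)) (i' := 0)
      (o' := o ++ (List.range (n x γ)).flatMap (g x γ)) ?_ ((exec_clear ?_).congr ?_))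
  · have h0 : Function.update (Function.update s b (n x γ)) (b + 1) 0 =
        Function.update s b (n x γ) := Function.update_eq_self_iff.2 (by simp [hb1])
    simpa [h0] using hloop
  · simp; omega
  · have h₇ := hb b le_rfl
    funext k
    simp only [Function.update_apply]
    split_ifs <;> simp_all

/-- In the empty context only the input length limits the registers: they stay below a fixed power
of `x.length + 2`, hence have `O(log)` digits. -/
theorem Printable.logspaceComputable [Finite α] {g : List α → Unit → List α} (hg : Printable g) :
    LogspaceComputable (fun x => g x ()) := by
  obtain ⟨F, d, hF⟩ := hg [] 0 (by simp)
  refine logspaceComputable_of_run F _ (3 * d + 1) fun x => ?_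
  have hlog : Nat.log 2 (x.length + 2) ≤ Nat.log 2 x.length + 2 := by
    rcases Nat.eq_zero_or_pos x.length with h | h
    · rw [h]; exact (Nat.log_lt_of_lt_pow (by norm_num) (by norm_num)).le
    · refine Nat.lt_succ_iff.1 (Nat.log_lt_of_lt_pow (by omega) ?_)
      have := Nat.lt_pow_succ_log_self (b := 2) (by norm_num) x.length
      rw [Nat.succ_eq_add_one] at *
      have h4 : 2 ^ (Nat.log 2 x.length + 2 + 1) = 4 * 2 ^ (Nat.log 2 x.length + 1) := by ring
      omega
  -- The final `+ 1` makes the inequality `(x.length + 2) ^ d < 2 ^ L` strict and keeps `L` positive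
  -- when `d = 0`. The constant `3 * d + 1` comes from `log (|x| + 2) + 1 ≤ log |x| + 3 ≤ 3 * (log
  -- |x| + 1)`.
  refine ⟨d * (Nat.log 2 (x.length + 2) + 1) + 1, ?_, _,
    (hF x () (fun _ => 0) (x.length + 2) _ [] rfl (fun _ _ => rfl) ⟨le_rfl, by simp [vars]⟩ ?_
      (by omega) (by omega)).1, rfl⟩
  · nlinarith
  · rw [pow_succ, mul_comm d, pow_mul]
    have h₁ : (x.length + 2) ^ d ≤ (2 ^ (Nat.log 2 (x.length + 2) + 1)) ^ d :=
      Nat.pow_le_pow_left (Nat.lt_pow_succ_log_self (by norm_num) _).le d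
    have h₂ : 0 < (2 ^ (Nat.log 2 (x.length + 2) + 1)) ^ d := by positivity
    omega

end LogNat

/-! ### Rearranging variables and derived functions -/

section LogNat

open Frag Transducer

variable {α Γ Δ : Type} [NumContext Γ] [NumContext Δ]

/-- A rearrangement of the variables of a context. -/
structure ContextMap (φ : Δ → Γ) : Prop where
  mem_vars : ∀ δ, ∀ a ∈ vars (φ δ), a ∈ vars δ
  registers : ∀ ρ : List ℕ, ∃ ρ' : List ℕ, (∀ r ∈ ρ', r ∈ ρ) ∧
    ∀ (s : ℕ → ℕ) (δ : Δ), ρ.map s = vars δ → ρ'.map s = vars (φ δ)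

theorem LogNat.map {φ : Δ → Γ} (hφ : ContextMap φ) {g : List α → Γ → ℕ} (h : LogNat g) :
    LogNat (fun x δ => g x (φ δ)) := by
  have hz : ∀ (x : List α) δ z, SizeBound x δ z → SizeBound x (φ δ) z := fun x δ z hz =>
    ⟨hz.1, fun a ha => hz.2 a (hφ.mem_vars δ a ha)⟩
  refine ⟨?_, fun ρ b hρ => ?_⟩
  · obtain ⟨d, hd⟩ := h.bound
    exact ⟨d, fun x δ z h => hd x _ z (hz x δ z h)⟩
  · obtain ⟨ρ', hρ', hs'⟩ := hφ.registers ρ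
    obtain ⟨F, d, hF⟩ := h.computes ρ' b fun r hr => hρ r (hρ' r hr)
    exact ⟨F, d, fun x δ s z L o hs hb h hL =>
      hF x _ s z L o (hs' s δ hs) hb (hz x δ z h) hL⟩

/-- Needed to substitute for the loop index, which in the step function of a recursion lies below
the accumulator and so is not the last variable. -/
theorem contextMap_swap :
    ContextMap (fun q : ((Γ × ℕ) × ℕ) × ℕ => ((q.1.1.1, q.2), q.1.2)) where
  mem_vars δ a ha := by
    simp only [vars, List.mem_cons] at ha ⊢
    tauto
  registers ρ := by
    rcases ρ with _ | ⟨r₁, _ | ⟨r₂, _ | ⟨r₃, ρ⟩⟩⟩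
    · exact ⟨[], by simp, fun s δ h => by simp [vars] at h⟩
    · exact ⟨[], by simp, fun s δ h => by simp [vars] at h⟩
    · exact ⟨[], by simp, fun s δ h => by simp [vars] at h⟩
    · refine ⟨r₂ :: r₁ :: ρ, by simp; tauto, fun s δ h => ?_⟩
      simp only [vars, List.map_cons, List.cons.injEq] at h ⊢
      tauto

/-! ### Polynomial bounds -/

theorem PolyBounded.add {g h : List α → Γ → ℕ} (hg : PolyBounded g) (hh : PolyBounded h) :
    PolyBounded (fun x γ => g x γ + h x γ) := by
  obtain ⟨d, hd⟩ := hg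
  obtain ⟨e, he⟩ := hh
  refine ⟨d + e + 1, fun x γ z hz => ?_⟩
  have h₁ := hd x γ z hz
  have h₂ := he x γ z hz
  have h₃ := hz.pow_le (show d ≤ d + e by omega)
  have h₄ := hz.pow_le (show e ≤ d + e by omega)
  have h₅ := hz.two_mul_pow_le (d + e)
  dsimp only
  omega

theorem PolyBounded.mul {g h : List α → Γ → ℕ} (hg : PolyBounded g) (hh : PolyBounded h) :
    PolyBounded (fun x γ => g x γ * h x γ) := by
  obtain ⟨d, hd⟩ := hg
  obtain ⟨e, he⟩ := hh
  refine ⟨d + e, fun x γ z hz => ?_⟩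
  rw [pow_add]
  exact Nat.mul_lt_mul_of_lt_of_le (hd x γ z hz) (he x γ z hz).le (hz.pos_pow e)

theorem LogNat.natRec_of_le {n z₀ B : List α → Γ → ℕ} {f : List α → Γ → ℕ → ℕ → ℕ}
    (hn : LogNat n) (hz₀ : LogNat z₀)
    (hf : LogNat (fun x (q : (Γ × ℕ) × ℕ) => f x q.1.1 q.1.2 q.2)) (hB : PolyBounded B)
    (hb : ∀ x γ, ∀ i ≤ n x γ, Nat.rec (motive := fun _ => ℕ) (z₀ x γ) (f x γ) i ≤ B x γ) :
    LogNat (fun x γ => Nat.rec (motive := fun _ => ℕ) (z₀ x γ) (f x γ) (n x γ)) := by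
  obtain ⟨d, hd⟩ := hB
  exact hn.natRec hz₀ hf ⟨d, fun x γ z hz i hi => (hb x γ i hi).trans_lt (hd x γ z hz)⟩

/-! ### Arithmetic -/

theorem LogNat.const (n : ℕ) : LogNat (fun (_ : List α) (_ : Γ) => n) := by
  induction n with
  | zero => exact LogNat.zero
  | succ n ih => exact ih.succ

theorem LogNat.add {g h : List α → Γ → ℕ} (hg : LogNat g) (hh : LogNat h) :
    LogNat (fun x γ => g x γ + h x γ) := by
  have hr : ∀ x γ i, Nat.rec (motive := fun _ => ℕ) (g x γ) (fun _ a => a + 1) i = g x γ + i := by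
    intro x γ i
    induction i with
    | zero => rfl
    | succ i ih => simp only [ih]; rfl
  refine (LogNat.natRec_of_le (f := fun _ _ _ a => a + 1) hh hg LogNat.snd.succ
    (hg.bound.add hh.bound) fun x γ i hi => ?_).congr fun x γ => hr x γ _
  rw [hr]
  exact Nat.add_le_add_left hi _

theorem LogNat.sub {g h : List α → Γ → ℕ} (hg : LogNat g) (hh : LogNat h) :
    LogNat (fun x γ => g x γ - h x γ) := by
  have hr : ∀ x γ i, Nat.rec (motive := fun _ => ℕ) (g x γ) (fun _ a => a - 1) i = g x γ - i := by
    intro x γ i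
    induction i with
    | zero => rfl
    | succ i ih => simp only [ih]; rfl
  refine (LogNat.natRec_of_le (f := fun _ _ _ a => a - 1) hh hg LogNat.snd.pred
    hg.bound fun x γ i hi => ?_).congr fun x γ => hr x γ _
  rw [hr]
  exact Nat.sub_le _ _

theorem LogNat.mul {g h : List α → Γ → ℕ} (hg : LogNat g) (hh : LogNat h) :
    LogNat (fun x γ => g x γ * h x γ) := by
  have hr : ∀ x γ i, Nat.rec (motive := fun _ => ℕ) 0 (fun _ a => a + g x γ) i = g x γ * i := by
    intro x γ i
    induction i with
    | zero => rfl
    | succ i ih => simp only [ih]; rfl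
  refine (LogNat.natRec_of_le (f := fun x γ _ a => a + g x γ) hh LogNat.zero
    (LogNat.snd.add hg.weaken.weaken)
    (hg.bound.mul hh.bound) fun x γ i hi => ?_).congr fun x γ => hr x γ _
  rw [hr]
  exact Nat.mul_le_mul_left _ hi

theorem LogNat.mod_two {g : List α → Γ → ℕ} (hg : LogNat g) :
    LogNat (fun x γ => g x γ % 2) := by
  have hr : ∀ i, Nat.rec (motive := fun _ => ℕ) 0 (fun _ a => 1 - a) i = i % 2 := by
    intro i
    induction i with
    | zero => rfl
    | succ i ih => simp only [ih]; omega
  refine (LogNat.natRec_of_le (f := fun _ _ _ a => 1 - a) hg LogNat.zero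
    ((LogNat.const 1).sub LogNat.snd)
    (LogNat.const 1).bound fun x γ i hi => ?_).congr fun x γ => hr _
  rw [hr]
  omega

/-- Passing from `i` to `i + 1` raises the half exactly when `i` is odd, which makes it a recursion
with small values. -/
theorem LogNat.half {g : List α → Γ → ℕ} (hg : LogNat g) :
    LogNat (fun x γ => g x γ / 2) := by
  have hr : ∀ i, Nat.rec (motive := fun _ => ℕ) 0 (fun i a => a + i % 2) i = i / 2 := by
    intro i
    induction i with
    | zero => rfl
    | succ i ih => simp only [ih]; omega
  refine (LogNat.natRec_of_le (f := fun _ _ i a => a + i % 2) hg LogNat.zero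
    (LogNat.snd.add (LogNat.snd.weaken.mod_two)) hg.bound fun x γ i hi => ?_).congr fun x γ => hr _
  rw [hr]
  omega

/-- The power of two itself could be too large for a register. Halving repeatedly avoids it, and
intermediate values never exceed `g`. -/
theorem LogNat.div_two_pow {g h : List α → Γ → ℕ} (hg : LogNat g) (hh : LogNat h) :
    LogNat (fun x γ => g x γ / 2 ^ h x γ) := by
  have hr : ∀ x γ i, Nat.rec (motive := fun _ => ℕ) (g x γ) (fun _ a => a / 2) i =
      g x γ / 2 ^ i := by
    intro x γ i
    induction i with
    | zero => simp
    | succ i ih => simp only [ih]; rw [Nat.div_div_eq_div_mul, pow_succ]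
  refine (LogNat.natRec_of_le (f := fun _ _ _ a => a / 2) hh hg LogNat.snd.half
    hg.bound fun x γ i hi => ?_).congr fun x γ => hr x γ _
  rw [hr]
  exact Nat.div_le_self _ _

/-! ### Boolean functions -/

/-- A Boolean function that is computable in logarithmic space. -/
def LogBool (p : List α → Γ → Bool) : Prop := LogNat (fun x γ => (p x γ).toNat)

theorem LogBool.congr {p p' : List α → Γ → Bool} (h : LogBool p) (hp : ∀ x γ, p x γ = p' x γ) :
    LogBool p' :=
  LogNat.congr h fun x γ => by rw [hp]

theorem LogNat.cond {p : List α → Γ → Bool} {g h : List α → Γ → ℕ} (hp : LogBool p)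
    (hg : LogNat g) (hh : LogNat h) : LogNat (fun x γ => if p x γ then g x γ else h x γ) :=
  (LogNat.ite hp hg hh).congr fun x γ => by cases p x γ <;> rfl

theorem Printable.cond {p : List α → Γ → Bool} {g h : List α → Γ → List α} (hp : LogBool p)
    (hg : Printable g) (hh : Printable h) :
    Printable (fun x γ => if p x γ then g x γ else h x γ) :=
  (Printable.ite hp hg hh).congr fun x γ => by cases p x γ <;> rfl

theorem LogBool.not {p : List α → Γ → Bool} (hp : LogBool p) : LogBool (fun x γ => !p x γ) :=
  (LogNat.const 1).sub hp |>.congr fun x γ => by cases h : p x γ <;> simp [h]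

theorem LogBool.and {p q : List α → Γ → Bool} (hp : LogBool p) (hq : LogBool q) :
    LogBool (fun x γ => p x γ && q x γ) :=
  (LogNat.mul hp hq).congr fun x γ => by
    cases h : p x γ <;> cases h' : q x γ <;> simp [h, h']

theorem LogBool.le {g h : List α → Γ → ℕ} (hg : LogNat g) (hh : LogNat h) :
    LogBool (fun x γ => decide (g x γ ≤ h x γ)) :=
  ((LogNat.const 1).sub (hg.sub hh)).congr fun x γ => by
    by_cases hgh : g x γ ≤ h x γ
    · simp [hgh]
    · simp only [hgh, decide_false, Bool.toNat_false]
      omega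

theorem LogBool.lt {g h : List α → Γ → ℕ} (hg : LogNat g) (hh : LogNat h) :
    LogBool (fun x γ => decide (g x γ < h x γ)) :=
  LogBool.le hg.succ hh

theorem LogBool.eq {g h : List α → Γ → ℕ} (hg : LogNat g) (hh : LogNat h) :
    LogBool (fun x γ => decide (g x γ = h x γ)) :=
  ((LogBool.le hg hh).and (LogBool.le hh hg)).congr fun x γ => by
    rw [← Bool.decide_and, decide_eq_decide]
    exact le_antisymm_iff.symm

theorem LogBool.getElem {h : List α → Γ → ℕ} (hh : LogNat h) (p : Option α → Bool) :
    LogBool (fun x γ => p x[h x γ]?) :=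
  LogNat.getElem hh p

theorem LogNat.countP {n : List α → Γ → ℕ} {p : List α → Γ → ℕ → Bool} (hn : LogNat n)
    (hp : LogBool (fun x (q : Γ × ℕ) => p x q.1 q.2)) :
    LogNat (fun x γ => (List.range (n x γ)).countP (p x γ)) := by
  have hr : ∀ x γ i, Nat.rec (motive := fun _ => ℕ) 0 (fun i a => a + (p x γ i).toNat) i =
      (List.range i).countP (p x γ) := by
    intro x γ i
    induction i with
    | zero => rfl
    | succ i ih =>
      simp only [ih, List.range_succ, List.countP_append, List.countP_singleton]
      cases p x γ i <;> rfl
  refine (LogNat.natRec_of_le (f := fun x γ i a => a + (p x γ i).toNat) hn LogNat.zero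
    (LogNat.snd.add (LogNat.weaken hp)) hn.bound fun x γ i hi => ?_).congr fun x γ => hr x γ _
  rw [hr]
  exact List.countP_le_length.trans (by simpa using hi)

/-- A bounded universal quantifier is a count that reaches the full length. -/
theorem LogBool.all {n : List α → Γ → ℕ} {p : List α → Γ → ℕ → Bool} (hn : LogNat n)
    (hp : LogBool (fun x (q : Γ × ℕ) => p x q.1 q.2)) :
    LogBool (fun x γ => (List.range (n x γ)).all (p x γ)) :=
  (LogBool.eq (hn.countP hp) hn).congr fun x γ => by
    rw [Bool.eq_iff_iff, decide_eq_true_iff, List.all_eq_true]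
    have := List.countP_eq_length (p := p x γ) (l := List.range (n x γ))
    rwa [List.length_range] at this

/-- A right fold consumes the range from its end, so it is the primitive recursion whose round `i`
uses the index `n - 1 - i`. The bound `B` only has to be preserved by one step. -/
theorem LogNat.foldr {n z₀ B : List α → Γ → ℕ} {f : List α → Γ → ℕ → ℕ → ℕ}
    (hn : LogNat n) (hz₀ : LogNat z₀)
    (hf : LogNat (fun x (q : (Γ × ℕ) × ℕ) => f x q.1.1 q.1.2 q.2)) (hB : PolyBounded B)
    (hzB : ∀ x γ, z₀ x γ ≤ B x γ) (hfB : ∀ x γ i a, a ≤ B x γ → f x γ i a ≤ B x γ) :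
    LogNat (fun x γ => (List.range (n x γ)).foldr (f x γ) (z₀ x γ)) := by
  have hr : ∀ x γ i m, i + m = n x γ →
      Nat.rec (motive := fun _ => ℕ) (z₀ x γ) (fun i a => f x γ (n x γ - 1 - i) a) i =
      (List.range' m i).foldr (f x γ) (z₀ x γ) := by
    intro x γ i
    induction i with
    | zero => intro m hm; rfl
    | succ i ih =>
      intro m hm
      rw [List.range'_succ, List.foldr_cons, ← ih (m + 1) (by omega)]
      simp only
      congr 1
      omega
  have hfB' : ∀ x γ i,
      Nat.rec (motive := fun _ => ℕ) (z₀ x γ) (fun i a => f x γ (n x γ - 1 - i) a) i ≤ B x γ := by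
    intro x γ i
    induction i with
    | zero => exact hzB x γ
    | succ i ih => exact hfB _ _ _ _ ih
  have hg : LogNat (fun x (q : (Γ × ℕ) × ℕ) => f x q.1.1 (n x q.1.1 - 1 - q.1.2) q.2) :=
    (LogNat.map contextMap_swap hf).subst
      ((hn.weaken.weaken.sub (LogNat.const 1)).sub LogNat.snd.weaken)
  refine (LogNat.natRec_of_le (f := fun x γ i a => f x γ (n x γ - 1 - i) a) hn hz₀ hg hB
    fun x γ i _ => hfB' x γ i).congr fun x γ => ?_
  rw [hr x γ (n x γ) 0 (add_zero _), List.range_eq_range']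

end LogNat

/-! ### Numbers in binary -/

theorem bits_eq_cons {n : ℕ} (hn : n ≠ 0) : n.bits = decide (n % 2 = 1) :: (n / 2).bits := by
  conv_lhs => rw [← Nat.bit_bodd_div2 n]
  rw [Nat.bits_append_bit]
  · rw [Nat.div2_val, Nat.mod_two_of_bodd]
    cases n.bodd <;> rfl
  · intro h
    rw [Nat.div2_val] at h
    have : n = 1 := by omega
    subst this
    rfl

/-- Bit `i` exists precisely when the quotient by `2 ^ i` is nonzero. Testing this for each `i`
prints the bits without first computing their number. -/
theorem flatMap_range_bits (m n : ℕ) (h : n < 2 ^ m) :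
    (List.range m).flatMap (fun i => if n / 2 ^ i ≠ 0 then [decide (n / 2 ^ i % 2 = 1)] else []) =
      n.bits := by
  induction m generalizing n with
  | zero =>
    have : n = 0 := by simpa using h
    subst this
    rfl
  | succ m ih =>
    rw [List.range_succ_eq_map, List.flatMap_cons, List.flatMap_map]
    have := ih (n / 2) (by rw [pow_succ] at h; omega)
    simp only [Nat.div_div_eq_div_mul, ← pow_succ', Nat.succ_eq_add_one, pow_zero,
      Nat.div_one] at this ⊢
    rw [this]
    by_cases hn : n = 0
    · subst hn
      rfl
    · rw [if_pos hn, bits_eq_cons hn]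
      rfl

section

variable {Γ : Type} [NumContext Γ]

theorem Printable.encodeBinary {g : List CodeSym → Γ → ℕ} (hg : LogNat g) :
    Printable (fun x γ => encodeBinary (g x γ)) := by
  have hd : LogNat (fun x (q : Γ × ℕ) => g x q.1 / 2 ^ q.2) := hg.weaken.div_two_pow LogNat.snd
  have hb : Printable (fun x (q : Γ × ℕ) => if g x q.1 / 2 ^ q.2 ≠ 0 then
      (if g x q.1 / 2 ^ q.2 % 2 ≠ 0 then [some true] else [some false]) else []) :=
    Printable.ite hd (Printable.ite hd.mod_two (Printable.singleton _) (Printable.singleton _))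
      Printable.nil
  refine ((Printable.flatMap_range (g := fun x γ i => if g x γ / 2 ^ i ≠ 0 then
      (if g x γ / 2 ^ i % 2 ≠ 0 then [some true] else [some false]) else []) hg hb).append
      (Printable.singleton none)).congr fun x γ => ?_
  -- The number itself serves as a crude bound on its own bit length; the surplus positions print
  -- nothing.
  rw [_root_.encodeBinary, ← flatMap_range_bits (g x γ) (g x γ) Nat.lt_two_pow_self,
    List.map_flatMap]
  congr 2
  funext i
  rcases Nat.mod_two_eq_zero_or_one (g x γ / 2 ^ i) with h | h <;> rw [h] <;> split_ifs <;> simp_all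

theorem Printable.encodeUnary {g : List CodeSym → Γ → ℕ} (hg : LogNat g) :
    Printable (fun x γ => encodeUnary (g x γ)) := by
  refine ((Printable.flatMap_range (g := fun _ _ _ => [some true]) hg
    (Printable.singleton _)).append (Printable.singleton none)).congr fun x γ => ?_
  rw [_root_.encodeUnary]
  congr 1
  generalize g x γ = n
  induction n with
  | zero => rfl
  | succ n ih => rw [List.range_succ, List.flatMap_append, ih, List.replicate_succ']; rfl

end

/-! ## Tokens -/

/-- The word between the delimiters number `j - 1` and `j`. -/
def token : List CodeSym → ℕ → List Bool
  | [], _ => []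
  | none :: _, 0 => []
  | some b :: x, 0 => b :: token x 0
  | none :: x, j + 1 => token x j
  | some _ :: x, j + 1 => token x (j + 1)

/-- The words, each followed by a delimiter. -/
def joinTokens (l : List (List Bool)) : List CodeSym := l.flatMap fun t => t.map some ++ [none]

/-- The number of delimiters among the first `i` symbols. -/
def delims (x : List CodeSym) (i : ℕ) : ℕ := (x.take i).count none

theorem joinTokens_cons (t : List Bool) (l : List (List Bool)) :
    joinTokens (t :: l) = t.map some ++ none :: joinTokens l := by
  simp [joinTokens]

theorem token_joinTokens (l : List (List Bool)) (j : ℕ) :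
    token (joinTokens l) j = l[j]?.getD [] := by
  induction l generalizing j with
  | nil => simp [joinTokens, token]
  | cons t l ih =>
    rw [joinTokens_cons]
    induction t with
    | nil =>
      cases j with
      | zero => simp [token]
      | succ j => simp [token, ih]
    | cons b t iht =>
      cases j with
      | zero => simpa [token] using iht
      | succ j => simpa [token] using iht

theorem delims_joinTokens (l : List (List Bool)) :
    delims (joinTokens l) (joinTokens l).length = l.length := by
  rw [delims, List.take_length]
  induction l with
  | nil => rfl
  | cons t l ih =>
    rw [joinTokens_cons, List.count_append, List.count_cons, ih]
    have : (t.map some : List CodeSym).count none = 0 := List.count_eq_zero.2 (by simp)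
    simp [this]

theorem getLast?_joinTokens (l : List (List Bool)) (hl : l ≠ []) :
    (joinTokens l).getLast? = some none := by
  obtain ⟨l, t, rfl⟩ := List.eq_nil_or_concat'  l |>.resolve_left hl
  simp [joinTokens]

theorem token_length_le (x : List CodeSym) (j : ℕ) : (token x j).length ≤ x.length := by
  induction x generalizing j with
  | nil => simp [token]
  | cons a x ih =>
    rcases a with _ | b <;> rcases j with _ | j
    · simp [token]
    · have := ih j
      simp only [token, List.length_cons]
      omega
    · have := ih 0
      simp only [token, List.length_cons]
      omega
    · have := ih (j + 1)
      simp only [token, List.length_cons]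
      omega

/-- Only delimited words count as tokens here. The final delimiter guarantees that no symbols are
left over behind the last one. -/
theorem joinTokens_token (x : List CodeSym) (h : x = [] ∨ x.getLast? = some none) :
    joinTokens ((List.range (delims x x.length)).map (token x)) = x := by
  simp only [delims, List.take_length]
  induction x with
  | nil => rfl
  | cons a x ih =>
    have hx : x = [] ∨ x.getLast? = some none := by
      rcases x with _ | ⟨c, x⟩
      · exact Or.inl rfl
      · right
        simpa using h
    rcases a with _ | b
    · rw [List.count_cons_self, List.range_succ_eq_map, List.map_cons, List.map_map,
        joinTokens_cons]
      have : token (none :: x) ∘ Nat.succ = token x := by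
        funext j
        simp [token]
      rw [this, ih hx]
      simp [token]
    · rcases hx with rfl | hx
      · simp at h
      · have hc : x.count none ≠ 0 := by
          rw [Ne, List.count_eq_zero, not_not]
          exact List.mem_of_getLast? hx
        obtain ⟨k, hk⟩ := Nat.exists_eq_succ_of_ne_zero hc
        have ih := ih (Or.inr hx)
        rw [hk, Nat.succ_eq_add_one, List.range_succ_eq_map, List.map_cons, List.map_map,
          joinTokens_cons] at ih
        rw [List.count_cons_of_ne (by simp), hk, Nat.succ_eq_add_one, List.range_succ_eq_map,
          List.map_cons, List.map_map, joinTokens_cons]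
        have : token (some b :: x) ∘ Nat.succ = token x ∘ Nat.succ := by
          funext j
          simp [token]
        rw [this]
        simp only [token, List.map_cons, List.cons_append]
        rw [ih]

/-- One step of a fold over the bits of a string. -/
def bitStep (f : Bool → ℕ → ℕ) : Option CodeSym → ℕ → ℕ
  | some (some b), a => f b a
  | _, a => a

/-- The bits of token `j` are the bits preceded by exactly `j` delimiters. A fold over a token thus
becomes a fold over all input positions, without storing the token. -/
theorem foldr_token (x : List CodeSym) (j : ℕ) (f : Bool → ℕ → ℕ) (z : ℕ) :
    (List.range x.length).foldr (fun i a => if delims x i = j then bitStep f x[i]? a else a) z =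
      (token x j).foldr f z := by
  induction x generalizing j with
  | nil => rfl
  | cons c x ih =>
    rw [List.length_cons, List.range_succ_eq_map, List.foldr_cons, List.foldr_map]
    have h0 : delims (c :: x) 0 = 0 := rfl
    have hs : ∀ i : ℕ, (c :: x)[i.succ]? = x[i]? := fun i => List.getElem?_cons_succ
    simp only [h0, hs, List.getElem?_cons_zero]
    rcases c with _ | b <;> rcases j with _ | j
    · have hd : ∀ i : ℕ, ¬ delims (none :: x) i.succ = 0 := fun i => by simp [delims]
      simp only [hd, if_false, List.foldr_fixed]
      rfl
    · have hd : ∀ i : ℕ, (delims (none :: x) i.succ = j + 1) = (delims x i = j) := fun i => by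
        simp [delims]
      simp only [hd, ih, (Nat.succ_ne_zero j).symm, if_false]
      rfl
    · have hd : ∀ i : ℕ, delims (some b :: x) i.succ = delims x i := fun i => by simp [delims]
      simp only [hd, ih, if_true]
      rfl
    · have hd : ∀ i : ℕ, delims (some b :: x) i.succ = delims x i := fun i => by simp [delims]
      simp only [hd, ih, (Nat.succ_ne_zero j).symm, if_false]
      rfl

/-! ### Reading tokens in logarithmic space -/

section

variable {Γ : Type} [NumContext Γ]

theorem LogNat.inf {g h : List CodeSym → Γ → ℕ} (hg : LogNat g) (hh : LogNat h) :
    LogNat (fun x γ => min (g x γ) (h x γ)) :=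
  (LogNat.cond (LogBool.le hg hh) hg hh).congr fun x γ => by simp [min_def]

theorem LogNat.delims {h : List CodeSym → Γ → ℕ} (hh : LogNat h) :
    LogNat (fun x γ => delims x (h x γ)) := by
  refine (LogNat.countP (p := fun x _ i => x[i]? == some none) hh
    (LogBool.getElem LogNat.snd fun a => a == some none)).congr fun x γ => ?_
  generalize h x γ = i
  rw [_root_.delims]
  induction i with
  | zero => rfl
  | succ i ih =>
    rw [List.range_succ, List.countP_append, ih, List.countP_singleton, List.take_add_one,
      List.count_append]
    rcases x[i]? with _ | _ | b <;> rfl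

theorem contextMap_last : ContextMap (fun q : Γ × ℕ => ((), q.2)) where
  mem_vars δ a ha := by
    simp only [vars, List.mem_cons] at ha ⊢
    simp_all
  registers ρ := by
    rcases ρ with _ | ⟨r, ρ⟩
    · exact ⟨[], by simp, fun s δ h => by simp [vars] at h⟩
    · refine ⟨[r], by simp, fun s δ h => ?_⟩
      simp only [vars, List.map_cons, List.cons.injEq] at h ⊢
      exact ⟨h.1, rfl⟩

theorem LogNat.foldr_token {h : List CodeSym → Γ → ℕ} (hh : LogNat h)
    {f : List CodeSym → Bool → ℕ → ℕ} {z : ℕ}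
    (hf : ∀ b, LogNat (fun x (q : Unit × ℕ) => f x b q.2))
    {B : List CodeSym → ℕ} (hB : PolyBounded (fun x (_ : Γ) => B x)) (hz : ∀ x, z ≤ B x)
    (hfB : ∀ x b a, a ≤ B x → f x b a ≤ B x) :
    LogNat (fun x γ => (token x (h x γ)).foldr (f x) z) := by
  have hf' : ∀ b, LogNat (fun x (q : (Γ × ℕ) × ℕ) => f x b q.2) := fun b =>
    LogNat.map contextMap_last (hf b)
  refine (LogNat.foldr (n := fun x _ => x.length) (z₀ := fun _ _ => z) (B := fun x _ => B x)
    (f := fun x γ i a => if decide (_root_.delims x i = h x γ) then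
      (if x[i]? == some (some true) then f x true a else
        if x[i]? == some (some false) then f x false a else a) else a)
    LogNat.length (LogNat.const z) ?_ hB (fun x _ => hz x) ?_).congr fun x γ => ?_
  · exact LogNat.cond (LogBool.eq (LogNat.delims LogNat.snd.weaken) hh.weaken.weaken)
      (LogNat.cond (LogBool.getElem LogNat.snd.weaken fun a => a == some (some true)) (hf' true)
        (LogNat.cond (LogBool.getElem LogNat.snd.weaken fun a => a == some (some false)) (hf' false)
          LogNat.snd)) LogNat.snd
  · intro x γ i a ha
    split_ifs
    · exact hfB x _ _ ha
    · exact hfB x _ _ ha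
    · exact ha
    · exact ha
  · rw [← _root_.foldr_token]
    congr 1
    funext i a
    simp only [decide_eq_true_eq]
    rcases x[i]? with _ | _ | _ | _ <;> rfl

end

/-- The value of a word as a binary number, least significant bit first. -/
def bitsVal (t : List Bool) : ℕ := t.foldr (fun b a => 2 * a + b.toNat) 0

theorem bitsVal_bits (n : ℕ) : bitsVal n.bits = n := by
  induction n using Nat.strong_induction_on with
  | _ n ih =>
    by_cases hn : n = 0
    · subst hn
      rfl
    · have h := ih (n / 2) (by omega)
      rw [bits_eq_cons hn]
      simp only [bitsVal, List.foldr_cons] at h ⊢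
      rw [h]
      rcases Nat.mod_two_eq_zero_or_one n with h' | h' <;> rw [h'] <;> simp <;> omega

theorem bits_injective : Function.Injective Nat.bits := fun m n h => by
  rw [← bitsVal_bits m, h, bitsVal_bits]

/-- A word without superfluous zeros. -/
def NoTrailingZero (t : List Bool) : Prop := t.getLast? ≠ some false

theorem noTrailingZero_bits (n : ℕ) : NoTrailingZero n.bits := by
  induction n using Nat.strong_induction_on with
  | _ n ih =>
    by_cases hn : n = 0
    · subst hn
      simp [NoTrailingZero]
    · have h := ih (n / 2) (by omega)
      rw [bits_eq_cons hn, NoTrailingZero]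
      by_cases hn' : n / 2 = 0
      · have : n = 1 := by omega
        subst this
        decide
      · rw [NoTrailingZero] at h
        rw [bits_eq_cons hn'] at h ⊢
        simpa using h

/-- The words with no superfluous zero are exactly those that binary notation produces, so testing
this property recognizes well-formed numerals. -/
theorem bits_bitsVal {t : List Bool} (ht : NoTrailingZero t) : (bitsVal t).bits = t := by
  induction t with
  | nil => rfl
  | cons b t ih =>
    have ht' : NoTrailingZero t := by
      rcases t with _ | ⟨c, t⟩
      · simp [NoTrailingZero]
      · simpa [NoTrailingZero] using ht
    have hv : bitsVal (b :: t) = 2 * bitsVal t + b.toNat := rfl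
    by_cases h0 : bitsVal (b :: t) = 0
    · have htn : t = [] := by
        rw [← ih ht', show bitsVal t = 0 by omega]
        rfl
      subst htn
      cases b
      · simp [NoTrailingZero] at ht
      · simp [bitsVal] at h0
    · rw [bits_eq_cons h0, hv]
      cases b
      · rw [Bool.toNat_false, Nat.add_zero, Nat.mul_div_cancel_left _ (by norm_num), ih ht']
        simp
      · rw [Bool.toNat_true, show (2 * bitsVal t + 1) / 2 = bitsVal t by omega, ih ht']
        simp

/-! ### Lengths, values and tests of tokens -/

section

variable {Γ : Type} [NumContext Γ] {h : List CodeSym → Γ → ℕ}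

theorem polyBounded_length : PolyBounded (fun (x : List CodeSym) (_ : Γ) => x.length) :=
  LogNat.length.bound

/-- The minimum in the fold only provides the bound that every step must preserve; it never takes
effect, as a token is no longer than the string. -/
theorem LogNat.token_length (hh : LogNat h) : LogNat (fun x γ => (token x (h x γ)).length) := by
  refine (LogNat.foldr_token (f := fun x _ a => min (a + 1) x.length) (z := 0) hh
    (fun _ => LogNat.inf LogNat.snd.succ LogNat.length) (B := fun x => x.length)
    polyBounded_length (by simp) (fun x b a _ => min_le_right _ _)).congr fun x γ => ?_
  have hl : ∀ t : List Bool, t.foldr (fun _ a => min (a + 1) x.length) 0 =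
      min t.length x.length := by
    intro t
    induction t with
    | nil => simp
    | cons b t ih =>
      rw [List.foldr_cons, ih, List.length_cons]
      omega
  rw [hl]
  exact Nat.min_eq_left (token_length_le x _)

/-- The value of a token, clipped at the length of the string. -/
def tokenVal (x : List CodeSym) (j : ℕ) : ℕ := min (bitsVal (token x j)) x.length

/-- Horner's scheme from the most significant bit. Clipping after every step gives the same result
as clipping once at the end, because doubling never decreases a number. -/
theorem LogNat.tokenVal (hh : LogNat h) : LogNat (fun x γ => tokenVal x (h x γ)) := by
  refine (LogNat.foldr_token (f := fun x b a => min (2 * a + b.toNat) x.length) (z := 0) hh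
    (fun b => LogNat.inf (((LogNat.const 2).mul LogNat.snd).add (LogNat.const _)) LogNat.length)
    (B := fun x => x.length)
    polyBounded_length (by simp) (fun x b a _ => min_le_right _ _)).congr fun x γ => ?_
  rw [_root_.tokenVal]
  generalize token x (h x γ) = t
  induction t with
  | nil => simp [bitsVal]
  | cons b t ih =>
    rw [List.foldr_cons, ih]
    simp only [bitsVal, List.foldr_cons]
    have := Bool.toNat_le b
    generalize List.foldr _ _ t = v
    omega

theorem LogBool.token_all (hh : LogNat h) : LogBool (fun x γ => (token x (h x γ)).all id) := by
  refine (LogNat.foldr_token (f := fun _ b a => if b then a else 0) (z := 1) hh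
    (fun b => ?_) (B := fun _ => 1) (LogNat.const 1).bound (by simp) ?_).congr fun x γ => ?_
  · cases b
    · exact LogNat.zero
    · exact LogNat.snd
  · intro x b a ha
    split_ifs <;> omega
  · dsimp only
    generalize token x (h x γ) = t
    induction t with
    | nil => rfl
    | cons b t ih =>
      rw [List.foldr_cons, ih]
      cases b <;> simp

instance (t : List Bool) : Decidable (NoTrailingZero t) :=
  inferInstanceAs (Decidable (t.getLast? ≠ some false))

theorem LogBool.token_noTrailingZero (hh : LogNat h) :
    LogBool (fun x γ => decide (NoTrailingZero (token x (h x γ)))) := by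
  -- The value `2` means that no bit has been seen yet. A right fold meets the last bit first, and
  -- that bit is then kept.
  have hl : LogNat fun x γ => (token x (h x γ)).foldr
      (fun b a => if decide (a = 2) then b.toNat else a) 2 := by
    refine LogNat.foldr_token (f := fun _ b a => if decide (a = 2) then b.toNat else a) (z := 2) hh
      (fun b => LogNat.cond (LogBool.eq LogNat.snd (LogNat.const 2)) (LogNat.const _) LogNat.snd)
      (B := fun _ => 2) (LogNat.const 2).bound (by simp) ?_
    intro x b a ha
    have := Bool.toNat_le b
    split_ifs <;> omega
  refine (LogBool.eq hl (LogNat.const 0)).not.congr fun x γ => ?_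
  have key : ∀ t : List Bool, t.foldr (fun b a => if a = 2 then b.toNat else a) 2 =
      (t.getLast?.map Bool.toNat).getD 2 := by
    intro t
    induction t with
    | nil => rfl
    | cons b t ih =>
      rw [List.foldr_cons, ih]
      rcases t with _ | ⟨c, t⟩
      · rfl
      · rw [List.getLast?_cons_cons, List.getLast?_eq_some_getLast (by simp)]
        cases List.getLast (c :: t) (by simp) <;> rfl
  rw [Bool.eq_iff_iff]
  simp only [decide_eq_true_eq, key, Bool.not_eq_true', decide_eq_false_iff_not]
  rw [NoTrailingZero]
  rcases (token x (h x γ)).getLast? with _ | _ | _ <;> simp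

end

/-! ## The reduction -/

/-! ### Scores and the exchange argument -/

section Scores

variable {m : ℕ}

/-- The candidate a voter ranks first (`p` only shows that there is a candidate). -/
def firstCand (p : Fin m) (v : Vote m) : Fin m := v ⟨0, p.pos⟩

/-- The candidate a voter ranks last (`p` only shows that there is a candidate). -/
def lastCand (p : Fin m) (v : Vote m) : Fin m := v ⟨m - 1, Nat.sub_lt p.pos Nat.one_pos⟩

theorem firstCand_eq_iff {p c : Fin m} {v : Vote m} :
    firstCand p v = c ↔ (v.symm c).val = 0 := by
  rw [firstCand, ← Equiv.eq_symm_apply, Fin.ext_iff, eq_comm]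

theorem lastCand_eq_iff {p c : Fin m} {v : Vote m} :
    lastCand p v = c ↔ (v.symm c).val + 1 = m := by
  have := p.pos
  rw [lastCand, ← Equiv.eq_symm_apply, Fin.ext_iff]
  simp only
  omega

/-- The points that a vote gives to a candidate under First-Last. -/
def points (v : Vote m) (c : Fin m) : ℤ := firstLastVector m (v.symm c)

theorem points_eq (p c : Fin m) (v : Vote m) :
    points v c = (if firstCand p v = c then 1 else 0) - (if lastCand p v = c then 1 else 0) := by
  simp only [points, firstLastVector, firstCand_eq_iff, lastCand_eq_iff]

/-- How many of the voters rank the candidate with number `c` first. -/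
def firstCount (p : Fin m) (l : List (Vote m)) (c : ℕ) : ℕ :=
  l.countP fun v => decide ((firstCand p v).val = c)

/-- How many of the voters rank the candidate with number `c` last. -/
def lastCount (p : Fin m) (l : List (Vote m)) (c : ℕ) : ℕ :=
  l.countP fun v => decide ((lastCand p v).val = c)

theorem score_eq (p c : Fin m) (l : List (Vote m)) :
    score (firstLastVector m) l c = firstCount p l c - lastCount p l c := by
  induction l with
  | nil => rfl
  | cons v l ih =>
    have h := points_eq p c v
    simp only [points, score, firstCount, lastCount, List.map_cons, List.sum_cons,
      List.countP_cons, decide_eq_true_eq, ← Fin.ext_iff] at h ih ⊢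
    rw [h, ih]
    push_cast
    ring

theorem sum_firstCount (p : Fin m) (l : List (Vote m)) :
    ∑ c : Fin m, firstCount p l c = l.length := by
  induction l with
  | nil => simp [firstCount]
  | cons v l ih =>
    simp only [firstCount, List.countP_cons, decide_eq_true_eq, ← Fin.ext_iff,
      Finset.sum_add_distrib, List.length_cons] at ih ⊢
    rw [ih]
    simp

theorem sum_lastCount (p : Fin m) (l : List (Vote m)) :
    ∑ c : Fin m, lastCount p l c = l.length := by
  induction l with
  | nil => simp [lastCount]
  | cons v l ih =>
    simp only [lastCount, List.countP_cons, decide_eq_true_eq, ← Fin.ext_iff,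
      Finset.sum_add_distrib, List.length_cons] at ih ⊢
    rw [ih]
    simp

/-- Exchanging the vote `v` for `u` makes `p` gain a point, and no other candidate gains more. -/
def Improves (p : Fin m) (u v : Vote m) : Prop :=
  points v p < points u p ∧ ∀ d, points u d + points v p ≤ points u p + points v d

/-- The preferred candidate gains at least one point. A rival gains at most one, since it gets at
most `0` from `u`, where first place is taken, and at least `-1` from `v`. -/
theorem improves_of_first {p : Fin m} {u v : Vote m} (hu : firstCand p u = p)
    (hv : firstCand p v ≠ p) : Improves p u v := by
  have hup := firstCand_eq_iff.1 hu
  rw [Ne, firstCand_eq_iff] at hv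
  have hlt := (v.symm p).isLt
  have h₁ : points u p = 1 := by
    simp only [points, firstLastVector]
    -- First and last place differ: `v` has `p` in a positive position, so there are at least two
    -- candidates.
    rw [if_pos hup, if_neg (by omega)]
    rfl
  have h₂ : points v p ≤ 0 := by
    simp only [points, firstLastVector]
    rw [if_neg hv]
    split_ifs <;> omega
  refine ⟨by omega, fun d => ?_⟩
  by_cases hd : d = p
  · subst hd
    omega
  have hud : (u.symm d).val ≠ 0 := by
    intro h
    exact hd (u.symm.injective (Fin.ext (h.trans hup.symm)))
  have h₃ : points u d ≤ 0 := by
    simp only [points, firstLastVector]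
    rw [if_neg hud]
    split_ifs <;> omega
  have h₄ : -1 ≤ points v d := by
    simp only [points, firstLastVector]
    split_ifs <;> omega
  omega

/-- Dual to `improves_of_first`: a rival gets at least `0` from `v`, where last place is taken, and
at most `1` from `u`. -/
theorem improves_of_last {p : Fin m} {u v : Vote m} (hu : lastCand p u ≠ p)
    (hv : lastCand p v = p) : Improves p u v := by
  have hvp := lastCand_eq_iff.1 hv
  rw [Ne, lastCand_eq_iff] at hu
  have hlt := (u.symm p).isLt
  have h₁ : points v p = -1 := by
    simp only [points, firstLastVector]
    rw [if_pos hvp, if_neg (by omega)]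
    rfl
  have h₂ : 0 ≤ points u p := by
    simp only [points, firstLastVector]
    rw [if_neg hu]
    split_ifs <;> omega
  refine ⟨by omega, fun d => ?_⟩
  by_cases hd : d = p
  · subst hd
    omega
  have hvd : (v.symm d).val + 1 ≠ m := by
    intro h
    exact hd (v.symm.injective (Fin.ext (by omega)))
  have h₃ : 0 ≤ points v d := by
    simp only [points, firstLastVector]
    rw [if_neg hvd]
    split_ifs <;> omega
  have h₄ : points u d ≤ 1 := by
    simp only [points, firstLastVector]
    split_ifs <;> omega
  omega

/-- The points that a multiset of voters gives to a candidate. -/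
def totalPoints (M : Multiset (Vote m)) (c : Fin m) : ℤ := (M.map fun v => points v c).sum

/-- Pigeonhole with multiplicities: otherwise the part of `W` satisfying `P` would be contained in
that of `M`. It supplies a voter still available for an exchange. -/
theorem exists_count_lt {α : Type} [DecidableEq α] {M W : Multiset α} {P : α → Prop}
    [DecidablePred P] (h : M.countP P < W.countP P) : ∃ u, P u ∧ M.count u < W.count u := by
  by_contra! hc
  refine h.not_ge ?_
  rw [Multiset.countP_eq_card_filter, Multiset.countP_eq_card_filter]
  refine Multiset.card_le_card (Multiset.le_iff_count.2 fun u => ?_)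
  by_cases hu : P u
  · rw [Multiset.count_filter_of_pos hu, Multiset.count_filter_of_pos hu]
    exact hc u hu
  · rw [Multiset.count_filter_of_neg hu]
    exact Nat.zero_le _

/-- If `p` can be made a winner, then also with as many voters as possible that satisfy `P`, for
any property `P` such that exchanging voters without `P` for voters with `P` is good for `p`. -/
theorem exists_optimal_choice (p : Fin m) (r : Fin m → ℤ) (W M₀ : Multiset (Vote m))
    (hM₀ : M₀ ≤ W) (hwin : ∀ d, r d + totalPoints M₀ d ≤ r p + totalPoints M₀ p) :
    ∃ M ≤ W, M.card = M₀.card ∧ (∀ d, r d + totalPoints M d ≤ r p + totalPoints M p) ∧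
      ∀ (P : Vote m → Prop) [DecidablePred P], (∀ u v, P u → ¬P v → Improves p u v) →
        M.countP P = min M₀.card (W.countP P) := by
  classical
  let T : Finset (Multiset (Vote m)) := (W.powersetCard M₀.card).toFinset.filter
    fun M => ∀ d, r d + totalPoints M d ≤ r p + totalPoints M p
  have hT : ∀ M, M ∈ T ↔ (M ≤ W ∧ M.card = M₀.card) ∧
      ∀ d, r d + totalPoints M d ≤ r p + totalPoints M p := fun M => by
    simp only [T, Finset.mem_filter, Multiset.mem_toFinset, Multiset.mem_powersetCard]
  -- Maximality is demanded of the points of `p` and does not mention `P`, so one and the same `M`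
  -- is extremal for all admissible properties simultaneously.
  obtain ⟨M, hMT, hmax⟩ := T.exists_max_image (fun M => totalPoints M p)
    ⟨M₀, (hT M₀).2 ⟨⟨hM₀, rfl⟩, hwin⟩⟩
  obtain ⟨⟨hMW, hMc⟩, hMwin⟩ := (hT M).1 hMT
  refine ⟨M, hMW, hMc, hMwin, fun P _ hP => ?_⟩
  have hle : M.countP P ≤ min M₀.card (W.countP P) :=
    le_min ((Multiset.countP_le_card P M).trans hMc.le) (Multiset.countP_le_of_le P hMW)
  refine hle.antisymm (not_lt.1 fun hlt => ?_)
  obtain ⟨u, hu, huc⟩ := exists_count_lt (hlt.trans_le (min_le_right _ _))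
  obtain ⟨v, hvM, hv⟩ : ∃ v ∈ M, ¬P v := by
    by_contra! hc
    have := Multiset.countP_eq_card.2 hc
    have := hlt.trans_le (min_le_left _ _)
    omega
  obtain ⟨himp, himp'⟩ := hP u v hu hv
  have htot : ∀ d, totalPoints (u ::ₘ M.erase v) d = points u d + totalPoints M d - points v d := by
    intro d
    conv_rhs => rw [← Multiset.cons_erase hvM]
    simp only [totalPoints, Multiset.map_cons, Multiset.sum_cons]
    ring
  -- The exchanged choice still wins, as no rival gains more than `p`; but `p` has strictly more
  -- points, against maximality.
  have hmem : u ::ₘ M.erase v ∈ T := by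
    refine (hT _).2 ⟨⟨Multiset.le_iff_count.2 fun a => ?_, ?_⟩, fun d => ?_⟩
    · have h₁ := Multiset.count_le_of_le a (Multiset.erase_le v M)
      have h₂ := Multiset.count_le_of_le a hMW
      rw [Multiset.count_cons]
      split_ifs with h
      · subst h
        omega
      · omega
    · rw [Multiset.card_cons, Multiset.card_erase_add_one hvM, hMc]
    · have := hMwin d
      have := himp' d
      rw [htot, htot]
      omega
  have := hmax _ hmem
  simp only [htot] at this
  omega

end Scores

/-! ### The score that a winning `p` may be assumed to have -/

namespace CCAVInstance

variable (I : CCAVInstance)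

/-- The number of all voters. -/
def numVoters : ℕ := I.registered.length + I.unregistered.length

/-- The largest number of added voters that can rank `p` first. -/
def maxFirst : ℕ := min I.k (firstCount I.p I.unregistered I.p)

/-- The smallest number of added voters that can rank `p` last. -/
def minLast : ℕ := I.k - min I.k (I.unregistered.length - lastCount I.p I.unregistered I.p)

/-- There are enough voters, and the best score of `p` is not negative. -/
def Admissible : Prop :=
  I.k ≤ I.unregistered.length ∧
    lastCount I.p I.registered I.p + I.minLast ≤ firstCount I.p I.registered I.p + I.maxFirst

/-- The best score that `p` can get. -/
def bestScore : ℕ :=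
  firstCount I.p I.registered I.p + I.maxFirst - (lastCount I.p I.registered I.p + I.minLast)

theorem score_append (l : List (Vote I.m)) (c : Fin I.m) :
    score (firstLastVector I.m) (I.registered ++ l) c =
      score (firstLastVector I.m) I.registered c + totalPoints l c := by
  simp [score, totalPoints, points]

/-- The exchange argument applied to ranking `p` first and to not ranking `p` last fixes both counts
of `p`, so its score no longer depends on the choice of voters. -/
theorem exists_bestScore (h : I.ExactControl firstLast) :
    I.Admissible ∧ ∃ l : List (Vote I.m), l.Sublist I.unregistered ∧ l.length = I.k ∧
      score (firstLastVector I.m) (I.registered ++ l) I.p = I.bestScore ∧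
      ∀ d, score (firstLastVector I.m) (I.registered ++ l) d ≤ I.bestScore := by
  obtain ⟨l₀, hl₀, hk, hwin⟩ := h
  obtain ⟨M, hMW, hMc, hMwin, hM⟩ := exists_optimal_choice I.p
    (score (firstLastVector I.m) I.registered) I.unregistered l₀ hl₀.subperm
    (fun d => by rw [← I.score_append, ← I.score_append]; exact hwin d)
  -- The optimal multiset is realized by an actual sublist of the unregistered voters: a submultiset
  -- is a permuted sublist.
  obtain ⟨l', rfl⟩ := Quot.exists_rep M
  obtain ⟨l, hll', hl⟩ : l'.Subperm I.unregistered := hMW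
  have hcoe : (Quot.mk _ l' : Multiset (Vote I.m)) = (l : Multiset (Vote I.m)) :=
    (Multiset.coe_eq_coe.2 hll').symm
  rw [hcoe] at hMc hMwin hM
  have hlk : l.length = I.k := by rw [← hk]; exact hMc
  have hfirst : firstCount I.p l I.p = I.maxFirst := by
    have := hM (fun v => firstCand I.p v = I.p) fun u v hu hv => improves_of_first hu hv
    simp only [Multiset.coe_countP, Multiset.coe_card, hk] at this
    simpa only [firstCount, maxFirst, ← Fin.ext_iff] using this
  have hlast : lastCount I.p l I.p = I.minLast := by
    have := hM (fun v => lastCand I.p v ≠ I.p) fun u v hu hv =>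
      improves_of_last hu (not_not.1 hv)
    simp only [Multiset.coe_countP, Multiset.coe_card, hk] at this
    have hc : ∀ l : List (Vote I.m), l.length =
        lastCount I.p l I.p + l.countP fun v => decide (lastCand I.p v ≠ I.p) := by
      intro l
      rw [List.length_eq_countP_add_countP fun v => decide ((lastCand I.p v).val = I.p.val)]
      simp only [lastCount, decide_eq_true_eq, ← Fin.ext_iff, decide_not, ne_eq]
    have h₁ := hc l
    have h₂ := hc I.unregistered
    rw [minLast]
    omega
  have hp : score (firstLastVector I.m) (I.registered ++ l) I.p =
      firstCount I.p I.registered I.p + I.maxFirst -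
        (lastCount I.p I.registered I.p + I.minLast) := by
    rw [score_eq I.p]
    simp only [firstCount, lastCount, List.countP_append] at hfirst hlast ⊢
    push_cast
    rw [← hfirst, ← hlast]
  have hwin' : ∀ d, score (firstLastVector I.m) (I.registered ++ l) d ≤
      score (firstLastVector I.m) (I.registered ++ l) I.p := fun d => by
    rw [I.score_append, I.score_append]
    exact hMwin d
  -- Scores sum to zero, so the maximum cannot be negative. Hence the truncated subtraction in
  -- `bestScore` is exact.
  have hnonneg : 0 ≤ score (firstLastVector I.m) (I.registered ++ l) I.p := by
    by_contra! hneg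
    have hsum : ∑ d, score (firstLastVector I.m) (I.registered ++ l) d = 0 := by
      simp only [score_eq I.p, Finset.sum_sub_distrib]
      rw [← Nat.cast_sum, ← Nat.cast_sum, sum_firstCount, sum_lastCount, sub_self]
    have : ∑ d, score (firstLastVector I.m) (I.registered ++ l) d < ∑ _d : Fin I.m, 0 :=
      Finset.sum_lt_sum_of_nonempty ⟨I.p, Finset.mem_univ _⟩ fun d _ => (hwin' d).trans_lt hneg
    simp [hsum] at this
  have hS : score (firstLastVector I.m) (I.registered ++ l) I.p = I.bestScore := by
    rw [bestScore]
    omega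
  refine ⟨⟨?_, by omega⟩, l, hl, hlk, hS, fun d => hS ▸ hwin' d⟩
  rw [← hk]
  exact hl₀.length_le

end CCAVInstance

theorem List.flatMap_sublist_flatMap {α β : Type} (l : List α) {f g : α → List β}
    (h : ∀ a ∈ l, (f a).Sublist (g a)) : (l.flatMap f).Sublist (l.flatMap g) := by
  induction l with
  | nil => simp
  | cons a l ih =>
    rw [List.flatMap_cons, List.flatMap_cons]
    exact (h a (by simp)).append (ih fun b hb => h b (by simp [hb]))

theorem countP_flatMap_finRange {m : ℕ} {β : Type} (f : Fin m → List β) (q : β → Bool) :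
    ((List.finRange m).flatMap f).countP q = ∑ c, (f c).countP q := by
  rw [List.countP_flatMap, Fin.sum_univ_def]
  rfl

/-! ### The multigraph and its perfect matchings -/

namespace CCAVInstance

variable (I : CCAVInstance)

/-- The vertex for a candidate that is ranked first. -/
def plus (c : Fin I.m) : Fin (2 * I.m + 1) := ⟨c.val, by omega⟩

/-- The vertex for a candidate that is ranked last. -/
def minus (c : Fin I.m) : Fin (2 * I.m + 1) := ⟨I.m + c.val, by omega⟩

/-- The vertex that collects what the candidates lack to the best score of `p`. -/
def sink : Fin (2 * I.m + 1) := ⟨2 * I.m, by omega⟩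

/-- The edge of an unregistered voter. -/
def voterEdge (v : Vote I.m) : ColoredEdge (2 * I.m + 1) :=
  ⟨I.plus (firstCand I.p v), I.minus (lastCand I.p v), true⟩

/-- The edge between the two vertices of a candidate. -/
def fillEdge (c : Fin I.m) : ColoredEdge (2 * I.m + 1) := ⟨I.plus c, I.minus c, false⟩

/-- The edge that compensates for a lacking point of a candidate. -/
def lackEdge (c : Fin I.m) : ColoredEdge (2 * I.m + 1) := ⟨I.plus c, I.sink, false⟩

/-- The edges of the multigraph. -/
def graphEdges : List (ColoredEdge (2 * I.m + 1)) :=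
  I.unregistered.map I.voterEdge ++
    (List.finRange I.m).flatMap (fun c => List.replicate I.numVoters (I.fillEdge c)) ++
    (List.finRange I.m).flatMap fun c =>
      List.replicate (if c.val = I.p.val then 0 else I.numVoters + I.bestScore) (I.lackEdge c)

/-- The capacity of the vertex with number `i`. -/
def capacity (i : ℕ) : ℕ :=
  if i < I.m then I.numVoters + I.bestScore - firstCount I.p I.registered i
  else if i < 2 * I.m then I.numVoters - lastCount I.p I.registered (i - I.m)
  else I.m * I.bestScore

/-- The multigraph of an instance of the control problem. -/
def graph : BMatchingInstance where
  n := 2 * I.m + 1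
  edges := I.graphEdges
  bipartite := by
    refine ⟨fun v => decide (v.val < I.m), fun e he => ?_⟩
    simp only [graphEdges, List.mem_append, List.mem_map, List.mem_flatMap,
      List.mem_replicate] at he
    rcases he with (⟨v, -, rfl⟩ | ⟨c, -, -, rfl⟩) | ⟨c, -, -, rfl⟩
    · simp [voterEdge, plus, minus]
    · simp [fillEdge, plus, minus]
    · simp only [lackEdge, plus, sink, c.isLt, decide_true]
      exact fun h => absurd (of_decide_eq_true h.symm) (by omega)
  b := fun v => I.capacity v
  k := I.k

/-- The degree of a vertex in a set of edges. -/
abbrev degree (E : List (ColoredEdge (2 * I.m + 1))) (v : Fin (2 * I.m + 1)) : ℕ :=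
  E.countP fun e => decide (ColoredEdge.Incident v e)

theorem hasExactPerfectBMatching_graph : I.graph.HasExactPerfectBMatching ↔
    ∃ E : List (ColoredEdge (2 * I.m + 1)), E.Sublist I.graphEdges ∧
      E.countP (fun e => e.red) = I.k ∧
      ∀ v : Fin (2 * I.m + 1), I.degree E v = I.capacity v :=
  Iff.rfl

section

variable {I} {c d : Fin I.m} {v : Vote I.m}

theorem incident_plus_voterEdge :
    ColoredEdge.Incident (I.plus c) (I.voterEdge v) ↔ (firstCand I.p v).val = c.val := by
  simp only [ColoredEdge.Incident, voterEdge, plus, minus, Fin.mk.injEq]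
  omega

theorem incident_minus_voterEdge :
    ColoredEdge.Incident (I.minus c) (I.voterEdge v) ↔ (lastCand I.p v).val = c.val := by
  simp only [ColoredEdge.Incident, voterEdge, plus, minus, Fin.mk.injEq]
  omega

theorem not_incident_sink_voterEdge : ¬ColoredEdge.Incident I.sink (I.voterEdge v) := by
  simp only [ColoredEdge.Incident, voterEdge, plus, minus, sink, Fin.mk.injEq]
  omega

theorem incident_plus_fillEdge :
    ColoredEdge.Incident (I.plus c) (I.fillEdge d) ↔ d = c := by
  simp only [ColoredEdge.Incident, fillEdge, plus, minus, Fin.ext_iff]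
  omega

theorem incident_minus_fillEdge :
    ColoredEdge.Incident (I.minus c) (I.fillEdge d) ↔ d = c := by
  simp only [ColoredEdge.Incident, fillEdge, plus, minus, Fin.ext_iff]
  omega

theorem not_incident_sink_fillEdge : ¬ColoredEdge.Incident I.sink (I.fillEdge d) := by
  simp only [ColoredEdge.Incident, fillEdge, plus, minus, sink, Fin.mk.injEq]
  omega

theorem incident_plus_lackEdge :
    ColoredEdge.Incident (I.plus c) (I.lackEdge d) ↔ d = c := by
  simp only [ColoredEdge.Incident, lackEdge, plus, sink, Fin.ext_iff]
  omega

theorem not_incident_minus_lackEdge : ¬ColoredEdge.Incident (I.minus c) (I.lackEdge d) := by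
  simp only [ColoredEdge.Incident, lackEdge, plus, minus, sink, Fin.mk.injEq]
  omega

theorem incident_sink_lackEdge : ColoredEdge.Incident I.sink (I.lackEdge d) := by
  simp only [ColoredEdge.Incident, lackEdge, or_true]

end

theorem degree_plus_voterEdges (l : List (Vote I.m)) (c : Fin I.m) :
    I.degree (l.map I.voterEdge) (I.plus c) = firstCount I.p l c := by
  rw [degree, List.countP_map]
  refine List.countP_congr fun v _ => ?_
  simp [incident_plus_voterEdge]

theorem degree_minus_voterEdges (l : List (Vote I.m)) (c : Fin I.m) :
    I.degree (l.map I.voterEdge) (I.minus c) = lastCount I.p l c := by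
  rw [degree, List.countP_map]
  refine List.countP_congr fun v _ => ?_
  simp [incident_minus_voterEdge]

theorem degree_sink_voterEdges (l : List (Vote I.m)) :
    I.degree (l.map I.voterEdge) I.sink = 0 := by
  rw [degree, List.countP_map, List.countP_eq_zero]
  intro v _
  simp [not_incident_sink_voterEdge]

theorem countP_red_voterEdges (l : List (Vote I.m)) :
    (l.map I.voterEdge).countP (fun e => e.red) = l.length := by
  rw [List.countP_map, List.countP_eq_length]
  intro v _
  rfl

/-- A matching yields a choice of voters. -/
theorem exists_choice_of_matching (h : I.graph.HasExactPerfectBMatching) :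
    ∃ l : List (Vote I.m), l.Sublist I.unregistered ∧ l.length = I.k ∧
      score (firstLastVector I.m) (I.registered ++ l) I.p = I.bestScore ∧
      ∀ d, score (firstLastVector I.m) (I.registered ++ l) d ≤ I.bestScore := by
  obtain ⟨E, hE, hred, hdeg⟩ := I.hasExactPerfectBMatching_graph.1 h
  obtain ⟨E₁₂, E₃, rfl, hE₁₂, hE₃⟩ := List.sublist_append_iff.1 hE
  obtain ⟨E₁, E₂, rfl, hE₁, hE₂⟩ := List.sublist_append_iff.1 hE₁₂
  obtain ⟨l, hl, rfl⟩ := List.sublist_map_iff.1 hE₁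
  have h₂ : ∀ e ∈ E₂, ∃ c, e = I.fillEdge c := fun e he => by
    have := hE₂.subset he
    simp only [List.mem_flatMap, List.mem_replicate] at this
    obtain ⟨c, -, -, rfl⟩ := this
    exact ⟨c, rfl⟩
  have h₃ : ∀ e ∈ E₃, ∃ c, c ≠ I.p ∧ e = I.lackEdge c := fun e he => by
    have := hE₃.subset he
    simp only [List.mem_flatMap, List.mem_replicate] at this
    obtain ⟨c, -, hc, rfl⟩ := this
    refine ⟨c, fun h => hc ?_, rfl⟩
    rw [if_pos (by rw [h])]
  have hfill : ∀ c, I.degree E₂ (I.plus c) = I.degree E₂ (I.minus c) := fun c =>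
    List.countP_congr fun e he => by
      obtain ⟨d, rfl⟩ := h₂ e he
      simp [incident_plus_fillEdge, incident_minus_fillEdge]
  have hlack : ∀ c, I.degree E₃ (I.minus c) = 0 := fun c =>
    List.countP_eq_zero.2 fun e he => by
      obtain ⟨d, -, rfl⟩ := h₃ e he
      simp [not_incident_minus_lackEdge]
  have hlackp : I.degree E₃ (I.plus I.p) = 0 :=
    List.countP_eq_zero.2 fun e he => by
      obtain ⟨d, hd, rfl⟩ := h₃ e he
      simp [incident_plus_lackEdge, hd]
  have hred₂ : E₂.countP (fun e => e.red) = 0 := List.countP_eq_zero.2 fun e he => by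
    obtain ⟨d, rfl⟩ := h₂ e he
    simp [fillEdge]
  have hred₃ : E₃.countP (fun e => e.red) = 0 := List.countP_eq_zero.2 fun e he => by
    obtain ⟨d, -, rfl⟩ := h₃ e he
    simp [lackEdge]
  have hred₁ := I.countP_red_voterEdges l
  rw [List.countP_append, List.countP_append, hred₁, hred₂, hred₃] at hred
  have hplus : ∀ c : Fin I.m, firstCount I.p l c + I.degree E₂ (I.plus c) + I.degree E₃ (I.plus c) =
      I.numVoters + I.bestScore - firstCount I.p I.registered c := fun c => by
    have := hdeg (I.plus c)
    have hcap : I.capacity (I.plus c).val =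
        I.numVoters + I.bestScore - firstCount I.p I.registered c := if_pos c.isLt
    rw [hcap, degree, List.countP_append, List.countP_append] at this
    rw [← this, ← I.degree_plus_voterEdges]
  have hminus : ∀ c : Fin I.m,
      lastCount I.p l c + I.degree E₂ (I.minus c) + I.degree E₃ (I.minus c) =
      I.numVoters - lastCount I.p I.registered c := fun c => by
    have := hdeg (I.minus c)
    have hcap : I.capacity (I.minus c).val =
        I.numVoters - lastCount I.p I.registered c := by
      rw [show (I.minus c).val = I.m + c.val from rfl, capacity, if_neg (by omega),
        if_pos (by omega), Nat.add_sub_cancel_left]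
    rw [hcap, degree, List.countP_append, List.countP_append] at this
    rw [← this, ← I.degree_minus_voterEdges]
  -- Difference of the degree equations at the two vertices of `c`; the fill edges contribute
  -- equally and cancel. Registered counts are at most the number of all voters, so the capacities
  -- are not truncated. The equation at the sink is not needed.
  have hscore : ∀ c, score (firstLastVector I.m) (I.registered ++ l) c =
      I.bestScore - I.degree E₃ (I.plus c) := fun c => by
    have hp := hplus c
    have hm := hminus c
    rw [hlack c, ← hfill c] at hm
    have hf : firstCount I.p I.registered c ≤ I.registered.length := List.countP_le_length
    have hl : lastCount I.p I.registered c ≤ I.registered.length := List.countP_le_length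
    rw [score_eq I.p]
    simp only [firstCount, lastCount, List.countP_append, numVoters] at hf hl hp hm ⊢
    push_cast
    omega
  refine ⟨l, hl, hred, ?_, fun d => ?_⟩
  · rw [hscore, hlackp]
    simp
  · rw [hscore]
    omega

theorem sum_score (l : List (Vote I.m)) :
    ∑ d, score (firstLastVector I.m) l d = 0 := by
  simp only [score_eq I.p, Finset.sum_sub_distrib]
  rw [← Nat.cast_sum, ← Nat.cast_sum, sum_firstCount, sum_lastCount, sub_self]

/-- A choice of voters yields a matching. -/
theorem matching_of_choice {l : List (Vote I.m)} (hl : l.Sublist I.unregistered)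
    (hk : l.length = I.k)
    (hp : score (firstLastVector I.m) (I.registered ++ l) I.p = I.bestScore)
    (hd : ∀ d, score (firstLastVector I.m) (I.registered ++ l) d ≤ I.bestScore) :
    I.graph.HasExactPerfectBMatching := by
  -- The degree equations force both multiplicities: `s c` fill edges complete the minus vertex, and
  -- `t c` is what the score of `c` lacks to the best score.
  let s : Fin I.m → ℕ := fun c => I.numVoters - lastCount I.p (I.registered ++ l) c
  let t : Fin I.m → ℕ := fun c =>
    (I.bestScore - score (firstLastVector I.m) (I.registered ++ l) c).toNat
  have hcount : ∀ c : Fin I.m, lastCount I.p (I.registered ++ l) c ≤ I.numVoters := fun c => by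
    have := hl.length_le
    have h : lastCount I.p (I.registered ++ l) c ≤ (I.registered ++ l).length :=
      List.countP_le_length
    rw [List.length_append] at h
    rw [numVoters]
    omega
  have ht : ∀ c, (t c : ℤ) =
      I.bestScore - score (firstLastVector I.m) (I.registered ++ l) c := fun c =>
    Int.toNat_of_nonneg (by have := hd c; omega)
  have htp : t I.p = 0 := by
    have := ht I.p
    omega
  have hscore : ∀ c, score (firstLastVector I.m) (I.registered ++ l) c =
      firstCount I.p (I.registered ++ l) c - lastCount I.p (I.registered ++ l) c :=
    fun c => score_eq I.p c _
  -- The scores sum to zero, so only the constant part of `t` remains; this is the capacity of the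
  -- sink.
  have htsum : ∑ c, t c = I.m * I.bestScore := by
    have : (∑ c, (t c : ℤ)) = I.m * I.bestScore := by
      simp only [ht, Finset.sum_sub_distrib, I.sum_score]
      simp
    exact_mod_cast this
  refine I.hasExactPerfectBMatching_graph.2 ⟨l.map I.voterEdge ++
    (List.finRange I.m).flatMap (fun c => List.replicate (s c) (I.fillEdge c)) ++
    (List.finRange I.m).flatMap (fun c => List.replicate (t c) (I.lackEdge c)),
    ((hl.map _).append (List.flatMap_sublist_flatMap _ fun c _ => ?_)).append
      (List.flatMap_sublist_flatMap _ fun c _ => ?_), ?_, fun v => ?_⟩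
  · exact (List.replicate_sublist_replicate _).2 (Nat.sub_le _ _)
  · refine (List.replicate_sublist_replicate _).2 ?_
    split_ifs with h
    · rw [Fin.ext h, htp]
    -- No score is below minus the number of all voters, so the supply of lack edges suffices.
    · have := ht c
      have := hscore c
      have := hcount c
      omega
  · rw [List.countP_append, List.countP_append, countP_red_voterEdges, countP_flatMap_finRange,
      countP_flatMap_finRange]
    simpa [List.countP_replicate, fillEdge, lackEdge] using hk
  · rw [degree, List.countP_append, List.countP_append, countP_flatMap_finRange,
      countP_flatMap_finRange]
    simp only [List.countP_replicate, decide_eq_true_eq]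
    rw [capacity]
    by_cases h₁ : v.val < I.m
    · obtain ⟨c, rfl⟩ : ∃ c, I.plus c = v := ⟨⟨v.val, h₁⟩, rfl⟩
      rw [if_pos h₁, show (I.plus c).val = c.val from rfl]
      have hv := I.degree_plus_voterEdges l c
      simp only [degree] at hv
      rw [hv]
      simp only [incident_plus_fillEdge, incident_plus_lackEdge, Finset.sum_ite_eq',
        Finset.mem_univ, if_true]
      have h₁ := ht c
      have h₂ := hscore c
      have h₃ := hcount c
      have h₄ : firstCount I.p I.registered c ≤ I.registered.length := List.countP_le_length
      simp only [s, firstCount, lastCount, List.countP_append, numVoters] at h₁ h₂ h₃ h₄ ⊢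
      omega
    · rw [if_neg h₁]
      by_cases h₂ : v.val < 2 * I.m
      · obtain ⟨c, rfl⟩ : ∃ c, I.minus c = v :=
          ⟨⟨v.val - I.m, by omega⟩, Fin.ext (by simp [minus]; omega)⟩
        rw [if_pos h₂, show (I.minus c).val = I.m + c.val from rfl]
        have hv := I.degree_minus_voterEdges l c
        simp only [degree] at hv
        rw [hv]
        simp only [incident_minus_fillEdge, not_incident_minus_lackEdge, Finset.sum_ite_eq',
          Finset.mem_univ, if_true, if_false, Finset.sum_const_zero]
        have h₃ := hcount c
        simp only [s, lastCount, List.countP_append, numVoters,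
          Nat.add_sub_cancel_left] at h₃ ⊢
        omega
      · obtain rfl : I.sink = v := Fin.ext (by simp [sink]; omega)
        rw [if_neg h₂]
        have hv := I.degree_sink_voterEdges l
        simp only [degree] at hv
        rw [hv]
        simp only [not_incident_sink_fillEdge, incident_sink_lackEdge, if_true, if_false,
          Finset.sum_const_zero, htsum, Nat.zero_add]

/-- Both sides amount to a choice of `k` voters for which `p` attains `bestScore` and nobody exceeds
it. -/
theorem exactControl_iff : I.ExactControl firstLast ↔
    I.Admissible ∧ I.graph.HasExactPerfectBMatching := by
  constructor
  · intro h
    obtain ⟨ha, l, hl, hk, hp, hd⟩ := I.exists_bestScore h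
    exact ⟨ha, I.matching_of_choice hl hk hp hd⟩
  · rintro ⟨-, h⟩
    obtain ⟨l, hl, hk, hp, hd⟩ := I.exists_choice_of_matching h
    exact ⟨l, hl, hk, fun d => hp ▸ hd d⟩

end CCAVInstance

/-! ## Encodings as sequences of tokens -/

theorem joinTokens_append (l l' : List (List Bool)) :
    joinTokens (l ++ l') = joinTokens l ++ joinTokens l' :=
  List.flatMap_append

theorem encodeBinary_eq_joinTokens (n : ℕ) : encodeBinary n = joinTokens [n.bits] := by
  simp [encodeBinary, joinTokens]

theorem encodeUnary_eq_joinTokens (n : ℕ) :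
    encodeUnary n = joinTokens [List.replicate n true] := by
  simp [encodeUnary, joinTokens]

theorem flatMap_joinTokens {α : Type} (l : List α) (f : α → List (List Bool)) :
    l.flatMap (fun a => joinTokens (f a)) = joinTokens (l.flatMap f) := by
  simp [joinTokens, List.flatMap_assoc]

theorem flatMap_encodeBinary {α : Type} (l : List α) (f : α → ℕ) :
    l.flatMap (fun a => encodeBinary (f a)) = joinTokens (l.map fun a => (f a).bits) := by
  simp only [encodeBinary_eq_joinTokens]
  rw [flatMap_joinTokens, List.map_eq_flatMap]

/-- Counting delimiters recovers the number of tokens, and `token` recovers each of them. -/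
theorem joinTokens_injective : Function.Injective joinTokens := by
  intro l l' h
  have hlen : l.length = l'.length := by
    rw [← delims_joinTokens l, ← delims_joinTokens l', h]
  refine List.ext_getElem hlen fun j hj hj' => ?_
  have := token_joinTokens l j
  rw [h, token_joinTokens] at this
  simpa [hj, hj'] using this.symm

theorem map_eq_map_range {α β : Type} (l : List α) (f : α → β) (g : ℕ → β)
    (h : ∀ i (hi : i < l.length), f l[i] = g i) : l.map f = (List.range l.length).map g := by
  refine List.ext_getElem (by simp) fun i hi hi' => ?_
  rw [List.length_map] at hi
  simp [h i hi]

theorem flatMap_eq_flatMap_range {α β : Type} (l : List α) (f : α → List β) (g : ℕ → List β)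
    (h : ∀ i (hi : i < l.length), f l[i] = g i) :
    l.flatMap f = (List.range l.length).flatMap g := by
  rw [List.flatMap_def, List.flatMap_def, map_eq_map_range l f g h]

theorem countP_eq_countP_range {α : Type} (l : List α) (f : α → Bool) (g : ℕ → Bool)
    (h : ∀ i (hi : i < l.length), f l[i] = g i) :
    l.countP f = (List.range l.length).countP g := by
  have h₁ : l.countP f = (l.map f).countP id := by rw [List.countP_map]; rfl
  have h₂ : (List.range l.length).countP g = ((List.range l.length).map g).countP id := by
    rw [List.countP_map]; rfl
  rw [h₁, h₂, map_eq_map_range l f g h]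

theorem map_range_mul {β : Type} (n m : ℕ) (g : ℕ → β) :
    (List.range (n * m)).map g =
      (List.range n).flatMap fun v => (List.range m).map fun i => g (v * m + i) := by
  induction n with
  | zero => simp
  | succ n ih =>
    rw [Nat.succ_mul, List.range_add, List.map_append, ih, List.range_succ, List.flatMap_append,
      List.flatMap_singleton, List.map_map]
    rfl

/-! ### Injectivity of the encoding of matching instances -/

namespace BMatchingInstance

/-- The tokens of an edge. -/
def edgeTokens {n : ℕ} (e : ColoredEdge n) : List (List Bool) :=
  [e.fst.val.bits, e.snd.val.bits, e.red.toNat.bits]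

theorem encodeEdge_eq_joinTokens {n : ℕ} (e : ColoredEdge n) :
    encodeEdge e = joinTokens (edgeTokens e) := by
  simp only [encodeEdge, encodeBinary_eq_joinTokens, ← joinTokens_append]
  rfl

theorem edgeTokens_injective {n : ℕ} : Function.Injective (edgeTokens (n := n)) := by
  rintro ⟨a, b, r⟩ ⟨a', b', r'⟩ h
  simp only [edgeTokens, List.cons.injEq, and_true] at h
  obtain ⟨h₁, h₂, h₃⟩ := h
  have h₁ := Fin.ext (bits_injective h₁)
  have h₂ := Fin.ext (bits_injective h₂)
  have h₃ := bits_injective h₃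
  subst h₁ h₂
  cases r <;> cases r' <;> simp_all

/-- Every edge has exactly three tokens, so the blocks of two equal sequences are aligned. -/
theorem flatMap_edgeTokens_injective {n : ℕ} :
    Function.Injective fun l : List (ColoredEdge n) => l.flatMap edgeTokens := by
  intro l
  induction l with
  | nil =>
    intro l' h
    cases l' with
    | nil => rfl
    | cons e l' => simp [edgeTokens] at h
  | cons e l ih =>
    intro l' h
    cases l' with
    | nil => simp [edgeTokens] at h
    | cons e' l' =>
      simp only [List.flatMap_cons] at h
      obtain ⟨h₁, h₂⟩ := List.append_inj h rfl
      rw [edgeTokens_injective h₁, ih h₂]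

theorem encode_eq_joinTokens (G : BMatchingInstance) :
    G.encode = joinTokens ([List.replicate G.n true, G.k.bits] ++
      (List.ofFn G.b).map Nat.bits ++ G.edges.flatMap edgeTokens) := by
  have h₁ := flatMap_encodeBinary (List.ofFn G.b) id
  simp only [id] at h₁
  rw [encode, joinTokens_append, joinTokens_append, ← flatMap_joinTokens]
  congr 1
  · congr 1
    · rw [encodeUnary_eq_joinTokens, encodeBinary_eq_joinTokens, ← joinTokens_append]
      rfl
  · congr 1
    funext e
    exact encodeEdge_eq_joinTokens e

/-- Membership in the target language provides some instance with the given code; injectivity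
identifies it with the constructed multigraph. -/
theorem encode_injective : Function.Injective encode := by
  rintro ⟨n, E, hE, b, k⟩ ⟨n', E', hE', b', k'⟩ h
  rw [encode_eq_joinTokens, encode_eq_joinTokens] at h
  replace h := joinTokens_injective h
  simp only [List.cons_append, List.nil_append, List.cons.injEq] at h
  obtain ⟨hn, hk, h⟩ := h
  obtain rfl : n = n' := by simpa using congrArg List.length hn
  obtain rfl := bits_injective hk
  obtain ⟨hb, he⟩ := List.append_inj h (by simp)
  obtain rfl := flatMap_edgeTokens_injective he
  obtain rfl := List.ofFn_injective (List.map_injective_iff.2 bits_injective hb)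
  rfl

theorem encode_ne_nil (G : BMatchingInstance) : G.encode ≠ [] := by
  simp [encode, encodeUnary]

end BMatchingInstance

/-! ## The reduction on strings -/

namespace ReductionString

/-- The number of candidates that a string announces. -/
def candNum (x : List CodeSym) : ℕ := (token x 0).length

/-- The number of registered voters that a string announces. -/
def regNum (x : List CodeSym) : ℕ := (token x 1).length

/-- The number of unregistered voters that a string announces. -/
def unregNum (x : List CodeSym) : ℕ := (token x 2).length

/-- The preferred candidate. -/
def pref (x : List CodeSym) : ℕ := tokenVal x 3

/-- The number of voters to be added, clipped at the length of the string. -/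
def addNum (x : List CodeSym) : ℕ := tokenVal x 4

/-- The candidate in position `i` of voter `v`. -/
def cand (x : List CodeSym) (v i : ℕ) : ℕ := tokenVal x (5 + (v * candNum x + i))

/-- Is the string an encoding? -/
def valid (x : List CodeSym) : Bool :=
  decide (delims x x.length = 5 + (regNum x + unregNum x) * candNum x) &&
  (x[x.length - 1]? == some none) &&
  (List.range 3).all (fun j => (token x j).all id) &&
  (List.range (5 + (regNum x + unregNum x) * candNum x)).all
    (fun j => decide (NoTrailingZero (token x j))) &&
  decide (pref x < candNum x) &&
  (List.range (regNum x + unregNum x)).all fun v => (List.range (candNum x)).all fun i =>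
    decide (cand x v i < candNum x) &&
      (List.range i).all fun j => !decide (cand x v j = cand x v i)

/-- How many of the `n` voters starting with voter `s` have candidate `c` in position `i`. -/
def posCount (x : List CodeSym) (s n i c : ℕ) : ℕ :=
  (List.range n).countP fun v => decide (cand x (s + v) i = c)

/-- The largest number of added voters that can rank the preferred candidate first. -/
def maxFirst (x : List CodeSym) : ℕ :=
  min (addNum x) (posCount x (regNum x) (unregNum x) 0 (pref x))

/-- The smallest number of added voters that can rank the preferred candidate last. -/
def minLast (x : List CodeSym) : ℕ :=
  addNum x - min (addNum x)
    (unregNum x - posCount x (regNum x) (unregNum x) (candNum x - 1) (pref x))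

/-- There are enough voters, and the best score is not negative. -/
def admissible (x : List CodeSym) : Bool :=
  decide (addNum x ≤ unregNum x) &&
  decide (posCount x 0 (regNum x) (candNum x - 1) (pref x) + minLast x ≤
    posCount x 0 (regNum x) 0 (pref x) + maxFirst x)

/-- The best score of the preferred candidate. -/
def bestScore (x : List CodeSym) : ℕ :=
  posCount x 0 (regNum x) 0 (pref x) + maxFirst x -
    (posCount x 0 (regNum x) (candNum x - 1) (pref x) + minLast x)

/-- The capacity of vertex `i`. -/
def capacity (x : List CodeSym) (i : ℕ) : ℕ :=
  if decide (i < candNum x) then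
    regNum x + unregNum x + bestScore x - posCount x 0 (regNum x) 0 i
  else if decide (i < 2 * candNum x) then
    regNum x + unregNum x - posCount x 0 (regNum x) (candNum x - 1) (i - candNum x)
  else candNum x * bestScore x

/-- The code of an edge. -/
def edgeCode (a b r : ℕ) : List CodeSym := encodeBinary a ++ encodeBinary b ++ encodeBinary r

/-- The code of the multigraph. -/
def graphCode (x : List CodeSym) : List CodeSym :=
  encodeUnary (2 * candNum x + 1) ++ encodeBinary (addNum x) ++
    (List.range (2 * candNum x + 1)).flatMap (fun i => encodeBinary (capacity x i)) ++
    ((List.range (unregNum x)).flatMap (fun v =>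
        edgeCode (cand x (regNum x + v) 0)
          (candNum x + cand x (regNum x + v) (candNum x - 1)) 1) ++
      (List.range (candNum x)).flatMap (fun c =>
        (List.range (regNum x + unregNum x)).flatMap fun _ => edgeCode c (candNum x + c) 0) ++
      (List.range (candNum x)).flatMap (fun c =>
        (List.range (if decide (c = pref x) then 0 else
          regNum x + unregNum x + bestScore x)).flatMap fun _ => edgeCode c (2 * candNum x) 0))

/-- The reduction. -/
def reduction (x : List CodeSym) : List CodeSym :=
  if valid x && admissible x then graphCode x else []

/-! ### Logarithmic space -/

section

variable {Γ : Type} [NumContext Γ]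

theorem logNat_candNum : LogNat (fun x (_ : Γ) => candNum x) :=
  LogNat.token_length (LogNat.const 0)

theorem logNat_regNum : LogNat (fun x (_ : Γ) => regNum x) :=
  LogNat.token_length (LogNat.const 1)

theorem logNat_unregNum : LogNat (fun x (_ : Γ) => unregNum x) :=
  LogNat.token_length (LogNat.const 2)

theorem logNat_pref : LogNat (fun x (_ : Γ) => pref x) := LogNat.tokenVal (LogNat.const 3)

theorem logNat_addNum : LogNat (fun x (_ : Γ) => addNum x) := LogNat.tokenVal (LogNat.const 4)

theorem logNat_cand {v i : List CodeSym → Γ → ℕ} (hv : LogNat v) (hi : LogNat i) :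
    LogNat (fun x γ => cand x (v x γ) (i x γ)) :=
  LogNat.tokenVal ((LogNat.const 5).add ((hv.mul logNat_candNum).add hi))

theorem logNat_voters : LogNat (fun x (_ : Γ) => regNum x + unregNum x) :=
  logNat_regNum.add logNat_unregNum

theorem logNat_tokens :
    LogNat (fun x (_ : Γ) => 5 + (regNum x + unregNum x) * candNum x) :=
  (LogNat.const 5).add (logNat_voters.mul logNat_candNum)

theorem logBool_valid : LogBool (fun x (_ : Γ) => valid x) := by
  have h₁ : LogBool (fun x (_ : Γ) => x[x.length - 1]? == some none) :=
    LogBool.getElem (LogNat.length.sub (LogNat.const 1)) fun a : Option CodeSym => a == some none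
  have h₂ : LogBool (fun x (_ : Γ) => (List.range 3).all fun j => (token x j).all id) :=
    LogBool.all (p := fun x _ j => (token x j).all id) (LogNat.const 3)
      (LogBool.token_all LogNat.snd)
  have h₃ : LogBool (fun x (_ : Γ) =>
      (List.range (5 + (regNum x + unregNum x) * candNum x)).all
        fun j => decide (NoTrailingZero (token x j))) :=
    LogBool.all (p := fun x _ j => decide (NoTrailingZero (token x j))) logNat_tokens
      (LogBool.token_noTrailingZero LogNat.snd)
  have h₄ : LogBool (fun x (q : (Γ × ℕ) × ℕ) => (List.range q.2).all fun j =>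
      !decide (cand x q.1.2 j = cand x q.1.2 q.2)) :=
    LogBool.all (p := fun x (q : (Γ × ℕ) × ℕ) j => !decide (cand x q.1.2 j = cand x q.1.2 q.2))
      LogNat.snd
      (LogBool.eq (logNat_cand LogNat.snd.weaken.weaken LogNat.snd)
        (logNat_cand LogNat.snd.weaken.weaken LogNat.snd.weaken)).not
  have h₅ : LogBool (fun x (q : Γ × ℕ) => (List.range (candNum x)).all fun i =>
      decide (cand x q.2 i < candNum x) &&
        (List.range i).all fun j => !decide (cand x q.2 j = cand x q.2 i)) :=
    LogBool.all (p := fun x (q : Γ × ℕ) i => decide (cand x q.2 i < candNum x) &&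
        (List.range i).all fun j => !decide (cand x q.2 j = cand x q.2 i)) logNat_candNum
      ((LogBool.lt (logNat_cand LogNat.snd.weaken LogNat.snd) logNat_candNum).and h₄)
  have h₆ : LogBool (fun x (_ : Γ) => (List.range (regNum x + unregNum x)).all fun v =>
      (List.range (candNum x)).all fun i => decide (cand x v i < candNum x) &&
        (List.range i).all fun j => !decide (cand x v j = cand x v i)) :=
    LogBool.all (p := fun x _ v =>
      (List.range (candNum x)).all fun i => decide (cand x v i < candNum x) &&
        (List.range i).all fun j => !decide (cand x v j = cand x v i)) logNat_voters h₅
  exact (((((LogBool.eq (LogNat.delims LogNat.length) logNat_tokens).and h₁).and h₂).and h₃).and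
    (LogBool.lt logNat_pref logNat_candNum)).and h₆

theorem logNat_posCount {s n i c : List CodeSym → Γ → ℕ} (hs : LogNat s) (hn : LogNat n)
    (hi : LogNat i) (hc : LogNat c) :
    LogNat (fun x γ => posCount x (s x γ) (n x γ) (i x γ) (c x γ)) :=
  LogNat.countP (p := fun x γ v => decide (cand x (s x γ + v) (i x γ) = c x γ)) hn
    (LogBool.eq (logNat_cand (hs.weaken.add LogNat.snd) hi.weaken) hc.weaken)

theorem logNat_maxFirst : LogNat (fun x (_ : Γ) => maxFirst x) :=
  LogNat.inf logNat_addNum (logNat_posCount logNat_regNum logNat_unregNum LogNat.zero logNat_pref)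

theorem logNat_lastPos : LogNat (fun x (_ : Γ) => candNum x - 1) :=
  logNat_candNum.sub (LogNat.const 1)

theorem logNat_minLast : LogNat (fun x (_ : Γ) => minLast x) :=
  logNat_addNum.sub (LogNat.inf logNat_addNum (logNat_unregNum.sub
    (logNat_posCount logNat_regNum logNat_unregNum logNat_lastPos logNat_pref)))

theorem logNat_firstTotal :
    LogNat (fun x (_ : Γ) => posCount x 0 (regNum x) 0 (pref x) + maxFirst x) :=
  (logNat_posCount LogNat.zero logNat_regNum LogNat.zero logNat_pref).add logNat_maxFirst

theorem logNat_lastTotal :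
    LogNat (fun x (_ : Γ) => posCount x 0 (regNum x) (candNum x - 1) (pref x) + minLast x) :=
  (logNat_posCount LogNat.zero logNat_regNum logNat_lastPos logNat_pref).add logNat_minLast

theorem logBool_admissible : LogBool (fun x (_ : Γ) => admissible x) :=
  (LogBool.le logNat_addNum logNat_unregNum).and (LogBool.le logNat_lastTotal logNat_firstTotal)

theorem logNat_bestScore : LogNat (fun x (_ : Γ) => bestScore x) :=
  logNat_firstTotal.sub logNat_lastTotal

theorem logNat_capacity {i : List CodeSym → Γ → ℕ} (hi : LogNat i) :
    LogNat (fun x γ => capacity x (i x γ)) :=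
  LogNat.cond (LogBool.lt hi logNat_candNum)
    ((logNat_voters.add logNat_bestScore).sub
      (logNat_posCount LogNat.zero logNat_regNum LogNat.zero hi))
    (LogNat.cond (LogBool.lt hi ((LogNat.const 2).mul logNat_candNum))
      (logNat_voters.sub
        (logNat_posCount LogNat.zero logNat_regNum logNat_lastPos (hi.sub logNat_candNum)))
      (logNat_candNum.mul logNat_bestScore))

theorem printable_edgeCode {a b r : List CodeSym → Γ → ℕ} (ha : LogNat a) (hb : LogNat b)
    (hr : LogNat r) : Printable (fun x γ => edgeCode (a x γ) (b x γ) (r x γ)) :=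
  ((Printable.encodeBinary ha).append (Printable.encodeBinary hb)).append
    (Printable.encodeBinary hr)

theorem printable_graphCode : Printable (fun x (_ : Γ) => graphCode x) := by
  have hn : ∀ {Γ : Type} [NumContext Γ], LogNat (fun x (_ : Γ) => 2 * candNum x + 1) :=
    ((LogNat.const 2).mul logNat_candNum).succ
  have h₁ : Printable (fun x (_ : Γ) =>
      (List.range (2 * candNum x + 1)).flatMap fun i => encodeBinary (capacity x i)) :=
    Printable.flatMap_range (g := fun x _ i => encodeBinary (capacity x i)) hn
      (Printable.encodeBinary (logNat_capacity LogNat.snd))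
  have h₂ : Printable (fun x (_ : Γ) => (List.range (unregNum x)).flatMap fun v =>
      edgeCode (cand x (regNum x + v) 0)
        (candNum x + cand x (regNum x + v) (candNum x - 1)) 1) :=
    Printable.flatMap_range (g := fun x _ v => edgeCode (cand x (regNum x + v) 0)
        (candNum x + cand x (regNum x + v) (candNum x - 1)) 1) logNat_unregNum
      (printable_edgeCode (logNat_cand (logNat_regNum.add LogNat.snd) LogNat.zero)
        (logNat_candNum.add (logNat_cand (logNat_regNum.add LogNat.snd) logNat_lastPos))
        (LogNat.const 1))
  have h₃ : Printable (fun x (_ : Γ) => (List.range (candNum x)).flatMap fun c =>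
      (List.range (regNum x + unregNum x)).flatMap fun _ => edgeCode c (candNum x + c) 0) :=
    Printable.flatMap_range (g := fun x _ c => (List.range (regNum x + unregNum x)).flatMap
        fun _ => edgeCode c (candNum x + c) 0) logNat_candNum
      (Printable.flatMap_range (g := fun x (q : Γ × ℕ) _ => edgeCode q.2 (candNum x + q.2) 0)
        logNat_voters (printable_edgeCode LogNat.snd.weaken
          (logNat_candNum.add LogNat.snd.weaken) LogNat.zero))
  have h₄ : Printable (fun x (_ : Γ) => (List.range (candNum x)).flatMap fun c =>
      (List.range (if decide (c = pref x) then 0 else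
        regNum x + unregNum x + bestScore x)).flatMap fun _ => edgeCode c (2 * candNum x) 0) :=
    Printable.flatMap_range (g := fun x _ c => (List.range (if decide (c = pref x) then 0 else
        regNum x + unregNum x + bestScore x)).flatMap fun _ => edgeCode c (2 * candNum x) 0)
      logNat_candNum
      (Printable.flatMap_range (g := fun x (q : Γ × ℕ) _ => edgeCode q.2 (2 * candNum x) 0)
        (LogNat.cond (LogBool.eq LogNat.snd logNat_pref) LogNat.zero
          (logNat_voters.add logNat_bestScore))
        (printable_edgeCode LogNat.snd.weaken ((LogNat.const 2).mul logNat_candNum) LogNat.zero))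
  have h₀ := (Printable.encodeUnary hn).append (Printable.encodeBinary (logNat_addNum (Γ := Γ)))
  exact (h₀.append h₁).append ((h₂.append h₃).append h₄)

end

theorem logspaceComputable_reduction : LogspaceComputable reduction :=
  Printable.logspaceComputable (g := fun x _ => reduction x)
    (Printable.cond (logBool_valid.and logBool_admissible) printable_graphCode Printable.nil)

end ReductionString

/-! ## Correctness of the reduction -/

namespace CCAVInstance

variable (I : CCAVInstance)

/-- All voters. -/
abbrev voters : List (Vote I.m) := I.registered ++ I.unregistered

/-- The number of the candidate in position `i` of voter `v`. -/
def candAt (v i : ℕ) : ℕ := if h : i < I.m then (I.voters[v]?.getD 1 ⟨i, h⟩).val else 0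

/-- The tokens of the encoding. -/
def tokens : List (List Bool) :=
  [List.replicate I.m true, List.replicate I.registered.length true,
    List.replicate I.unregistered.length true, I.p.val.bits, I.k.bits] ++
  (List.range (I.numVoters * I.m)).map fun t => (I.candAt (t / I.m) (t % I.m)).bits

theorem candAt_of_lt {v i : ℕ} (hv : v < I.voters.length) (hi : i < I.m) :
    I.candAt v i = (I.voters[v] ⟨i, hi⟩).val := by
  rw [candAt, dif_pos hi, List.getElem?_eq_getElem hv, Option.getD_some]

theorem candAt_lt (v : ℕ) {i : ℕ} (hi : i < I.m) : I.candAt v i < I.m := by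
  rw [candAt, dif_pos hi]
  exact Fin.isLt _

theorem flatMap_encodeVote : I.voters.flatMap encodeVote =
    joinTokens ((List.range (I.numVoters * I.m)).map
      fun t => (I.candAt (t / I.m) (t % I.m)).bits) := by
  have hm : 0 < I.m := I.p.pos
  have h : encodeVote = fun v : Vote I.m => joinTokens ((List.ofFn v).map fun c => c.val.bits) :=
    funext fun v => flatMap_encodeBinary _ _
  rw [h, flatMap_joinTokens]
  rw [map_range_mul, numVoters, ← List.length_append]
  congr 1
  refine flatMap_eq_flatMap_range _ _ _ fun v hv => List.ext_getElem (by simp) fun i hi hi' => ?_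
  have hi' : i < I.m := by simpa using hi'
  have h₁ : (v * I.m + i) / I.m = v := by
    rw [Nat.mul_comm, Nat.mul_add_div hm, Nat.div_eq_of_lt hi', Nat.add_zero]
  have h₂ : (v * I.m + i) % I.m = i := by
    rw [Nat.mul_comm, Nat.mul_add_mod, Nat.mod_eq_of_lt hi']
  simp only [List.getElem_map, List.getElem_ofFn, List.getElem_range, h₁, h₂]
  rw [I.candAt_of_lt hv hi']

theorem encode_eq_joinTokens : I.encode = joinTokens I.tokens := by
  rw [tokens, joinTokens_append, ← flatMap_encodeVote, List.flatMap_append, ← List.append_assoc]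
  simp only [encode, encodeUnary_eq_joinTokens, encodeBinary_eq_joinTokens, ← joinTokens_append]
  rfl

theorem length_tokens : I.tokens.length = 5 + I.numVoters * I.m := by
  simp [tokens]
  omega

theorem token_encode (j : ℕ) : token I.encode j = I.tokens[j]?.getD [] := by
  rw [encode_eq_joinTokens, token_joinTokens]

theorem token_encode_vote {v i : ℕ} (hv : v < I.numVoters) (hi : i < I.m) :
    token I.encode (5 + (v * I.m + i)) = (I.candAt v i).bits := by
  have hlt : v * I.m + i < I.numVoters * I.m := by
    calc v * I.m + i < (v + 1) * I.m := by rw [Nat.succ_mul]; omega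
      _ ≤ _ := Nat.mul_le_mul_right _ hv
  have h₁ : (v * I.m + i) / I.m = v := by
    rw [Nat.mul_comm, Nat.mul_add_div (by omega), Nat.div_eq_of_lt hi, Nat.add_zero]
  have h₂ : (v * I.m + i) % I.m = i := by
    rw [Nat.mul_comm, Nat.mul_add_mod, Nat.mod_eq_of_lt hi]
  rw [token_encode, tokens, List.getElem?_append_right (by simp)]
  simp [hlt, h₁, h₂]

end CCAVInstance

/-! ### Parsed quantities agree with those of the instance -/

namespace ReductionString

variable (I : CCAVInstance)

theorem candNum_encode : candNum I.encode = I.m := by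
  simp [candNum, I.token_encode, CCAVInstance.tokens]

theorem regNum_encode : regNum I.encode = I.registered.length := by
  simp [regNum, I.token_encode, CCAVInstance.tokens]

theorem unregNum_encode : unregNum I.encode = I.unregistered.length := by
  simp [unregNum, I.token_encode, CCAVInstance.tokens]

theorem voters_encode : regNum I.encode + unregNum I.encode = I.numVoters := by
  rw [regNum_encode, unregNum_encode, CCAVInstance.numVoters]

theorem candNum_le (x : List CodeSym) : candNum x ≤ x.length := token_length_le x 0

/-- Strictness matters: a `k` that is really clipped becomes the length of the string, which still
exceeds the number of unregistered voters. -/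
theorem unregNum_lt_length : unregNum I.encode < I.encode.length := by
  rw [unregNum_encode, CCAVInstance.encode]
  simp [encodeUnary, encodeBinary]
  omega

theorem pref_encode : pref I.encode = I.p := by
  have h := candNum_le I.encode
  rw [candNum_encode] at h
  have : bitsVal (token I.encode 3) = I.p := by
    simp [I.token_encode, CCAVInstance.tokens, bitsVal_bits]
  rw [pref, tokenVal, this]
  omega

theorem addNum_encode : addNum I.encode = min I.k I.encode.length := by
  have : bitsVal (token I.encode 4) = I.k := by
    simp [I.token_encode, CCAVInstance.tokens, bitsVal_bits]
  rw [addNum, tokenVal, this]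

theorem cand_encode {v i : ℕ} (hv : v < I.numVoters) (hi : i < I.m) :
    cand I.encode v i = I.candAt v i := by
  have h := candNum_le I.encode
  rw [candNum_encode] at h
  have := I.candAt_lt v hi
  rw [cand, tokenVal, candNum_encode, I.token_encode_vote hv hi, bitsVal_bits]
  omega

theorem noTrailingZero_token_encode (j : ℕ) : NoTrailingZero (token I.encode j) := by
  have hnil : NoTrailingZero [] := by simp [NoTrailingZero]
  have hrep : ∀ n, NoTrailingZero (List.replicate n true) := fun n => by
    cases n <;> simp [NoTrailingZero, List.getLast?_replicate]
  have : ∀ t ∈ I.tokens, NoTrailingZero t := by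
    intro t ht
    simp only [CCAVInstance.tokens, List.mem_append, List.mem_cons, List.not_mem_nil, or_false,
      List.mem_map] at ht
    rcases ht with (rfl | rfl | rfl | rfl | rfl) | ⟨_, -, rfl⟩
    · exact hrep _
    · exact hrep _
    · exact hrep _
    · exact noTrailingZero_bits _
    · exact noTrailingZero_bits _
    · exact noTrailingZero_bits _
  rw [I.token_encode]
  rcases h : I.tokens[j]? with _ | t
  · exact hnil
  · exact this t (List.mem_of_getElem? h)

theorem valid_encode : valid I.encode = true := by
  have h₁ : delims I.encode I.encode.length = 5 + I.numVoters * I.m := by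
    rw [I.encode_eq_joinTokens, delims_joinTokens, I.length_tokens]
  have h₂ : I.encode[I.encode.length - 1]? = some none := by
    rw [← List.getLast?_eq_getElem?, I.encode_eq_joinTokens]
    exact getLast?_joinTokens _ (by simp [CCAVInstance.tokens])
  have h₃ : ∀ j < 3, (token I.encode j).all id = true := by
    intro j hj
    interval_cases j <;> simp [I.token_encode, CCAVInstance.tokens]
  simp only [valid, voters_encode, candNum_encode, pref_encode, h₁, h₂, Bool.and_eq_true,
    decide_eq_true_eq, List.all_eq_true, List.mem_range, beq_self_eq_true, Bool.not_eq_true',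
    decide_eq_false_iff_not, and_true, true_and]
  refine ⟨⟨⟨fun j hj => List.all_eq_true.1 (h₃ j hj), fun j _ => noTrailingZero_token_encode I j⟩,
    I.p.isLt⟩, fun v hv i hi => ?_⟩
  have hv' : v < I.voters.length := by rwa [List.length_append]
  rw [cand_encode I hv hi]
  refine ⟨I.candAt_lt v hi, fun j hj h => ?_⟩
  rw [cand_encode I hv (hj.trans hi), I.candAt_of_lt hv' hi, I.candAt_of_lt hv' (hj.trans hi)] at h
  exact absurd (congrArg Fin.val ((I.voters[v]).injective (Fin.ext h))) hj.ne

/-- The offset `s` treats both blocks of voters uniformly: registered voters start at `0`,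
unregistered ones right after them. -/
theorem posCount_encode {s i : ℕ} (hi : i < I.m) (l : List (Vote I.m)) (c : ℕ)
    (hl : ∀ v (hv : v < l.length), I.voters[s + v]? = some l[v]) :
    posCount I.encode s l.length i c = l.countP fun v => decide ((v ⟨i, hi⟩).val = c) := by
  refine (countP_eq_countP_range _ _ _ fun v hv => ?_).symm
  obtain ⟨h, h'⟩ := List.getElem?_eq_some_iff.1 (hl v hv)
  rw [cand_encode I (by rwa [List.length_append] at h) hi, I.candAt_of_lt h hi, h']

theorem posCount_registered {i : ℕ} (hi : i < I.m) (c : ℕ) :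
    posCount I.encode 0 (regNum I.encode) i c =
      I.registered.countP fun v => decide ((v ⟨i, hi⟩).val = c) := by
  rw [regNum_encode]
  refine posCount_encode I hi _ c fun v hv => ?_
  rw [Nat.zero_add, List.getElem?_append_left hv, List.getElem?_eq_getElem hv]

theorem posCount_unregistered {i : ℕ} (hi : i < I.m) (c : ℕ) :
    posCount I.encode (regNum I.encode) (unregNum I.encode) i c =
      I.unregistered.countP fun v => decide ((v ⟨i, hi⟩).val = c) := by
  rw [regNum_encode, unregNum_encode]
  refine posCount_encode I hi _ c fun v hv => ?_
  rw [List.getElem?_append_right (by omega), Nat.add_sub_cancel_left, List.getElem?_eq_getElem hv]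

variable {I}

theorem maxFirst_encode (hk : addNum I.encode = I.k) : maxFirst I.encode = I.maxFirst := by
  rw [maxFirst, hk, posCount_unregistered I I.p.pos, pref_encode]
  rfl

theorem minLast_encode (hk : addNum I.encode = I.k) : minLast I.encode = I.minLast := by
  rw [minLast, hk, candNum_encode, posCount_unregistered I (Nat.sub_lt I.p.pos Nat.one_pos),
    pref_encode, unregNum_encode]
  rfl

theorem firstCount_encode (c : ℕ) :
    posCount I.encode 0 (regNum I.encode) 0 c = firstCount I.p I.registered c :=
  posCount_registered I I.p.pos c

theorem lastCount_encode (c : ℕ) :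
    posCount I.encode 0 (regNum I.encode) (I.m - 1) c = lastCount I.p I.registered c :=
  posCount_registered I (Nat.sub_lt I.p.pos Nat.one_pos) c

theorem bestScore_encode (hk : addNum I.encode = I.k) : bestScore I.encode = I.bestScore := by
  rw [bestScore, maxFirst_encode hk, minLast_encode hk, candNum_encode, firstCount_encode,
    lastCount_encode, pref_encode]
  rfl

theorem addNum_le_iff : addNum I.encode ≤ unregNum I.encode ↔ I.k ≤ I.unregistered.length := by
  have := unregNum_lt_length I
  rw [addNum_encode]
  rw [unregNum_encode] at this ⊢
  omega

theorem addNum_encode_of_le (h : I.k ≤ I.unregistered.length) : addNum I.encode = I.k := by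
  have := unregNum_lt_length I
  rw [addNum_encode]
  rw [unregNum_encode] at this
  omega

theorem admissible_encode : admissible I.encode = true ↔ I.Admissible := by
  simp only [admissible, Bool.and_eq_true, decide_eq_true_eq, addNum_le_iff,
    CCAVInstance.Admissible]
  refine and_congr_right fun h => ?_
  have hk := addNum_encode_of_le h
  rw [maxFirst_encode hk, minLast_encode hk, candNum_encode, firstCount_encode,
    lastCount_encode, pref_encode]

theorem capacity_encode (hk : addNum I.encode = I.k) (i : ℕ) :
    capacity I.encode i = I.capacity i := by
  simp only [capacity, candNum_encode, voters_encode, bestScore_encode hk, firstCount_encode,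
    lastCount_encode, decide_eq_true_eq]
  rfl

theorem flatMap_replicate_eq_flatMap_range {α β : Type} (n : ℕ) (a : α) (f : α → List β) :
    (List.replicate n a).flatMap f = (List.range n).flatMap fun _ => f a := by
  have := flatMap_eq_flatMap_range (List.replicate n a) f (fun _ => f a) (by simp)
  rwa [List.length_replicate] at this

theorem flatMap_finRange {m : ℕ} {β : Type} (f : Fin m → List β) (g : ℕ → List β)
    (h : ∀ i : Fin m, f i = g i) : (List.finRange m).flatMap f = (List.range m).flatMap g := by
  have := flatMap_eq_flatMap_range (List.finRange m) f g fun i hi => by simp [h]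
  rwa [List.length_finRange] at this

theorem flatMap_capacity_encode (hk : addNum I.encode = I.k) :
    (List.range (2 * I.m + 1)).flatMap (fun i => encodeBinary (capacity I.encode i)) =
      (List.ofFn I.graph.b).flatMap encodeBinary := by
  have h := flatMap_eq_flatMap_range (List.ofFn I.graph.b) encodeBinary
    (fun i => encodeBinary (capacity I.encode i)) fun i hi => by
      rw [List.getElem_ofFn, capacity_encode hk]
      rfl
  rw [List.length_ofFn] at h
  exact h.symm

theorem flatMap_voterEdge_encode :
    (List.range (unregNum I.encode)).flatMap (fun v =>
        edgeCode (cand I.encode (regNum I.encode + v) 0)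
          (I.m + cand I.encode (regNum I.encode + v) (I.m - 1)) 1) =
      (I.unregistered.map I.voterEdge).flatMap BMatchingInstance.encodeEdge := by
  have hm := I.p.pos
  rw [List.flatMap_map, unregNum_encode]
  refine (flatMap_eq_flatMap_range _ _ _ fun v hv => ?_).symm
  have hv' : I.registered.length + v < I.voters.length := by
    rw [List.length_append]
    omega
  have hv'' : I.registered.length + v < I.numVoters := by rwa [List.length_append] at hv'
  have hget : I.voters[I.registered.length + v] = I.unregistered[v] := by
    simp [List.getElem_append_right]
  rw [regNum_encode, cand_encode I hv'' hm, cand_encode I hv'' (Nat.sub_lt hm Nat.one_pos),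
    I.candAt_of_lt hv' hm, I.candAt_of_lt hv' (Nat.sub_lt hm Nat.one_pos), hget]
  rfl

theorem flatMap_fillEdge_encode :
    (List.range I.m).flatMap (fun c =>
        (List.range I.numVoters).flatMap fun _ => edgeCode c (I.m + c) 0) =
      ((List.finRange I.m).flatMap fun c =>
        List.replicate I.numVoters (I.fillEdge c)).flatMap BMatchingInstance.encodeEdge := by
  rw [List.flatMap_assoc]
  refine (flatMap_finRange _ _ fun c => ?_).symm
  rw [flatMap_replicate_eq_flatMap_range]
  rfl

theorem flatMap_lackEdge_encode :
    (List.range I.m).flatMap (fun c =>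
        (List.range (if c = I.p.val then 0 else I.numVoters + I.bestScore)).flatMap
          fun _ => edgeCode c (2 * I.m) 0) =
      ((List.finRange I.m).flatMap fun c => List.replicate
        (if c.val = I.p.val then 0 else I.numVoters + I.bestScore)
          (I.lackEdge c)).flatMap BMatchingInstance.encodeEdge := by
  rw [List.flatMap_assoc]
  refine (flatMap_finRange _ _ fun c => ?_).symm
  rw [flatMap_replicate_eq_flatMap_range]
  rfl

theorem graphCode_encode (hk : addNum I.encode = I.k) : graphCode I.encode = I.graph.encode := by
  have h : I.graph.encode = encodeUnary (2 * I.m + 1) ++ encodeBinary I.k ++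
      (List.ofFn I.graph.b).flatMap encodeBinary ++
      I.graphEdges.flatMap BMatchingInstance.encodeEdge := rfl
  rw [h, CCAVInstance.graphEdges, List.flatMap_append, List.flatMap_append,
    ← flatMap_capacity_encode hk, ← flatMap_voterEdge_encode, ← flatMap_fillEdge_encode,
    ← flatMap_lackEdge_encode]
  simp only [graphCode, candNum_encode, hk, voters_encode, bestScore_encode hk, pref_encode,
    decide_eq_true_eq]

theorem reduction_encode (h : I.Admissible) : reduction I.encode = I.graph.encode := by
  rw [reduction, valid_encode, admissible_encode.2 h, Bool.and_self, if_pos rfl,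
    graphCode_encode (addNum_encode_of_le h.1)]

/-- The tests allow every token to be rebuilt from its meaning: the first three are unary, the
others canonical binary. Pairwise distinct candidates in range form an injection of a finite set
into itself, hence a vote. -/
theorem exists_encode_eq {x : List CodeSym} (hx : valid x = true) :
    ∃ I : CCAVInstance, I.encode = x := by
  simp only [valid, Bool.and_eq_true, decide_eq_true_eq, List.all_eq_true, List.mem_range,
    beq_iff_eq, Bool.not_eq_true', decide_eq_false_iff_not, id] at hx
  obtain ⟨⟨⟨⟨⟨hdelims, hlast⟩, hones⟩, hbits⟩, hpref⟩, hcand⟩ := hx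
  have hle := candNum_le x
  have hinj : ∀ v : Fin (regNum x + unregNum x), Function.Injective fun i : Fin (candNum x) =>
      (⟨cand x v i, (hcand v v.isLt i i.isLt).1⟩ : Fin (candNum x)) := by
    intro v i j hij
    have hij : cand x v i = cand x v j := congrArg Fin.val hij
    rcases lt_trichotomy i.val j.val with h | h | h
    · exact absurd hij ((hcand v v.isLt j j.isLt).2 i h)
    · exact Fin.ext h
    · exact absurd hij.symm ((hcand v v.isLt i i.isLt).2 j h)
  let votes : List (Vote (candNum x)) := List.ofFn fun v =>
    Equiv.ofBijective _ (Finite.injective_iff_bijective.1 (hinj v))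
  let I : CCAVInstance :=
    -- The number of voters to add is taken unclipped here, because the instance has to encode to
    -- the very same string.
    ⟨candNum x, ⟨pref x, hpref⟩, votes.take (regNum x), votes.drop (regNum x),
      bitsVal (token x 4)⟩
  have hvotes : votes.length = regNum x + unregNum x := List.length_ofFn
  have hreg : I.registered.length = regNum x := by
    rw [List.length_take, hvotes]
    omega
  have hunreg : I.unregistered.length = unregNum x := by
    rw [List.length_drop, hvotes]
    omega
  have hnum : I.numVoters = regNum x + unregNum x := by
    rw [CCAVInstance.numVoters, hreg, hunreg]
  have hvoters : I.voters = votes := List.take_append_drop _ _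
  have hcandAt : ∀ v < regNum x + unregNum x, ∀ i < candNum x, I.candAt v i = cand x v i := by
    intro v hv i hi
    rw [CCAVInstance.candAt, dif_pos hi, hvoters, List.getElem?_eq_getElem (by rwa [hvotes]),
      Option.getD_some, List.getElem_ofFn]
    rfl
  -- A clipped value would equal the length of the string, which is at least `candNum x`; a value
  -- below that bound is therefore genuine.
  have hval : ∀ j < 5 + (regNum x + unregNum x) * candNum x, tokenVal x j < candNum x →
      (tokenVal x j).bits = token x j := by
    intro j hj h
    have : tokenVal x j = bitsVal (token x j) := by
      rw [tokenVal] at h ⊢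
      omega
    rw [this, bits_bitsVal (hbits j hj)]
  have hrep : ∀ j < 3, List.replicate (token x j).length true = token x j := fun j hj =>
    (List.eq_replicate_iff.2 ⟨rfl, hones j hj⟩).symm
  refine ⟨I, ?_⟩
  rw [I.encode_eq_joinTokens]
  refine Eq.trans (congrArg joinTokens ?_) (joinTokens_token x (.inr ?_))
  · rw [hdelims, List.range_add, List.map_append, List.map_map, CCAVInstance.tokens, hnum, hreg,
      hunreg]
    congr 1
    · simp only [List.range_succ, List.range_zero, List.nil_append, List.map_cons, List.map_nil,
        List.cons_append]
      rw [← hrep 0 (by omega), ← hrep 1 (by omega), ← hrep 2 (by omega),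
        ← hval 3 (by omega) hpref, ← bits_bitsVal (hbits 4 (by omega))]
      rfl
    · refine List.map_congr_left fun t ht => ?_
      rw [List.mem_range] at ht
      have hm : 0 < candNum x := by omega
      have hv : t / candNum x < regNum x + unregNum x := (Nat.div_lt_iff_lt_mul hm).2 ht
      have hi := Nat.mod_lt t hm
      have ht' : cand x (t / candNum x) (t % candNum x) = tokenVal x (5 + t) := by
        rw [cand, Nat.div_add_mod']
      change (I.candAt (t / candNum x) (t % candNum x)).bits = token x (5 + t)
      rw [hcandAt _ hv _ hi, ht']
      exact hval _ (Nat.add_lt_add_left ht 5) (ht' ▸ (hcand _ hv _ hi).1)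
  · rw [List.getLast?_eq_getElem?, hlast]

end ReductionString

theorem mainTheorem9 :
    LogspaceManyOneReduces (ccavExact firstLast) exactPerfectBipartiteBMatching := by
  refine ⟨ReductionString.reduction, ReductionString.logspaceComputable_reduction, fun x => ?_⟩
  constructor
  · rintro ⟨I, rfl, hI⟩
    obtain ⟨ha, hm⟩ := I.exactControl_iff.1 hI
    exact ⟨I.graph, (ReductionString.reduction_encode ha).symm, hm⟩
  · rintro ⟨G, hG, hm⟩
    -- Rejected strings are sent to the empty string, which is no code, since every code starts with
    -- a delimited unary number.
    have hx : (ReductionString.valid x && ReductionString.admissible x) = true := by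
      by_contra h
      rw [ReductionString.reduction, if_neg h] at hG
      exact G.encode_ne_nil hG
    rw [Bool.and_eq_true] at hx
    obtain ⟨I, rfl⟩ := ReductionString.exists_encode_eq hx.1
    have ha := ReductionString.admissible_encode.1 hx.2
    rw [ReductionString.reduction_encode ha] at hG
    obtain rfl := BMatchingInstance.encode_injective hG
    exact ⟨I, rfl, I.exactControl_iff.2 ⟨ha, hm⟩⟩
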